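/- **Setting.** Let $d\ge 1$, let $\mathbb S^d\subset\mathbb R^{d+1}$ be the unit sphere with surface measure $\nu$, and let $\mu$ be the normalized Haar measure on $SO(d+1)$. For $l\in\mathbb N_0$ let $\mathfrak B^l$ be the space of restrictions to $\mathbb S^d$ of complex homogeneous harmonic polynomials of degree $l$ in $d+1$ variables, $N(d,l)=\dim\mathfrak B^l$, and let $\{B^l_q:1\le q\le N(d,l)\}$ be any basis of $\mathfrak B^l$ that is orthonormal in $L^2(\mathbb S^d,\nu)$. Put $\phi^l_q(f)=\int f\,\overline{B^l_q}\,d\nu$; the Fourier–Laplace series of $f$ is $\sum_{l\ge0}\big(\sum_q\phi^l_q(f)B^l_q\big)$. For $g$ on $SO(d+1)$ let $\tilde\phi^l(g)$ be the $N(d,l)\times N(d,l)$ matrix with entries $\int g(u)D^l_{qr}(u)\,d\mu(u)$, where $D^l_{qr}(u)=\int\overline{B^l_q(ux)}\,B^l_r(x)\,d\nu(x)$. Let $X$ be a random element of $\mathbb S^d$ with density $f_X$ with respect to $\nu$, let $Y=m(X)+\epsilon$ with $\epsilon$ integrable and $E(\epsilon\mid X)=0$, and let $Z=UX$, where $U$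 is a random element of $SO(d+1)$, independent of $(X,\epsilon)$, with a square-integrable density $f_U$ with respect to $\mu$ such that $\tilde\phi^l(f_U)$ is invertible for every $l\in\mathbb N_0$. Let $(Y_1,Z_1),(Y_2,Z_2),\dots$ be i.i.d. with the law of $(Y,Z)$. For $T_n>0$ set $$K_{T_n}(x,z)=\sum_{0\le l\le T_n}\sum_{q}\Big(\sum_{r}\big(\tilde\phi^l(f_U)\big)^{-1}_{qr}\overline{B^l_r(z)}\Big)B^l_q(x),$$ $$\hat f_X(x)=\frac1n\sum_{i=1}^n\mathrm{Re}\,K_{T_n}(x,Z_i),\qquad \hat m(x)=\frac{1}{\hat f_X(x)}\,\frac1n\sum_{i=1}^n\mathrm{Re}\,K_{T_n}(x,Z_i)\,Y_i .$$ **Theorem.** Assume that there are constants $\beta\ge0$, $k\in\mathbb N$ with $k>d/4$, and $\delta>0$ such that: 1. (ordinary smoothness) for some $c_1>0$, $\|(\tilde\phi^l(f_U))^{-1}\|_{\rm op}\le c_1l^\beta$ for all $l\ge1$; 2. $f_X,m\in C^{2k}(\mathbb S^d)$, and $f_X$ is bounded away from zero; 3. for each $x\in\mathbb S^d$ there is $c>0$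 with $E\big((\mathrm{Re}\,K_{T_n}(x,Z))^2\big)\ge c\,T_n^{2\beta+d}$ for all $n\ge1$; 4. $E|Y|^{2+\delta}<\infty$, $E(|Y|^{2+\delta}\mid X)$ is bounded, and $E(\epsilon^2\mid X)$ is bounded away from zero (almost surely, by constants); 5. $T_n\asymp n^p$ for some $p$ with $\frac1{2\beta+d+8k}\le p<\frac1{2\beta+2d}$; 6. with $\Delta$ the Laplace–Beltrami operator of $\mathbb S^d$, the Fourier–Laplace series of $\Delta^kf_X$ and of $\Delta^k(m f_X)$ converge absolutely at every point, that is, $\sum_l\big|\sum_q\phi^l_q(g)B^l_q(x)\big|<\infty$ for every $x\in\mathbb S^d$ and $g\in\{\Delta^kf_X,\Delta^k(mf_X)\}$. Then, for every $x\in\mathbb S^d$, as $n\to\infty$, $$\sqrt n\cdot\frac{\hat m(x)-m(x)-E\big(\mathrm{Re}\,K_{T_n}(x,Z)\,(Y-m(x))\big)/f_X(x)}{\sqrt{\mathrm{Var}\big(\mathrm{Re}\,K_{T_n}(x,Z)\,(Y-m(x))\big)}\big/f_X(x)}\ \overset{d}{\longrightarrow}\ N(0,1).$$ -/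

import Mathlib

open MeasureTheory ProbabilityTheory Filter Topology
open scoped Manifold ComplexConjugate Matrix

noncomputable section

/-- The unit sphere `S^d` in `ℝ^{d+1}`. -/
abbrev USphere (d : ℕ) : Type := Metric.sphere (0 : EuclideanSpace ℝ (Fin (d + 1))) 1

/-- The surface measure `ν` on `S^d`, of total mass the area of `S^d`. -/
def sphereMeasure (d : ℕ) : Measure (USphere d) :=
  (volume : Measure (EuclideanSpace ℝ (Fin (d + 1)))).toSphere

/-- The group `SO(d+1)`, with the topology of the space of matrices. -/
abbrev SOGroup (d : ℕ) : Type := Matrix.specialOrthogonalGroup (Fin (d + 1)) ℝ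

theorem SOGroup.mul_transpose {d : ℕ} (u : SOGroup d) : u.1 * u.1ᵀ = 1 :=
  (Matrix.mem_orthogonalGroup_iff _ _).1 (Matrix.mem_specialOrthogonalGroup_iff.1 u.2).1

theorem SOGroup.transpose_mul {d : ℕ} (u : SOGroup d) : u.1ᵀ * u.1 = 1 :=
  (Matrix.mem_orthogonalGroup_iff' _ _).1 (Matrix.mem_specialOrthogonalGroup_iff.1 u.2).1

instance SOGroup.instMeasurableSpace (d : ℕ) : MeasurableSpace (SOGroup d) := borel _

instance SOGroup.instBorelSpace (d : ℕ) : BorelSpace (SOGroup d) := ⟨rfl⟩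

instance SOGroup.instIsTopologicalGroup (d : ℕ) : IsTopologicalGroup (SOGroup d) where
  continuous_mul :=
    Continuous.subtype_mk ((continuous_subtype_val.comp continuous_fst).matrix_mul
      (continuous_subtype_val.comp continuous_snd)) _
  continuous_inv := by
    have h : Continuous fun u : SOGroup d => u.1ᵀ := continuous_subtype_val.matrix_transpose
    exact Continuous.subtype_mk h _

instance SOGroup.instCompactSpace (d : ℕ) : CompactSpace (SOGroup d) := by
  let S : Set (Matrix (Fin (d + 1)) (Fin (d + 1)) ℝ) := {A | A * Aᵀ = 1 ∧ A.det = 1}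
  have hS : IsCompact S := by
    have hbig : IsCompact (Set.pi Set.univ fun _ : Fin (d + 1) =>
        Set.pi Set.univ fun _ : Fin (d + 1) => Set.Icc (-1 : ℝ) 1) :=
      isCompact_univ_pi fun _ => isCompact_univ_pi fun _ => isCompact_Icc
    refine IsCompact.of_isClosed_subset hbig ?_ ?_
    · refine IsClosed.inter ?_ ?_
      · exact isClosed_eq (continuous_id.matrix_mul continuous_id.matrix_transpose)
          continuous_const
      · exact isClosed_eq continuous_id.matrix_det continuous_const
    · intro A hA i _ j _
      have h1 : ∑ k, A i k * A i k = 1 := by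
        have := congrFun (congrFun hA.1 i) i
        simpa [Matrix.mul_apply] using this
      have h2 : A i j * A i j ≤ ∑ k, A i k * A i k :=
        Finset.single_le_sum (f := fun k => A i k * A i k)
          (fun k _ => mul_self_nonneg (A i k)) (Finset.mem_univ j)
      exact abs_le.1 (abs_le_one_iff_mul_self_le_one.2 (h1 ▸ h2))
  have hEq : S = {A | A ∈ Matrix.specialOrthogonalGroup (Fin (d + 1)) ℝ} := by
    ext A
    simp only [S, Set.mem_ofPred_eq, Matrix.mem_specialOrthogonalGroup_iff,
      Matrix.mem_orthogonalGroup_iff]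
  rw [hEq] at hS
  exact isCompact_iff_compactSpace.1 hS

/-- The normalized Haar measure `μ` on `SO(d+1)`. -/
def haarSO (d : ℕ) : Measure (SOGroup d) := Measure.haarMeasure ⊤

/-- The rotated point `u x` of the sphere (matrix times vector). -/
def rot {d : ℕ} (u : SOGroup d) (x : USphere d) : USphere d :=
  ⟨WithLp.toLp 2 (u.1 *ᵥ x.1.ofLp), by
    have hx : ‖x.1‖ ^ 2 = 1 := by simp
    have hxd : x.1.ofLp ⬝ᵥ x.1.ofLp = 1 := by
      rw [EuclideanSpace.norm_sq_eq] at hx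
      simpa [dotProduct, sq] using hx
    have h : ‖WithLp.toLp 2 (u.1 *ᵥ x.1.ofLp)‖ ^ 2 = 1 := by
      rw [EuclideanSpace.norm_sq_eq]
      have h2 : (u.1 *ᵥ x.1.ofLp) ⬝ᵥ (u.1 *ᵥ x.1.ofLp) = 1 := by
        rw [Matrix.dotProduct_mulVec, Matrix.vecMul_mulVec, u.transpose_mul, Matrix.vecMul_one, hxd]
      simpa [dotProduct, sq] using h2
    rw [mem_sphere_zero_iff_norm]
    exact (pow_eq_one_iff_of_nonneg (norm_nonneg _) two_ne_zero).1 h⟩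

/-- The space of spherical harmonics of degree `l` on `S^d`: restrictions to `S^d` of homogeneous
harmonic polynomials of degree `l` in `d + 1` variables with complex coefficients. -/
def sphericalHarmonics (d l : ℕ) : Submodule ℂ (USphere d → ℂ) where
  carrier := {f | ∃ p : MvPolynomial (Fin (d + 1)) ℂ, p.IsHomogeneous l ∧
    ∑ i, MvPolynomial.pderiv i (MvPolynomial.pderiv i p) = 0 ∧
    ∀ x : USphere d, f x = MvPolynomial.eval (fun i => ((x.1 i : ℝ) : ℂ)) p}
  zero_mem' := ⟨0, MvPolynomial.isHomogeneous_zero _ _ _, by simp, by simp⟩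
  add_mem' := by
    rintro f g ⟨p, hp, hp', hpf⟩ ⟨q, hq, hq', hqg⟩
    refine ⟨p + q, hp.add hq, ?_, fun x => by simp [hpf, hqg]⟩
    simp only [map_add, Finset.sum_add_distrib, hp', hq', add_zero]
  smul_mem' := by
    rintro c f ⟨p, hp, hp', hpf⟩
    refine ⟨c • p, (MvPolynomial.homogeneousSubmodule _ _ l).smul_mem c hp, ?_,
      fun x => by simp [hpf, MvPolynomial.smul_eval]⟩
    simp only [Derivation.map_smul, ← Finset.smul_sum, hp', smul_zero]

/-- `N(d, l)`, the dimension of the space of spherical harmonics of degree `l`. -/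
def harmDim (d l : ℕ) : ℕ := Module.finrank ℂ (sphericalHarmonics d l)

/-- A family of functions `B^l_q` on `S^d`, for `l ≥ 0` and `N(d, l)` values of `q`. -/
abbrev HarmFamily (d : ℕ) : Type := (l : ℕ) → Fin (harmDim d l) → USphere d → ℂ

/-- For every `l`, the `B^l_q` form a basis of the spherical harmonics of degree `l` which is
orthonormal in `L²(S^d, ν)`. -/
structure IsHarmONB {d : ℕ} (B : HarmFamily d) : Prop where
  span_eq : ∀ l, Submodule.span ℂ (Set.range (B l)) = sphericalHarmonics d l
  orthonormal : ∀ l q r,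
    ∫ x, B l q x * conj (B l r x) ∂(sphereMeasure d) = if q = r then 1 else 0

/-- The hyperspherical Fourier transform `φ^l_q(f) = ∫ f conj(B^l_q) dν`. -/
def harmFourier {d : ℕ} (B : HarmFamily d) (f : USphere d → ℝ) (l : ℕ) (q : Fin (harmDim d l)) :
    ℂ :=
  ∫ x, (f x : ℂ) * conj (B l q x) ∂(sphereMeasure d)

/-- The degree `l` term of the Fourier-Laplace series of `f`. -/
def fourierLaplaceTerm {d : ℕ} (B : HarmFamily d) (f : USphere d → ℝ) (l : ℕ) (x : USphere d) :
    ℂ :=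
  ∑ q, harmFourier B f l q * B l q x

/-- `D^l_{qr}(u) = ∫ conj(B^l_q(u x)) B^l_r(x) dν(x)`. -/
def rotCoeff {d : ℕ} (B : HarmFamily d) (l : ℕ) (q r : Fin (harmDim d l)) (u : SOGroup d) : ℂ :=
  ∫ x, conj (B l q (rot u x)) * B l r x ∂(sphereMeasure d)

/-- The rotational Fourier transform of `g` at degree `l`, the matrix with entries
`∫ g(u) D^l_{qr}(u) dμ(u)`. -/
def rotFourier {d : ℕ} (B : HarmFamily d) (g : SOGroup d → ℝ) (l : ℕ) :
    Matrix (Fin (harmDim d l)) (Fin (harmDim d l)) ℂ :=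
  Matrix.of fun q r => ∫ u, (g u : ℂ) * rotCoeff B l q r u ∂(haarSO d)

/-- The operator norm of a complex matrix with respect to the standard norm of `ℂ^n`. -/
def matOpNorm {n : ℕ} (A : Matrix (Fin n) (Fin n) ℂ) : ℝ :=
  ‖Matrix.toEuclideanCLM (n := Fin n) (𝕜 := ℂ) A‖

/-- The deconvolution kernel `K_T(x, z)`, where the sum is over the integers `0 ≤ l ≤ T`. -/
def deconvKernel {d : ℕ} (B : HarmFamily d) (fU : SOGroup d → ℝ) (T : ℝ) (x z : USphere d) : ℂ :=
  ∑ l ∈ Finset.range (⌊T⌋₊ + 1), ∑ q, (∑ r, (rotFourier B fU l)⁻¹ q r * conj (B l r z)) * B l q x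

/-- The deconvolution density estimator at `x`, based on `z_0, …, z_{n-1}`. -/
def densityEstimator {d : ℕ} (B : HarmFamily d) (fU : SOGroup d → ℝ) (T : ℝ) (n : ℕ)
    (z : ℕ → USphere d) (x : USphere d) : ℝ :=
  (n : ℝ)⁻¹ * ∑ i ∈ Finset.range n, (deconvKernel B fU T x (z i)).re

/-- The deconvolution regression estimator at `x`, based on `(y_0, z_0), …, (y_{n-1}, z_{n-1})`. -/
def regressionEstimator {d : ℕ} (B : HarmFamily d) (fU : SOGroup d → ℝ) (T : ℝ) (n : ℕ)
    (y : ℕ → ℝ) (z : ℕ → USphere d) (x : USphere d) : ℝ :=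
  (densityEstimator B fU T n z x)⁻¹ *
    ((n : ℝ)⁻¹ * ∑ i ∈ Finset.range n, (deconvKernel B fU T x (z i)).re * y i)

/-- The extension of a function on `S^d` to `ℝ^{d+1} ∖ {0}` that is constant along rays (with value
`0` at the origin). -/
def radialExtension {d : ℕ} (f : USphere d → ℝ) (y : EuclideanSpace ℝ (Fin (d + 1))) : ℝ :=
  if h : y = 0 then 0 else f ⟨‖y‖⁻¹ • y, by simp [norm_smul, norm_ne_zero_iff.2 h]⟩

/-- The Laplace-Beltrami operator of `S^d`: the Euclidean Laplacian of `y ↦ f (y / ‖y‖)`,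
restricted to `S^d`. -/
def laplaceBeltrami {d : ℕ} (f : USphere d → ℝ) : USphere d → ℝ :=
  fun x => Laplacian.laplacian (radialExtension f) x.1

/-- `f` is a (nonnegative, measurable) density of the measure `law` with respect to `ref`. -/
def IsDensityOf {α : Type*} [MeasurableSpace α] (f : α → ℝ) (law ref : Measure α) : Prop :=
  Measurable f ∧ (∀ a, 0 ≤ f a) ∧ law = ref.withDensity fun a => ENNReal.ofReal (f a)

end

/-! Write `κ n` for the real part of the kernel at level `T n` and the fixed point `x`, `W n = κ n
(Z) (Y - m x)`, `μ n` and `v n` for the mean and variance of `W n`, `F n` for the density estimator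
at `x`, and `b n = E κ n (Z) - f_X x`. Wherever `F n` and `v n` are nonzero, the studentized error
equals exactly `(A n - √n μ n (F n - f_X x) / (√(v n) f_X x)) * (f_X x / F n)`, where `A n` is the
standardized sum of `n` independent copies of `W n`. So it suffices that `A n` is asymptotically
normal (Lyapunov's condition), that `F n → f_X x` in probability (then Slutsky applies), and that
the cross term tends to zero in `L²`. This reduction is `tendstoInDistribution_ratio`.

The means are computed by harmonic analysis. A rotation acts on harmonics of degree `l` through the
matrix `D^l(u)`. Since `U` is independent of `X`, averaging produces the rotational Fourier matrix
of `f_U`, which the kernel inverts; what remains is a partial Fourier-Laplace sum of `g f_X`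
(`IsHarmONB.integral_deconvKernel`). Hence `μ n` and `b n` are truncation remainders. As `Δ^k`
multiplies the degree `l` term by `(-l (l + d - 1))^k`, absolute convergence of the differentiated
series makes the remainders `o(T^{-2k})` (`IsHarmONB.tendsto_fourierLaplace_remainder`). The
eigenvalue relation and the orthogonality of different degrees both come from
`integral_laplacian_mul_harmonic`; that the series sums to the function comes from the addition
theorem, Bessel's inequality, the condition `k > d/4` and Stone-Weierstrass.

The sizes are controlled as follows. The addition theorem, the dimension bound and ordinary
smoothness give `|κ n| ≤ C (T n + 1)^{β + d}`, which is `o(√n)` by the upper bound on `p`. The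
conditional moment conditions give `v n ≥ c E κ n (Z)²` eventually, and `E |W n|^{2+δ'}` is at most
a constant times `‖κ n‖_∞^{δ'} E κ n (Z)²`, so Lyapunov's ratio is of order at most `(‖κ n‖_∞ /
√n)^{δ'}`. The second moment of the cross term is at most a constant times `μ n² + n μ n² b n² / v
n`. The last summand vanishes because `v n` is at least of order `T^{2β+d}` and the lower bound on
`p` gives `√n ≤ K T^{4k} √(T^{2β+d})`. -/

/-! ### Lyapunov's central limit theorem through characteristic functions. -/

/-- For `|x| ≤ 1` this is the cubic Taylor remainder, weakened to the exponent `2 + δ ≤ 3`. For `|x|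
> 1` every term is at most a multiple of `x²`, and `4` exceeds the total `1 + 1 + 1 + 1/2`. -/
theorem norm_cexp_sub_taylor_two_le {δ : ℝ} (hδ : 0 ≤ δ) (hδ1 : δ ≤ 1) (x : ℝ) :
    ‖Complex.exp (x * Complex.I) - (1 + x * Complex.I - (x : ℂ) ^ 2 / 2)‖ ≤ 4 * |x| ^ (2 + δ) := by
  rcases le_or_gt |x| 1 with hx | hx
  · have h := Complex.exp_bound (x := x * Complex.I) (by simpa using hx) (n := 3) (by norm_num)
    have h2 : ∑ m ∈ Finset.range 3, ((x : ℂ) * Complex.I) ^ m / (m.factorial : ℂ)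
        = 1 + x * Complex.I - (x : ℂ) ^ 2 / 2 := by
      simp [Finset.sum_range_succ, mul_pow]; ring
    rw [h2] at h
    have h3 : ‖(x : ℂ) * Complex.I‖ = |x| := by simp
    rw [h3] at h
    refine h.trans ?_
    have h4 : |x| ^ 3 ≤ |x| ^ (2 + δ) := by
      rw [← Real.rpow_natCast]
      exact Real.rpow_le_rpow_of_exponent_ge' (abs_nonneg x) hx (by linarith)
        (by push_cast; linarith)
    have h5 : 0 ≤ |x| ^ 3 := by positivity
    norm_num [Nat.factorial]
    linarith
  · have h1 : ‖Complex.exp (x * Complex.I)‖ = 1 := Complex.norm_exp_ofReal_mul_I x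
    have h2 : ‖1 + (x : ℂ) * Complex.I - (x : ℂ) ^ 2 / 2‖ ≤ 1 + |x| + |x| ^ 2 / 2 := by
      refine (norm_sub_le _ _).trans (add_le_add ((norm_add_le _ _).trans ?_) ?_) <;> simp
    have h4 : |x| ^ 2 ≤ |x| ^ (2 + δ) := by
      rw [← Real.rpow_natCast]
      exact Real.rpow_le_rpow_of_exponent_le hx.le (by push_cast; linarith)
    have := norm_sub_le (Complex.exp (x * Complex.I)) (1 + (x : ℂ) * Complex.I - (x : ℂ) ^ 2 / 2)
    nlinarith

/-- The pointwise bound is integrated at `s V`; mean zero and unit second moment turn the Taylor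
polynomial into `1 - s²/2`. -/
theorem norm_charFun_sub_taylor_two_le {Ω : Type*} [MeasurableSpace Ω] {P : Measure Ω}
    [IsProbabilityMeasure P] {V : Ω → ℝ} (hV : AEMeasurable V P) {δ : ℝ} (hδ : 0 ≤ δ)
    (hδ1 : δ ≤ 1) (h0 : P[V] = 0) (h1 : P[V ^ 2] = 1) (h2 : MemLp V 2 P)
    (hm : Integrable (fun ω => |V ω| ^ (2 + δ)) P) (s : ℝ) :
    ‖charFun (P.map V) s - (1 - (s : ℂ) ^ 2 / 2)‖
      ≤ 4 * |s| ^ (2 + δ) * ∫ ω, |V ω| ^ (2 + δ) ∂P := by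
  have hi1 : Integrable V P := h2.integrable (by norm_num)
  have hi2 : Integrable (fun ω => V ω ^ 2) P := h2.integrable_sq
  have e1 : ∫ ω, ((s * V ω : ℝ) : ℂ) * Complex.I ∂P = 0 := by
    rw [integral_mul_const, integral_complex_ofReal, integral_const_mul, h0]; simp
  have e2 : ∫ ω, ((s * V ω : ℝ) : ℂ) ^ 2 / 2 ∂P = (s : ℂ) ^ 2 / 2 := by
    have : ∀ ω, ((s * V ω : ℝ) : ℂ) ^ 2 / 2 = (((s ^ 2 / 2) * V ω ^ 2 : ℝ) : ℂ) := fun ω => by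
      push_cast; ring
    simp_rw [this]
    rw [integral_complex_ofReal, integral_const_mul]
    have : ∫ ω, V ω ^ 2 ∂P = 1 := h1
    rw [this]; push_cast; ring
  have i1 : Integrable (fun ω => ((s * V ω : ℝ) : ℂ) * Complex.I) P :=
    ((hi1.const_mul s).ofReal).mul_const _
  have i2 : Integrable (fun ω => ((s * V ω : ℝ) : ℂ) ^ 2 / 2) P := by
    have : ∀ ω, ((s * V ω : ℝ) : ℂ) ^ 2 / 2 = (((s ^ 2 / 2) * V ω ^ 2 : ℝ) : ℂ) := fun ω => by
      push_cast; ring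
    simp_rw [this]
    exact (hi2.const_mul _).ofReal
  have i0 : Integrable (fun ω => Complex.exp (((s * V ω : ℝ) : ℂ) * Complex.I)) P := by
    refine Integrable.of_bound (C := 1) ?_ ?_
    · exact (by fun_prop : AEMeasurable
        (fun ω => Complex.exp (((s * V ω : ℝ) : ℂ) * Complex.I)) P).aestronglyMeasurable
    · exact Eventually.of_forall fun ω => (Complex.norm_exp_ofReal_mul_I _).le
  have e0 : charFun (P.map V) s = ∫ ω, Complex.exp (((s * V ω : ℝ) : ℂ) * Complex.I) ∂P := by
    rw [charFun_apply_real, integral_map hV (by fun_prop)]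
    simp
  have e3 : charFun (P.map V) s - (1 - (s : ℂ) ^ 2 / 2) =
      ∫ ω, (Complex.exp (((s * V ω : ℝ) : ℂ) * Complex.I)
        - (1 + ((s * V ω : ℝ) : ℂ) * Complex.I - ((s * V ω : ℝ) : ℂ) ^ 2 / 2)) ∂P := by
    have i3 : Integrable (fun ω => 1 + ((s * V ω : ℝ) : ℂ) * Complex.I) P :=
      (integrable_const _).add i1
    have i4 : Integrable (fun ω => 1 + ((s * V ω : ℝ) : ℂ) * Complex.I
      - ((s * V ω : ℝ) : ℂ) ^ 2 / 2) P := i3.sub i2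
    rw [integral_sub i0 i4, integral_sub i3 i2, integral_add (integrable_const _) i1, e1, e2, e0]
    simp
  rw [e3, ← integral_const_mul]
  refine norm_integral_le_of_norm_le (hm.const_mul _) (Eventually.of_forall fun ω => ?_)
  refine (norm_cexp_sub_taylor_two_le hδ hδ1 _).trans (le_of_eq ?_)
  rw [abs_mul, Real.mul_rpow (abs_nonneg _) (abs_nonneg _)]
  ring

/-- A central limit theorem for triangular arrays with i.i.d. rows, under Lyapunov's condition. -/
theorem tendstoInDistribution_of_lyapunov {Ω : Type*} [MeasurableSpace Ω] {P : Measure Ω}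
    [IsProbabilityMeasure P] {V : ℕ → ℕ → Ω → ℝ} (hind : ∀ n, iIndepFun (V n) P)
    (hident : ∀ n i, IdentDistrib (V n i) (V n 0) P P) {δ : ℝ} (hδ : 0 < δ) (hδ1 : δ ≤ 1)
    (h0 : ∀ᶠ n in atTop, P[V n 0] = 0) (h1 : ∀ᶠ n in atTop, P[V n 0 ^ 2] = 1)
    (h2 : ∀ᶠ n in atTop, MemLp (V n 0) 2 P)
    (hm : ∀ᶠ n in atTop, Integrable (fun ω => |V n 0 ω| ^ (2 + δ)) P)
    (hlim : Tendsto (fun n : ℕ => (√(n : ℝ))⁻¹ ^ δ * ∫ ω, |V n 0 ω| ^ (2 + δ) ∂P) atTop (𝓝 0)) :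
    TendstoInDistribution (fun (n : ℕ) ω => (√(n : ℝ))⁻¹ * ∑ i ∈ Finset.range n, V n i ω) atTop
      (id : ℝ → ℝ) (fun _ => P) (gaussianReal 0 1) where
  forall_aemeasurable n :=
    .const_mul (Finset.aemeasurable_fun_sum _ fun _ _ => (hident n _).aemeasurable_fst) _
  aemeasurable_limit := aemeasurable_id
  tendsto := by
    refine ProbabilityMeasure.tendsto_iff_tendsto_charFun.2 fun t => ?_
    have e : ∀ n : ℕ, charFun (P.map fun ω => (√(n : ℝ))⁻¹ * ∑ i ∈ Finset.range n, V n i ω) t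
        = (charFun (P.map (V n 0)) ((√(n : ℝ))⁻¹ * t)) ^ n := fun n =>
      charFun_inv_sqrt_mul_sum (hind n) (hident n)
    simp only [ProbabilityMeasure.coe_mk, e, Measure.map_id, charFun_gaussianReal]
    have : Complex.exp (t * ((0 : ℝ) : ℂ) * Complex.I - ((1 : NNReal) : ℝ) * t ^ 2 / 2)
      = Complex.exp (-(t : ℂ) ^ 2 / 2) := by
      congr 1; push_cast; ring
    rw [this]
    -- The `n`-th power converges to `exp (-t²/2)` once its base is `1 - t²/(2n) + o(1/n)`. At `s =
    -- t/√n` the Taylor error is `1/n` times `4 |t|^(2+δ) (√n)^(-δ) E|V|^(2+δ)`, and Lyapunov's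
    -- condition sends that factor to zero.
    apply Complex.tendsto_pow_exp_of_isLittleO_sub_add_div
    rw [Asymptotics.isLittleO_iff]
    intro c hc
    have hlim' := hlim.const_mul (4 * |t| ^ (2 + δ))
    rw [mul_zero] at hlim'
    filter_upwards [h0, h1, h2, hm, hlim'.eventually (gt_mem_nhds hc), eventually_gt_atTop 0]
      with n h0 h1 h2 hm hn hn0
    have hb := norm_charFun_sub_taylor_two_le (hident n 0).aemeasurable_fst hδ.le hδ1 h0 h1 h2 hm
      ((√(n : ℝ))⁻¹ * t)
    have hn0' : (0 : ℝ) < n := by exact_mod_cast hn0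
    have hs : (√(n : ℝ))⁻¹ ^ 2 = 1 / n := by
      rw [inv_pow, Real.sq_sqrt hn0'.le]; simp
    have e1 : (1 : ℂ) - (((√(n : ℝ))⁻¹ * t : ℝ) : ℂ) ^ 2 / 2 = 1 + (-(t : ℂ) ^ 2 / 2) / n := by
      have : (((√(n : ℝ))⁻¹ * t : ℝ) : ℂ) ^ 2 = (((1 / n : ℝ) * t ^ 2 : ℝ) : ℂ) := by
        rw [← hs]; push_cast; ring
      rw [this]; push_cast; ring
    rw [e1] at hb
    refine hb.trans ?_
    rw [abs_mul, Real.mul_rpow (abs_nonneg _) (abs_nonneg _), abs_of_nonneg (by positivity),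
      Real.rpow_add (by positivity)]
    rw [show (2 : ℝ) = ((2 : ℕ) : ℝ) by norm_num, Real.rpow_natCast, hs]
    push_cast
    have : ‖(1 / n : ℂ)‖ = 1 / n := by simp
    rw [this]
    calc _ = (4 * |t| ^ (2 + δ) * ((√(n : ℝ))⁻¹ ^ δ * ∫ ω, |V n 0 ω| ^ (2 + δ) ∂P)) * (1 / n) := by
          ring
      _ ≤ _ := by gcongr

/-! ### The surface measure: invariance under isometries and polar coordinates. -/

/-- The ambient Euclidean space `ℝ^{d+1}` of the sphere `S^d`. -/
abbrev Ambient (d : ℕ) : Type := EuclideanSpace ℝ (Fin (d + 1))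

instance (d : ℕ) : IsFiniteMeasure (sphereMeasure d) := by
  unfold sphereMeasure; infer_instance

instance (d : ℕ) : (sphereMeasure d).IsOpenPosMeasure := by
  unfold sphereMeasure; infer_instance

theorem sphereMeasure_real_univ_pos (d : ℕ) : 0 < (sphereMeasure d).real Set.univ := by
  have h : sphereMeasure d ≠ 0 := Measure.toSphere_ne_zero _
  have : NeZero (sphereMeasure d) := ⟨h⟩
  exact measureReal_univ_pos

/-- The action of a linear isometry on the sphere. -/
noncomputable def LinearIsometryEquiv.onSphere {d : ℕ} (T : Ambient d ≃ₗᵢ[ℝ] Ambient d) (x : USphere d) :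
    USphere d :=
  ⟨T x.1, by simp⟩

theorem LinearIsometryEquiv.continuous_onSphere {d : ℕ} (T : Ambient d ≃ₗᵢ[ℝ] Ambient d) :
    Continuous T.onSphere :=
  Continuous.subtype_mk (T.continuous.comp continuous_subtype_val) _

-- The surface measure of a set is a multiple of the Lebesgue measure of the cone over it. A linear
-- isometry commutes with forming cones and preserves Lebesgue measure.
open scoped Pointwise in
theorem LinearIsometryEquiv.measurePreserving_onSphere {d : ℕ} (T : Ambient d ≃ₗᵢ[ℝ] Ambient d) :
    MeasurePreserving T.onSphere (sphereMeasure d) (sphereMeasure d) := by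
  refine ⟨T.continuous_onSphere.measurable, ?_⟩
  ext s hs
  rw [Measure.map_apply T.continuous_onSphere.measurable hs, sphereMeasure,
    Measure.toSphere_apply' _ (T.continuous_onSphere.measurable hs), Measure.toSphere_apply' _ hs]
  congr 1
  have : Set.Ioo (0 : ℝ) 1 • (Subtype.val '' (T.onSphere ⁻¹' s) : Set (Ambient d))
      = T ⁻¹' (Set.Ioo (0 : ℝ) 1 • (Subtype.val '' s)) := by
    ext y
    simp only [Set.mem_smul, Set.mem_image, Set.mem_preimage, Subtype.exists]
    constructor
    · rintro ⟨r, hr, _, ⟨z, hz, hzs, rfl⟩, rfl⟩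
      exact ⟨r, hr, T z, ⟨T z, by simpa using hz, hzs, rfl⟩, by simp⟩
    · rintro ⟨r, hr, _, ⟨z, hz, hzs, rfl⟩, hy⟩
      refine ⟨r, hr, T.symm z, ⟨T.symm z, by simpa using hz, ?_, rfl⟩, ?_⟩
      · simpa [LinearIsometryEquiv.onSphere] using hzs
      · apply T.injective; simpa using hy
  rw [this]
  exact T.measurePreserving.measure_preimage_emb T.toHomeomorph.measurableEmbedding _

theorem LinearIsometryEquiv.integral_onSphere {d : ℕ} (T : Ambient d ≃ₗᵢ[ℝ] Ambient d)
    (f : USphere d → ℂ) :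
    ∫ x, f (T.onSphere x) ∂(sphereMeasure d) = ∫ x, f x ∂(sphereMeasure d) := by
  refine T.measurePreserving_onSphere.integral_comp ?_ f
  have h : Function.LeftInverse T.symm.onSphere T.onSphere := fun x => by
    apply Subtype.ext; simp [LinearIsometryEquiv.onSphere]
  have h' : Function.RightInverse T.symm.onSphere T.onSphere := fun x => by
    apply Subtype.ext; simp [LinearIsometryEquiv.onSphere]
  let e : USphere d ≃ₜ USphere d :=
    ⟨⟨T.onSphere, T.symm.onSphere, h, h'⟩, T.continuous_onSphere, T.symm.continuous_onSphere⟩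
  exact e.measurableEmbedding

/-- Linear isometries act transitively on the sphere. -/
theorem exists_onSphere_eq {d : ℕ} (x y : USphere d) :
    ∃ T : Ambient d ≃ₗᵢ[ℝ] Ambient d, T.onSphere x = y := by
  refine ⟨(ℝ ∙ (x.1 - y.1))ᗮ.reflection, Subtype.ext ?_⟩
  exact Submodule.reflection_sub (by simp)

/-- The rotation by `u ∈ SO(d+1)`, as a linear isometry. -/
theorem exists_isometry_eq_rot {d : ℕ} (u : SOGroup d) :
    ∃ T : Ambient d ≃ₗᵢ[ℝ] Ambient d, T.onSphere = rot u := by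
  let L : Ambient d →ₗ[ℝ] Ambient d := Matrix.toEuclideanLin u.1
  have hL : ∀ y, L y = WithLp.toLp 2 (u.1 *ᵥ y.ofLp) := fun y => rfl
  have hn : ∀ y, ‖L y‖ = ‖y‖ := fun y => by
    have h : ‖L y‖ ^ 2 = ‖y‖ ^ 2 := by
      rw [EuclideanSpace.norm_sq_eq, EuclideanSpace.norm_sq_eq]
      have h2 : (u.1 *ᵥ y.ofLp) ⬝ᵥ (u.1 *ᵥ y.ofLp) = y.ofLp ⬝ᵥ y.ofLp := by
        rw [Matrix.dotProduct_mulVec, Matrix.vecMul_mulVec, u.transpose_mul, Matrix.vecMul_one]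
      simpa [dotProduct, sq, hL] using h2
    exact (sq_eq_sq₀ (norm_nonneg _) (norm_nonneg _)).1 h
  let I : Ambient d →ₗᵢ[ℝ] Ambient d := ⟨L, hn⟩
  exact ⟨I.toLinearIsometryEquiv rfl, rfl⟩

theorem continuous_rot (d : ℕ) : Continuous fun p : SOGroup d × USphere d => rot p.1 p.2 := by
  refine Continuous.subtype_mk ?_ _
  refine (PiLp.continuous_toLp 2 _).comp ?_
  exact (continuous_subtype_val.comp continuous_fst).matrix_mulVec
    ((PiLp.continuous_ofLp 2 _).comp (continuous_subtype_val.comp continuous_snd))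

/-- The radial projection to the sphere (with a junk value at the origin). -/
noncomputable def sphereDir {d : ℕ} (y : Ambient d) : USphere d :=
  if h : y = 0 then ⟨EuclideanSpace.single 0 1, by simp⟩
  else ⟨‖y‖⁻¹ • y, by simp [norm_smul, norm_ne_zero_iff.2 h]⟩

theorem sphereDir_coe {d : ℕ} {y : Ambient d} (h : y ≠ 0) : (sphereDir y).1 = ‖y‖⁻¹ • y := by
  simp [sphereDir, h]

theorem norm_smul_sphereDir {d : ℕ} {y : Ambient d} (h : y ≠ 0) : ‖y‖ • (sphereDir y).1 = y := by
  rw [sphereDir_coe h, smul_smul, mul_inv_cancel₀ (norm_ne_zero_iff.2 h), one_smul]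

/-- Integration in polar coordinates of the product of an angular and a radial function. -/
theorem integral_polar {d : ℕ} (f : USphere d → ℂ) (g : ℝ → ℂ) (F : Ambient d → ℂ)
    (hF : ∀ y, y ≠ 0 → F y = f (sphereDir y) * g ‖y‖) :
    ∫ y, F y = (∫ x, f x ∂(sphereMeasure d)) * ∫ r in Set.Ioi (0 : ℝ), (r : ℂ) ^ d * g r := by
  have e1 : ∫ y, F y = ∫ y : ({(0)}ᶜ : Set (Ambient d)), F y ∂(volume.comap Subtype.val) := by
    rw [integral_subtype_comap (measurableSet_singleton _).compl F, restrict_compl_singleton]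
  have e2 : ∫ y : ({(0)}ᶜ : Set (Ambient d)), F y ∂(volume.comap Subtype.val) =
      ∫ p : USphere d × Set.Ioi (0 : ℝ), f p.1 * g p.2
        ∂((sphereMeasure d).prod (.volumeIoiPow (Module.finrank ℝ (Ambient d) - 1))) := by
    rw [sphereMeasure, ← (volume : Measure (Ambient d)).measurePreserving_homeomorphUnitSphereProd.integral_comp
      (Homeomorph.measurableEmbedding _)]
    refine integral_congr_ae (Eventually.of_forall fun y => ?_)
    have hy : y.1 ≠ 0 := y.2
    simp only [homeomorphUnitSphereProd_apply_snd_coe]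
    rw [hF _ hy]
    congr 2
    apply Subtype.ext
    rw [sphereDir_coe hy]
    simp
  rw [e1, e2, integral_prod_mul (fun x => f x) fun r : Set.Ioi (0 : ℝ) => g r]
  congr 1
  simp only [Measure.volumeIoiPow, ENNReal.ofReal]
  rw [integral_withDensity_eq_integral_smul,
    integral_subtype_comap measurableSet_Ioi fun a : ℝ =>
      Real.toNNReal (a ^ (Module.finrank ℝ (Ambient d) - 1)) • g a]
  · refine setIntegral_congr_fun measurableSet_Ioi fun r hr => ?_
    have hr' : (0 : ℝ) ≤ r := le_of_lt hr
    simp [NNReal.smul_def, hr']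
  · exact (measurable_subtype_coe.pow_const _).real_toNNReal

/-! ### The Laplacian on polynomials. -/

namespace HarmonicPolynomial

open MvPolynomial

variable {σ : Type*} [Fintype σ]

/-- The Laplacian of a polynomial. -/
noncomputable def lap (p : MvPolynomial σ ℂ) : MvPolynomial σ ℂ := ∑ i, pderiv i (pderiv i p)

theorem lap_add (p q : MvPolynomial σ ℂ) : lap (p + q) = lap p + lap q := by
  simp [lap, Finset.sum_add_distrib]

theorem lap_sub (p q : MvPolynomial σ ℂ) : lap (p - q) = lap p - lap q := by
  simp [lap, Finset.sum_sub_distrib]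

theorem lap_smul (c : ℂ) (p : MvPolynomial σ ℂ) : lap (c • p) = c • lap p := by
  simp [lap, Finset.smul_sum]

theorem lap_zero : lap (0 : MvPolynomial σ ℂ) = 0 := by simp [lap]

theorem iterate_lap_sub (j : ℕ) (p q : MvPolynomial σ ℂ) :
    lap^[j] (p - q) = lap^[j] p - lap^[j] q := by
  induction j generalizing p q with
  | zero => rfl
  | succ j ih => simp [Function.iterate_succ_apply, lap_sub, ih]

theorem iterate_lap_smul (j : ℕ) (c : ℂ) (p : MvPolynomial σ ℂ) :
    lap^[j] (c • p) = c • lap^[j] p := by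
  induction j generalizing p with
  | zero => rfl
  | succ j ih => simp [Function.iterate_succ_apply, lap_smul, ih]

theorem _root_.MvPolynomial.IsHomogeneous.lap {p : MvPolynomial σ ℂ} {l : ℕ}
    (h : p.IsHomogeneous l) : (lap p).IsHomogeneous (l - 2) :=
  IsHomogeneous.sum _ _ _ fun i _ => (h.pderiv (i := i)).pderiv

theorem isHomogeneous_iterate_lap {p : MvPolynomial σ ℂ} {l : ℕ} (h : p.IsHomogeneous l) (j : ℕ) :
    (lap^[j] p).IsHomogeneous (l - 2 * j) := by
  induction j with
  | zero => simpa using h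
  | succ j ih =>
    rw [Function.iterate_succ_apply']
    have := ih.lap
    rwa [show l - 2 * j - 2 = l - 2 * (j + 1) by omega] at this

/-- Each Laplacian lowers the degree by two until it reaches zero, so after `l` applications only a
constant is left. The count is generous, but only nilpotency is needed. -/
theorem iterate_lap_eq_zero {p : MvPolynomial σ ℂ} {l : ℕ} (h : p.IsHomogeneous l) :
    lap^[l + 1] p = 0 := by
  rw [Function.iterate_succ_apply']
  have h0 : (lap^[l] p).IsHomogeneous 0 := by
    have := isHomogeneous_iterate_lap h l
    rwa [show l - 2 * l = 0 by omega] at this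
  obtain ⟨c, hc⟩ : ∃ c, lap^[l] p = C c :=
    ⟨_, (totalDegree_eq_zero_iff_eq_C).1 ((totalDegree_zero_iff_isHomogeneous _).2 h0)⟩
  simp [hc, lap]

/-- The squared norm, as a polynomial. -/
noncomputable def normSq (σ : Type*) [Fintype σ] : MvPolynomial σ ℂ := ∑ i, X i ^ 2

theorem isHomogeneous_normSq : (normSq σ).IsHomogeneous 2 :=
  IsHomogeneous.sum _ _ _ fun i _ => isHomogeneous_X_pow i 2

theorem pderiv_normSq (i : σ) : pderiv i (normSq σ) = 2 * X i := by
  classical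
  simp only [normSq, map_sum, pderiv_pow, pderiv_X]
  rw [Finset.sum_eq_single i]
  · simp
  · intro j _ hj; simp [hj]
  · simp

/-- The product rule yields the cross term `4 ∑ X i ∂_i q`, which Euler's identity evaluates to `4 m
q`. -/
theorem lap_normSq_mul {q : MvPolynomial σ ℂ} {m : ℕ} (hq : q.IsHomogeneous m) :
    lap (normSq σ * q) = ((2 * Fintype.card σ + 4 * m : ℕ) : ℂ) • q + normSq σ * lap q := by
  have h : ∀ i, pderiv i (pderiv i (normSq σ * q)) =
      2 * q + 4 * (X i * pderiv i q) + normSq σ * pderiv i (pderiv i q) := fun i => by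
    rw [pderiv_mul, map_add, pderiv_mul, pderiv_mul, pderiv_normSq]
    have : pderiv i (2 * X i : MvPolynomial σ ℂ) = 2 := by
      rw [show (2 : MvPolynomial σ ℂ) = C 2 from (map_ofNat C 2).symm, pderiv_C_mul]; simp
    rw [this]; ring
  simp only [lap, h, Finset.sum_add_distrib, ← Finset.mul_sum]
  rw [hq.sum_X_mul_pderiv]
  simp only [Finset.sum_const, Finset.card_univ, smul_eq_C_mul, nsmul_eq_mul]
  push_cast
  simp only [map_add, map_mul, map_natCast, map_ofNat]
  ring

/-- A nonzero factor picked up by the Laplacian of `|x|^{2j} h`. -/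
theorem lap_normSq_pow_mul {h : MvPolynomial σ ℂ} {m : ℕ} [Nonempty σ] (hh : h.IsHomogeneous m)
    (hl : lap h = 0) (j : ℕ) :
    ∃ c : ℕ, 0 < c ∧ lap (normSq σ ^ (j + 1) * h) = (c : ℂ) • (normSq σ ^ j * h) := by
  induction j with
  | zero =>
    refine ⟨2 * Fintype.card σ + 4 * m, by have := Fintype.card_pos (α := σ); omega, ?_⟩
    rw [zero_add, pow_one, lap_normSq_mul hh, hl]; simp
  | succ j ih =>
    obtain ⟨c, hc, e⟩ := ih
    refine ⟨2 * Fintype.card σ + 4 * (2 * (j + 1) + m) + c, by omega, ?_⟩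
    rw [pow_succ', mul_assoc, lap_normSq_mul ((isHomogeneous_normSq.pow (j + 1)).mul hh), e]
    rw [mul_smul_comm, ← mul_assoc, ← pow_succ', ← add_smul]
    push_cast; rfl

/-- The nonvanishing of `c` lets `Δ^j` be inverted on `|x|^{2j} h`; this peels off one harmonic
component of a polynomial at a time. -/
theorem iterate_lap_normSq_pow_mul {h : MvPolynomial σ ℂ} {m : ℕ} [Nonempty σ]
    (hh : h.IsHomogeneous m) (hl : lap h = 0) (j : ℕ) :
    ∃ c : ℂ, c ≠ 0 ∧ lap^[j] (normSq σ ^ j * h) = c • h := by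
  induction j with
  | zero => exact ⟨1, one_ne_zero, by simp⟩
  | succ j ih =>
    obtain ⟨c, hc, e⟩ := ih
    obtain ⟨c', hc', e'⟩ := lap_normSq_pow_mul hh hl j
    refine ⟨c' * c, mul_ne_zero (by exact_mod_cast hc'.ne') hc, ?_⟩
    rw [Function.iterate_succ_apply, e', iterate_lap_smul, e, smul_smul]

end HarmonicPolynomial

/-! ### Spherical harmonics: density in polynomials, conjugation, rotation invariance. -/

open HarmonicPolynomial

/-- The value of a complex polynomial at a point of `ℝ^{d+1}`. -/
noncomputable def polyEval {d : ℕ} (p : MvPolynomial (Fin (d + 1)) ℂ) (y : Ambient d) : ℂ :=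
  MvPolynomial.eval (fun i => ((y i : ℝ) : ℂ)) p

theorem mem_sphericalHarmonics {d l : ℕ} {f : USphere d → ℂ} :
    f ∈ sphericalHarmonics d l ↔ ∃ p : MvPolynomial (Fin (d + 1)) ℂ, p.IsHomogeneous l ∧
      lap p = 0 ∧ f = fun x => polyEval p x.1 :=
  ⟨fun ⟨p, h1, h2, h3⟩ => ⟨p, h1, h2, funext h3⟩, fun ⟨p, h1, h2, h3⟩ => ⟨p, h1, h2, congrFun h3⟩⟩

theorem polyEval_normSq {d : ℕ} (x : USphere d) :
    polyEval (HarmonicPolynomial.normSq (Fin (d + 1))) x.1 = 1 := by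
  have hx : ‖x.1‖ ^ 2 = 1 := by simp
  rw [EuclideanSpace.norm_sq_eq] at hx
  simp only [polyEval, HarmonicPolynomial.normSq, map_sum, map_pow, MvPolynomial.eval_X]
  have : ((∑ i, ‖x.1 i‖ ^ 2 : ℝ) : ℂ) = 1 := by rw [hx]; simp
  rw [← this]; push_cast
  refine Finset.sum_congr rfl fun i _ => ?_
  rw [Real.norm_eq_abs]
  norm_cast
  rw [sq_abs]

/-- On the sphere, polynomials are sums of spherical harmonics. -/
theorem polyEval_mem_iSup_sphericalHarmonics {d : ℕ} (p : MvPolynomial (Fin (d + 1)) ℂ) :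
    (fun x : USphere d => polyEval p x.1) ∈ ⨆ l, sphericalHarmonics d l := by
  -- Induction on the number of Laplacians needed to kill `p`. If `Δ^(j+1) p = 0`, then `h = Δ^j p`
  -- is harmonic, and subtracting a multiple of `|x|^{2j} h` leaves a polynomial killed by `Δ^j`. On
  -- the sphere `|x|^{2j} h` restricts to `h`.
  have key : ∀ (j : ℕ) (l : ℕ) (p : MvPolynomial (Fin (d + 1)) ℂ), p.IsHomogeneous l →
      lap^[j] p = 0 → (fun x : USphere d => polyEval p x.1) ∈ ⨆ l, sphericalHarmonics d l := by
    intro j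
    induction j with
    | zero =>
      intro l p _ h0
      have : p = 0 := h0
      have e : (fun x : USphere d => polyEval p x.1) = 0 := by
        ext; simp [this, polyEval]
      rw [e]; exact zero_mem _
    | succ j ih =>
      intro l p hp h0
      have hhom := isHomogeneous_iterate_lap hp j
      have hharm : lap (lap^[j] p) = 0 := by rwa [← Function.iterate_succ_apply' lap j p]
      obtain ⟨c, hc, e⟩ := iterate_lap_normSq_pow_mul hhom hharm j
      -- When `l < 2j`, the truncated degree `l - 2j` no longer makes `|x|^{2j} h` homogeneous of
      -- degree `l`. In that case `Δ^j p` already vanishes, since its predecessor has degree at most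
      -- one.
      rcases Nat.lt_or_ge l (2 * j) with hlt | hge
      · rcases j with _ | j
        · omega
        have h1 : lap^[j + 1] p = 0 := by
          have hj := isHomogeneous_iterate_lap hp j
          rw [Function.iterate_succ_apply']
          have hle : l - 2 * j ≤ 1 := by omega
          simp only [HarmonicPolynomial.lap]
          refine Finset.sum_eq_zero fun i _ => ?_
          have h2 : (MvPolynomial.pderiv i (lap^[j] p)).IsHomogeneous 0 := by
            have := hj.pderiv (i := i)
            rwa [show l - 2 * j - 1 = 0 by omega] at this
          rw [(MvPolynomial.totalDegree_eq_zero_iff_eq_C).1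
            ((MvPolynomial.totalDegree_zero_iff_isHomogeneous _).2 h2)]
          simp
        exact ih l p hp h1
      have hR : (HarmonicPolynomial.normSq (Fin (d + 1)) ^ j * lap^[j] p).IsHomogeneous l := by
        have := (isHomogeneous_normSq (σ := Fin (d + 1)).pow j).mul hhom
        rwa [show 2 * j + (l - 2 * j) = l by omega] at this
      have hq : (p - c⁻¹ • (HarmonicPolynomial.normSq (Fin (d + 1)) ^ j * lap^[j] p)).IsHomogeneous
          l := hp.sub ((MvPolynomial.homogeneousSubmodule _ _ l).smul_mem _ hR)
      have h1 := ih l _ hq (by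
        rw [iterate_lap_sub, iterate_lap_smul, e, smul_smul, inv_mul_cancel₀ hc, one_smul, sub_self])
      have h2 : (fun x : USphere d => polyEval (lap^[j] p) x.1) ∈ ⨆ l, sphericalHarmonics d l :=
        le_iSup (sphericalHarmonics d) (l - 2 * j)
          (mem_sphericalHarmonics.2 ⟨_, hhom, hharm, rfl⟩)
      have h3 := add_mem h1 (Submodule.smul_mem _ c⁻¹ h2)
      convert h3 using 1
      ext x
      have hx := polyEval_normSq x
      simp only [polyEval] at hx
      simp [polyEval, MvPolynomial.smul_eval, hx]
  rw [← MvPolynomial.sum_homogeneousComponent p]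
  have e : (fun x : USphere d => polyEval (∑ i ∈ Finset.range (p.totalDegree + 1),
      MvPolynomial.homogeneousComponent i p) x.1) = ∑ i ∈ Finset.range (p.totalDegree + 1),
      fun x : USphere d => polyEval (MvPolynomial.homogeneousComponent i p) x.1 := by
    ext x; simp [polyEval]
  rw [e]
  refine Submodule.sum_mem _ fun i _ => ?_
  have := MvPolynomial.homogeneousComponent_isHomogeneous i p
  exact key _ i _ this (iterate_lap_eq_zero this)

theorem conj_mem_sphericalHarmonics {d l : ℕ} {f : USphere d → ℂ}
    (hf : f ∈ sphericalHarmonics d l) : (fun x => conj (f x)) ∈ sphericalHarmonics d l := by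
  obtain ⟨p, h1, h2, rfl⟩ := mem_sphericalHarmonics.1 hf
  refine mem_sphericalHarmonics.2 ⟨MvPolynomial.map (starRingEnd ℂ) p, h1.map _, ?_, ?_⟩
  · simp only [lap, MvPolynomial.pderiv_map, ← map_sum]
    have : ∑ i, MvPolynomial.pderiv i (MvPolynomial.pderiv i p) = 0 := h2
    rw [this, map_zero]
  · ext x
    simp only [polyEval, MvPolynomial.eval_map]
    rw [← MvPolynomial.eval₂_id, MvPolynomial.hom_eval₂]
    simp

theorem pderiv_bind₁_linear {n : ℕ} (a : Fin n → Fin n → ℂ) (p : MvPolynomial (Fin n) ℂ)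
    (j : Fin n) :
    MvPolynomial.pderiv j (MvPolynomial.bind₁
        (fun i => ∑ k, MvPolynomial.C (a i k) * MvPolynomial.X k) p) =
      ∑ i, MvPolynomial.C (a i j) * MvPolynomial.bind₁
        (fun i => ∑ k, MvPolynomial.C (a i k) * MvPolynomial.X k) (MvPolynomial.pderiv i p) := by
  classical
  induction p using MvPolynomial.induction_on with
  | C c => simp
  | add p q hp hq => simp only [map_add, hp, hq, mul_add, Finset.sum_add_distrib]
  | mul_X p i hp =>
    rw [map_mul, MvPolynomial.pderiv_mul, hp]
    simp only [MvPolynomial.bind₁_X_right, map_sum, MvPolynomial.pderiv_mul,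
      MvPolynomial.pderiv_X, map_add, map_mul, mul_add, Finset.sum_add_distrib]
    congr 1
    · rw [Finset.sum_mul]
      exact Finset.sum_congr rfl fun _ _ => by ring
    · simp [Pi.single_apply, mul_comm]

/-- Composing with an orthogonal linear substitution preserves the degree and commutes with the
Laplacian: by the chain rule the second derivatives are contracted with `a aᵀ = 1`. -/
theorem onSphere_mem_sphericalHarmonics {d l : ℕ} {f : USphere d → ℂ}
    (hf : f ∈ sphericalHarmonics d l) (T : Ambient d ≃ₗᵢ[ℝ] Ambient d) :
    (fun x => f (T.onSphere x)) ∈ sphericalHarmonics d l := by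
  obtain ⟨p, h1, h2, rfl⟩ := mem_sphericalHarmonics.1 hf
  let b := EuclideanSpace.basisFun (Fin (d + 1)) ℝ
  let a : Fin (d + 1) → Fin (d + 1) → ℂ := fun i j => ((T (b j) i : ℝ) : ℂ)
  -- Orthonormality of the rows is Parseval's identity for the images of the basis under the inverse
  -- isometry.
  have ha : ∀ i i', ∑ j, a i j * a i' j = if i = i' then 1 else 0 := fun i i' => by
    have e : ∀ i j, T (b j) i = inner ℝ (T.symm (b i)) (b j) := fun i j => by
      rw [← T.inner_map_map, T.apply_symm_apply]
      simp [b, EuclideanSpace.inner_single_left]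
    have h := b.sum_inner_mul_inner (T.symm (b i)) (T.symm (b i'))
    rw [T.symm.inner_map_map, OrthonormalBasis.inner_eq_ite] at h
    simp only [a, e]
    rw [← Complex.ofReal_one, ← Complex.ofReal_zero, ← apply_ite Complex.ofReal,
      show (if i = i' then (1 : ℝ) else 0) = _ from h.symm]
    push_cast
    exact Finset.sum_congr rfl fun j _ => by rw [real_inner_comm (b j) (T.symm (b i'))]
  let φ := MvPolynomial.bind₁ (R := ℂ)
    (fun i => ∑ k, MvPolynomial.C (a i k) * MvPolynomial.X k)
  refine mem_sphericalHarmonics.2 ⟨φ p, ?_, ?_, ?_⟩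
  · have := h1.aeval (fun i => ∑ k, MvPolynomial.C (a i k) * MvPolynomial.X k) (n := 1)
      fun i => MvPolynomial.IsHomogeneous.sum _ _ _ fun k _ =>
        MvPolynomial.isHomogeneous_C_mul_X (a i k) k
    simpa [φ, MvPolynomial.aeval_eq_bind₁] using this
  · have e : ∀ j, MvPolynomial.pderiv j (MvPolynomial.pderiv j (φ p)) =
        ∑ i, ∑ i', MvPolynomial.C (a i j * a i' j) *
          φ (MvPolynomial.pderiv i' (MvPolynomial.pderiv i p)) := fun j => by
      simp only [φ]
      rw [pderiv_bind₁_linear, map_sum]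
      refine Finset.sum_congr rfl fun i _ => ?_
      rw [MvPolynomial.pderiv_C_mul, pderiv_bind₁_linear, Finset.mul_sum]
      refine Finset.sum_congr rfl fun i' _ => ?_
      rw [MvPolynomial.C_mul]; ring
    simp only [lap, e]
    rw [Finset.sum_comm]
    have h2' : ∑ i, MvPolynomial.pderiv i (MvPolynomial.pderiv i p) = 0 := h2
    calc _ = ∑ i, φ (MvPolynomial.pderiv i (MvPolynomial.pderiv i p)) := by
          refine Finset.sum_congr rfl fun i _ => ?_
          rw [Finset.sum_comm]
          simp_rw [← Finset.sum_mul, ← map_sum, ha]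
          simp
      _ = 0 := by rw [← map_sum, h2', map_zero]
  · ext x
    have hx : ∀ i, ((T x.1 i : ℝ) : ℂ) = ∑ k, a i k * ((x.1 k : ℝ) : ℂ) := fun i => by
      have : T x.1 = ∑ k, x.1 k • T (b k) := by
        conv_lhs => rw [← b.sum_repr x.1]
        simp [b]
      rw [this]
      simp [a, mul_comm]
    simp only [polyEval, φ]
    change MvPolynomial.eval₂Hom _ _ p = MvPolynomial.eval₂Hom _ _ (MvPolynomial.bind₁ _ p)
    rw [MvPolynomial.eval₂Hom_bind₁]
    congr 2
    funext i
    simp only [LinearIsometryEquiv.onSphere, hx]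
    simp

/-! ### The dimension of the spaces of spherical harmonics. -/

/-- The harmonic homogeneous polynomials of degree `l`. -/
noncomputable def harmonicSubmodule (d l : ℕ) : Submodule ℂ (MvPolynomial (Fin (d + 1)) ℂ) where
  carrier := {p | p.IsHomogeneous l ∧ lap p = 0}
  zero_mem' := ⟨MvPolynomial.isHomogeneous_zero _ _ _, lap_zero⟩
  add_mem' := fun ha hb => ⟨ha.1.add hb.1, by rw [lap_add, ha.2, hb.2, add_zero]⟩
  smul_mem' := fun c p hp =>
    ⟨(MvPolynomial.homogeneousSubmodule _ _ l).smul_mem c hp.1, by rw [lap_smul, hp.2, smul_zero]⟩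

/-- A harmonic polynomial is determined by its terms of degree at most one in the first variable. -/
theorem eq_zero_of_lap_eq_zero {d : ℕ} {p : MvPolynomial (Fin (d + 1)) ℂ} (hp : lap p = 0)
    (h : ∀ s : Fin (d + 1) →₀ ℕ, s 0 ≤ 1 → p.coeff s = 0) : p = 0 := by
  -- The coefficient of `Δp` at `t = s - 2e_0` is a nonzero multiple of the coefficient of `p` at
  -- `s` plus a combination of coefficients whose first exponent is `n - 2`. Since `Δp = 0`, the
  -- latter determine the former.
  have key : ∀ (n : ℕ) (s : Fin (d + 1) →₀ ℕ), s 0 = n → p.coeff s = 0 := by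
    intro n
    induction n using Nat.strong_induction_on with
    | _ n ih =>
      intro s hs
      rcases Nat.lt_or_ge n 2 with hn | hn
      · exact h s (by omega)
      let t : Fin (d + 1) →₀ ℕ := s - Finsupp.single 0 2
      have hst : s = t + Finsupp.single 0 1 + Finsupp.single 0 1 := by
        ext i
        rcases eq_or_ne i 0 with rfl | hi
        · simp [t]; omega
        · simp [t, hi.symm]
      have ht0 : t 0 = n - 2 := by simp [t, hs]
      have hc : (lap p).coeff t = 0 := by rw [hp]; simp
      simp only [lap, MvPolynomial.coeff_sum, MvPolynomial.coeff_pderiv] at hc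
      rw [Finset.sum_eq_single 0] at hc
      · rw [hst]
        simp only [mul_eq_zero] at hc
        rcases hc with (hc | hc) | hc
        · exact hc
        · exfalso
          have : ((t + Finsupp.single 0 1 : Fin (d + 1) →₀ ℕ) 0 + 1 : ℕ) = 0 := by exact_mod_cast hc
          omega
        · exfalso
          have : (t 0 + 1 : ℕ) = 0 := by exact_mod_cast hc
          omega
      · intro i _ hi
        have h0 : (t + Finsupp.single i 1 + Finsupp.single i 1 : Fin (d + 1) →₀ ℕ) 0 = n - 2 := by
          simp [ht0, hi]
        rw [ih (n - 2) (by omega) _ h0]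
        simp
      · simp
  ext s
  simpa using key _ s rfl

/-- The multi-indices of degree `l` whose first entry is at most one. -/
abbrev lowIndices (d l : ℕ) : Type := {s : Fin (d + 1) →₀ ℕ // s 0 ≤ 1 ∧ s.degree = l}

/-- Encoding of the elements of `lowIndices` by all their entries but the last. -/
def lowIndicesEncode (e l : ℕ) (s : lowIndices (e + 1) l) : Fin 2 × (Fin e → Fin (l + 1)) :=
  (⟨s.1 0, Nat.lt_succ_of_le s.2.1⟩, fun j => ⟨s.1 j.succ.castSucc,
    Nat.lt_succ_of_le ((Finsupp.le_degree _ _).trans s.2.2.le)⟩)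

theorem lowIndicesEncode_injective (e l : ℕ) : Function.Injective (lowIndicesEncode e l) := by
  intro s t h
  have h0 : s.1 0 = t.1 0 := congrArg Fin.val (congrArg Prod.fst h)
  have h1 : ∀ j : Fin e, s.1 j.succ.castSucc = t.1 j.succ.castSucc := fun j =>
    congrArg Fin.val (congrFun (congrArg Prod.snd h) j)
  have h2 : ∀ i : Fin (e + 1), s.1 i.castSucc = t.1 i.castSucc := fun i => by
    refine Fin.cases ?_ (fun j => h1 j) i
    simpa using h0
  have hd : s.1.degree = t.1.degree := s.2.2.trans t.2.2.symm
  rw [Finsupp.degree_eq_sum, Finsupp.degree_eq_sum, Fin.sum_univ_castSucc (fun i => s.1 i),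
    Fin.sum_univ_castSucc (fun i => t.1 i), Finset.sum_congr rfl fun i _ => h2 i] at hd
  apply Subtype.ext
  ext i
  refine Fin.lastCases (by omega) (fun i => h2 i) i

/-- A harmonic polynomial is determined by its coefficients with first exponent `0` or `1`. Once the
degree is fixed the last exponent is redundant, so there are two choices for the first and at most
`l + 1` for each of the `d - 1` in between. Restriction to the sphere can only lower the dimension,
so its injectivity plays no role. -/
theorem harmDim_le {d : ℕ} (hd : 1 ≤ d) (l : ℕ) : harmDim d l ≤ 2 * (l + 1) ^ (d - 1) := by
  obtain ⟨e, rfl⟩ : ∃ e, d = e + 1 := ⟨d - 1, by omega⟩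
  have : Finite (lowIndices (e + 1) l) := Finite.of_injective _ (lowIndicesEncode_injective e l)
  have : Fintype (lowIndices (e + 1) l) := Fintype.ofFinite _
  let Φ : harmonicSubmodule (e + 1) l →ₗ[ℂ] (lowIndices (e + 1) l → ℂ) :=
    { toFun := fun p s => p.1.coeff s.1
      map_add' := fun p q => by ext; simp
      map_smul' := fun c p => by ext; simp }
  have hΦ : Function.Injective Φ := by
    rw [← LinearMap.ker_eq_bot, LinearMap.ker_eq_bot']
    intro p hp
    apply Subtype.ext
    refine eq_zero_of_lap_eq_zero p.2.2 fun s hs => ?_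
    by_cases hl : s.degree = l
    · exact congrFun hp ⟨s, hs, hl⟩
    · exact p.2.1.coeff_eq_zero hl
  have hfin : Module.Finite ℂ (harmonicSubmodule (e + 1) l) := Module.Finite.of_injective Φ hΦ
  let Ψ : harmonicSubmodule (e + 1) l →ₗ[ℂ] (USphere (e + 1) → ℂ) :=
    { toFun := fun p x => polyEval p.1 x.1
      map_add' := fun p q => by ext; simp [polyEval]
      map_smul' := fun c p => by ext; simp [polyEval, MvPolynomial.smul_eval] }
  have hΨ : LinearMap.range Ψ = sphericalHarmonics (e + 1) l := by
    ext f
    rw [mem_sphericalHarmonics]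
    constructor
    · rintro ⟨p, rfl⟩
      exact ⟨p.1, p.2.1, p.2.2, rfl⟩
    · rintro ⟨p, h1, h2, rfl⟩
      exact ⟨⟨p, h1, h2⟩, rfl⟩
  calc harmDim (e + 1) l = Module.finrank ℂ (LinearMap.range Ψ) := by rw [hΨ]; rfl
    _ ≤ Module.finrank ℂ (harmonicSubmodule (e + 1) l) := LinearMap.finrank_range_le Ψ
    _ ≤ Module.finrank ℂ (lowIndices (e + 1) l → ℂ) := LinearMap.finrank_le_finrank_of_injective hΦ
    _ = Fintype.card (lowIndices (e + 1) l) := Module.finrank_pi ℂ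
    _ ≤ Fintype.card (Fin 2 × (Fin e → Fin (l + 1))) :=
      Fintype.card_le_of_injective _ (lowIndicesEncode_injective e l)
    _ = 2 * (l + 1) ^ (e + 1 - 1) := by simp

/-! ### Green's identity against a harmonic polynomial times a radial bump. -/

/-- The `i`-th coordinate vector. -/
noncomputable abbrev coordVec {d : ℕ} (i : Fin (d + 1)) : Ambient d := EuclideanSpace.single i 1

theorem polyEval_hasStrictFDerivAt {d : ℕ} (p : MvPolynomial (Fin (d + 1)) ℂ) (y : Ambient d) :
    ∃ L : Ambient d →L[ℝ] ℂ, HasFDerivAt (polyEval p) L y ∧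
      ∀ i, L (coordVec i) = polyEval (MvPolynomial.pderiv i p) y := by
  induction p using MvPolynomial.induction_on with
  | C c =>
    refine ⟨0, ?_, fun i => by simp [polyEval]⟩
    have : polyEval (MvPolynomial.C c : MvPolynomial (Fin (d + 1)) ℂ) = fun _ => c := by
      ext; simp [polyEval]
    rw [this]; exact hasFDerivAt_const c y
  | add p q hp hq =>
    obtain ⟨L, h1, h2⟩ := hp
    obtain ⟨M, h3, h4⟩ := hq
    refine ⟨L + M, ?_, fun i => by simp [h2, h4, polyEval]⟩
    have : polyEval (p + q) = polyEval p + polyEval q := by ext; simp [polyEval]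
    rw [this]; exact h1.add h3
  | mul_X p j hp =>
    obtain ⟨L, h1, h2⟩ := hp
    let c : Ambient d →L[ℝ] ℂ := Complex.ofRealCLM.comp (EuclideanSpace.proj j)
    have h3 : HasFDerivAt (fun y : Ambient d => ((y j : ℝ) : ℂ)) c y := c.hasFDerivAt
    have e : polyEval (p * MvPolynomial.X j) = polyEval p * fun y => ((y j : ℝ) : ℂ) := by
      ext; simp [polyEval]
    refine ⟨_, e ▸ h1.mul h3, fun i => ?_⟩
    classical
    rcases eq_or_ne i j with rfl | hij
    · simp [h2, c, polyEval]
    · simp [h2, c, polyEval, MvPolynomial.pderiv_X, hij.symm]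

theorem contDiff_polyEval {d : ℕ} (p : MvPolynomial (Fin (d + 1)) ℂ) {n : WithTop ℕ∞} :
    ContDiff ℝ n (polyEval p) := by
  induction p using MvPolynomial.induction_on with
  | C c =>
    have : polyEval (MvPolynomial.C c : MvPolynomial (Fin (d + 1)) ℂ) = fun _ => c := by
      ext; simp [polyEval]
    rw [this]; exact contDiff_const
  | add p q hp hq =>
    have : polyEval (p + q) = polyEval p + polyEval q := by ext; simp [polyEval]
    rw [this]; exact hp.add hq
  | mul_X p j hp =>
    let c : Ambient d →L[ℝ] ℂ := Complex.ofRealCLM.comp (EuclideanSpace.proj j)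
    have : polyEval (p * MvPolynomial.X j) = fun y => polyEval p y * c y := by
      ext; simp [polyEval, c]
    rw [this]; exact hp.mul c.contDiff

theorem polyEval_smul {d l : ℕ} {p : MvPolynomial (Fin (d + 1)) ℂ} (hp : p.IsHomogeneous l) (t : ℝ)
    (y : Ambient d) : polyEval p (t • y) = (t : ℂ) ^ l * polyEval p y := by
  simp only [polyEval, MvPolynomial.eval_eq, Finset.mul_sum]
  refine Finset.sum_congr rfl fun s hs => ?_
  have hl : ∑ i ∈ s.support, s i = l := (hp.degree_eq_sum_deg_support hs).symm
  simp only [PiLp.smul_apply, smul_eq_mul, Complex.ofReal_mul, mul_pow, Finset.prod_mul_distrib]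
  rw [Finset.prod_pow_eq_pow_sum, hl]
  ring

/-- A polynomial times a radial function. -/
noncomputable def polyRadial {d : ℕ} (p : MvPolynomial (Fin (d + 1)) ℂ) (ψ : ℝ → ℝ)
    (y : Ambient d) : ℂ :=
  polyEval p y * (ψ (‖y‖ ^ 2) : ℂ)

/-- The derivative is again a combination of polynomials times radial functions, so second
derivatives follow by applying the same rule again. -/
theorem polyRadial_hasLineDerivAt {d : ℕ} (p : MvPolynomial (Fin (d + 1)) ℂ) {ψ : ℝ → ℝ}
    (hψ : Differentiable ℝ ψ) (y : Ambient d) (i : Fin (d + 1)) :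
    HasLineDerivAt ℝ (polyRadial p ψ) (polyRadial (MvPolynomial.pderiv i p) ψ y
      + 2 * polyRadial (MvPolynomial.X i * p) (deriv ψ) y) y (coordVec i) := by
  obtain ⟨L, hL, hLi⟩ := polyEval_hasStrictFDerivAt p y
  have h1 : HasFDerivAt (fun y : Ambient d => ψ (‖y‖ ^ 2))
      (deriv ψ (‖y‖ ^ 2) • (2 • innerSL ℝ y)) y :=
    (hψ _).hasDerivAt.comp_hasFDerivAt y (hasStrictFDerivAt_norm_sq y).hasFDerivAt
  have h2 := (Complex.ofRealCLM.hasFDerivAt (x := ψ (‖y‖ ^ 2))).comp y h1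
  have h3 := (hL.mul h2).hasLineDerivAt (coordVec i)
  convert! h3 using 1
  simp [polyRadial, hLi, EuclideanSpace.inner_single_right, polyEval]
  ring

/-- A smooth function supported in `[1/2, 3/2]`. -/
structure IsRadialBump (ψ : ℝ → ℝ) : Prop where
  smooth : ContDiff ℝ (⊤ : ℕ∞) ψ
  supp : ∀ s, s ∉ Set.Icc (1 / 2 : ℝ) (3 / 2) → ψ s = 0

theorem IsRadialBump.deriv {ψ : ℝ → ℝ} (h : IsRadialBump ψ) : IsRadialBump (deriv ψ) where
  smooth := ((contDiff_infty_iff_deriv (𝕜 := ℝ)).1 h.smooth).2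
  supp s hs := by
    have : ψ =ᶠ[𝓝 s] fun _ => 0 := by
      filter_upwards [isClosed_Icc.isOpen_compl.mem_nhds hs] with t ht using h.supp t ht
    rw [this.deriv_eq]; simp

theorem IsRadialBump.differentiable {ψ : ℝ → ℝ} (h : IsRadialBump ψ) : Differentiable ℝ ψ :=
  h.smooth.differentiable (by simp)

theorem tsupport_polyRadial_subset {d : ℕ} (p : MvPolynomial (Fin (d + 1)) ℂ) {ψ : ℝ → ℝ}
    (hψ : IsRadialBump ψ) :
    tsupport (polyRadial p ψ) ⊆ {y | ‖y‖ ^ 2 ∈ Set.Icc (1 / 2 : ℝ) (3 / 2)} := by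
  refine closure_minimal ?_ (isClosed_Icc.preimage (by fun_prop : Continuous fun y : Ambient d =>
    ‖y‖ ^ 2))
  intro y hy
  by_contra h
  exact hy (by simp [polyRadial, hψ.supp _ h])

theorem tsupport_polyRadial_subset_compl {d : ℕ} (p : MvPolynomial (Fin (d + 1)) ℂ) {ψ : ℝ → ℝ}
    (hψ : IsRadialBump ψ) : tsupport (polyRadial p ψ) ⊆ {0}ᶜ := by
  intro y hy h0
  have := tsupport_polyRadial_subset p hψ hy
  have h0' : y = 0 := h0
  simp [h0'] at this
  linarith [this.1]

theorem hasCompactSupport_polyRadial {d : ℕ} (p : MvPolynomial (Fin (d + 1)) ℂ) {ψ : ℝ → ℝ}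
    (hψ : IsRadialBump ψ) : HasCompactSupport (polyRadial p ψ) := by
  refine IsCompact.of_isClosed_subset (isCompact_closedBall (0 : Ambient d) 2)
    (isClosed_tsupport _) fun y hy => ?_
  have := (tsupport_polyRadial_subset p hψ hy).2
  rw [mem_closedBall_zero_iff]
  nlinarith [norm_nonneg y]

theorem continuous_polyRadial {d : ℕ} (p : MvPolynomial (Fin (d + 1)) ℂ) {ψ : ℝ → ℝ}
    (hψ : IsRadialBump ψ) : Continuous (polyRadial p ψ) := by
  have h1 := (contDiff_polyEval p (n := 0)).continuous
  have h2 := hψ.smooth.continuous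
  unfold polyRadial
  fun_prop

/-- `F` may be singular at the origin, but the bump factor has compact support avoiding it, so the
product is continuous with compact support. -/
theorem integrable_mul_polyRadial {d : ℕ} (p : MvPolynomial (Fin (d + 1)) ℂ) {ψ : ℝ → ℝ}
    (hψ : IsRadialBump ψ) {F : Ambient d → ℂ} (hF : ContinuousOn F {0}ᶜ) :
    Integrable (fun y => F y * polyRadial p ψ y) := by
  refine Continuous.integrable_of_hasCompactSupport ?_ (hasCompactSupport_polyRadial p hψ).mul_left
  refine continuous_of_tsupport fun y hy => ?_
  have hy' : y ∈ ({0}ᶜ : Set (Ambient d)) :=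
    tsupport_polyRadial_subset_compl p hψ (tsupport_mul_subset_right hy)
  exact (hF.continuousAt (isOpen_compl_singleton.mem_nhds hy')).mul
    (continuous_polyRadial p hψ).continuousAt

/-- Integration by parts in one coordinate, without boundary terms: the support of the bump is
compact and misses the possible singularity of `F`. -/
theorem integral_mul_lineDeriv_polyRadial {d : ℕ} (p : MvPolynomial (Fin (d + 1)) ℂ) {ψ : ℝ → ℝ}
    (hψ : IsRadialBump ψ) {F F' : Ambient d → ℂ} (hF : ContinuousOn F {0}ᶜ)
    (hF' : ContinuousOn F' {0}ᶜ) (i : Fin (d + 1))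
    (h : ∀ y, y ≠ 0 → HasLineDerivAt ℝ F (F' y) y (coordVec i)) :
    ∫ y, F y * (polyRadial (MvPolynomial.pderiv i p) ψ y
      + 2 * polyRadial (MvPolynomial.X i * p) (deriv ψ) y)
      = -∫ y, F' y * polyRadial p ψ y := by
  have hi := (integrable_mul_polyRadial (MvPolynomial.pderiv i p) hψ hF).add
    ((integrable_mul_polyRadial (MvPolynomial.X i * p) hψ.deriv hF).const_mul 2)
  refine integral_bilinear_hasLineDerivAt_right_eq_neg_left_of_integrable
    (B := ContinuousLinearMap.mul ℝ ℂ) (v := coordVec i)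
    (integrable_mul_polyRadial p hψ hF') ?_ (integrable_mul_polyRadial p hψ hF) ?_ ?_
  · refine hi.congr (Eventually.of_forall fun y => ?_)
    simp only [Pi.add_apply, ContinuousLinearMap.mul_apply']
    ring
  · exact fun y hy => h y (tsupport_polyRadial_subset_compl p hψ hy)
  · exact fun y _ => polyRadial_hasLineDerivAt p hψ.differentiable y i

theorem polyEval_normSq_eq {d : ℕ} (y : Ambient d) :
    polyEval (HarmonicPolynomial.normSq (Fin (d + 1))) y = (‖y‖ : ℂ) ^ 2 := by
  simp only [polyEval, HarmonicPolynomial.normSq, map_sum, map_pow, MvPolynomial.eval_X]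
  rw [← Complex.ofReal_pow, EuclideanSpace.norm_sq_eq]
  push_cast
  refine Finset.sum_congr rfl fun i _ => ?_
  rw [Real.norm_eq_abs]
  norm_cast
  rw [sq_abs]

/-- The partial derivative in the `i`-th coordinate. -/
noncomputable def partialDeriv {d : ℕ} (i : Fin (d + 1)) (F : Ambient d → ℂ) (y : Ambient d) : ℂ :=
  fderiv ℝ F y (coordVec i)

theorem contDiffOn_partialDeriv {d : ℕ} {n m : WithTop ℕ∞} {F : Ambient d → ℂ}
    (hF : ContDiffOn ℝ n F {0}ᶜ) (hmn : m + 1 ≤ n) (i : Fin (d + 1)) :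
    ContDiffOn ℝ m (partialDeriv i F) {0}ᶜ :=
  (hF.fderiv_of_isOpen isOpen_compl_singleton hmn).clm_apply contDiffOn_const

theorem hasLineDerivAt_partialDeriv {d : ℕ} {n : WithTop ℕ∞} {F : Ambient d → ℂ}
    (hF : ContDiffOn ℝ n F {0}ᶜ) (hn : n ≠ 0) {y : Ambient d} (hy : y ≠ 0) (i : Fin (d + 1)) :
    HasLineDerivAt ℝ F (partialDeriv i F y) y (coordVec i) :=
  ((hF.contDiffAt (isOpen_compl_singleton.mem_nhds hy)).differentiableAt
    hn).hasFDerivAt.hasLineDerivAt _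

theorem laplacian_eq_sum_partialDeriv {d : ℕ} {F : Ambient d → ℂ} (hF : ContDiffOn ℝ 2 F {0}ᶜ)
    {y : Ambient d} (hy : y ≠ 0) :
    Laplacian.laplacian F y = ∑ i, partialDeriv i (partialDeriv i F) y := by
  have h1 := congrFun (InnerProductSpace.laplacian_eq_iteratedFDeriv_orthonormalBasis F
    (EuclideanSpace.basisFun (Fin (d + 1)) ℝ)) y
  rw [h1]
  refine Finset.sum_congr rfl fun i _ => ?_
  have h2 : DifferentiableAt ℝ (fderiv ℝ F) y :=
    ((hF.fderiv_of_isOpen isOpen_compl_singleton (m := 1) le_rfl).contDiffAt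
      (isOpen_compl_singleton.mem_nhds hy)).differentiableAt one_ne_zero
  rw [iteratedFDeriv_two_apply]
  unfold partialDeriv
  rw [fderiv_clm_apply h2 (differentiableAt_const _)]
  simp

theorem contDiffOn_laplacian {d : ℕ} {n m : WithTop ℕ∞} {F : Ambient d → ℂ}
    (hF : ContDiffOn ℝ n F {0}ᶜ) (hmn : m + 2 ≤ n) :
    ContDiffOn ℝ m (Laplacian.laplacian F) {0}ᶜ := by
  have h1 : ContDiffOn ℝ m (fun y => ∑ i, partialDeriv i (partialDeriv i F) y) {0}ᶜ :=
    ContDiffOn.sum fun i _ => contDiffOn_partialDeriv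
      (contDiffOn_partialDeriv hF (m := m + 1) (by rwa [add_assoc, one_add_one_eq_two]) i) le_rfl i
  refine h1.congr fun y hy => laplacian_eq_sum_partialDeriv (hF.of_le ?_) hy
  exact le_trans (by simp) hmn

/-- The left side is `Δ(q η(|y|²))` as produced by the derivative rule. Harmonicity removes the term
in `η`, Euler's identity produces the degree in the coefficient of `η'`, and `∑ y_i² = |y|²` gives
the term in `η''`. -/
theorem sum_polyRadial_second_deriv {d l : ℕ} {q : MvPolynomial (Fin (d + 1)) ℂ}
    (hq : q.IsHomogeneous l) (hl : lap q = 0) (η : ℝ → ℝ) (y : Ambient d) :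
    ∑ i, ((polyRadial (MvPolynomial.pderiv i (MvPolynomial.pderiv i q)) η y
        + 2 * polyRadial (MvPolynomial.X i * MvPolynomial.pderiv i q) (deriv η) y)
      + 2 * (polyRadial (MvPolynomial.pderiv i (MvPolynomial.X i * q)) (deriv η) y
        + 2 * polyRadial (MvPolynomial.X i * (MvPolynomial.X i * q)) (deriv (deriv η)) y)) =
    polyEval q y * ((4 * l + 2 * (d + 1)) * ((deriv η (‖y‖ ^ 2) : ℝ) : ℂ)
      + 4 * (‖y‖ : ℂ) ^ 2 * ((deriv (deriv η) (‖y‖ ^ 2) : ℝ) : ℂ)) := by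
  have e1 : ∑ i, polyEval (MvPolynomial.pderiv i (MvPolynomial.pderiv i q)) y = 0 := by
    have := congrArg (fun p => polyEval p y) hl
    simpa [lap, polyEval] using this
  have e2 : ∑ i, polyEval (MvPolynomial.X i * MvPolynomial.pderiv i q) y = l * polyEval q y := by
    have := congrArg (fun p => polyEval p y) hq.sum_X_mul_pderiv
    simpa [polyEval] using this
  have e3 : ∑ i, polyEval (MvPolynomial.X i * (MvPolynomial.X i * q)) y
      = (‖y‖ : ℂ) ^ 2 * polyEval q y := by
    rw [← polyEval_normSq_eq]
    simp [polyEval, HarmonicPolynomial.normSq, Finset.sum_mul, sq, mul_assoc]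
  have e4 : ∀ i, polyEval (MvPolynomial.pderiv i (MvPolynomial.X i * q)) y
      = polyEval q y + polyEval (MvPolynomial.X i * MvPolynomial.pderiv i q) y := fun i => by
    simp [polyEval]; ring
  simp only [polyRadial, e4, Finset.sum_add_distrib, ← Finset.mul_sum, ← Finset.sum_mul, e1, e2, e3]
  simp
  ring

/-- Green's identity against a harmonic polynomial times a radial bump function. -/
theorem integral_laplacian_mul_polyRadial {d l : ℕ} {q : MvPolynomial (Fin (d + 1)) ℂ}
    (hq : q.IsHomogeneous l) (hl : lap q = 0) {η : ℝ → ℝ} (hη : IsRadialBump η)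
    {F : Ambient d → ℂ} (hF : ContDiffOn ℝ 2 F {0}ᶜ) :
    ∫ y, Laplacian.laplacian F y * polyRadial q η y =
      ∫ y, F y * (polyEval q y * ((4 * l + 2 * (d + 1)) * ((deriv η (‖y‖ ^ 2) : ℝ) : ℂ)
        + 4 * (‖y‖ : ℂ) ^ 2 * ((deriv (deriv η) (‖y‖ ^ 2) : ℝ) : ℂ))) := by
  have c1 : ∀ i, ContDiffOn ℝ 1 (partialDeriv i F) {0}ᶜ := fun i =>
    contDiffOn_partialDeriv hF (by norm_num) i
  have c2 : ∀ i, ContDiffOn ℝ 0 (partialDeriv i (partialDeriv i F)) {0}ᶜ := fun i =>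
    contDiffOn_partialDeriv (c1 i) (by norm_num) i
  have key : ∀ i, ∫ y, F y * ((polyRadial (MvPolynomial.pderiv i (MvPolynomial.pderiv i q)) η y
        + 2 * polyRadial (MvPolynomial.X i * MvPolynomial.pderiv i q) (deriv η) y)
      + 2 * (polyRadial (MvPolynomial.pderiv i (MvPolynomial.X i * q)) (deriv η) y
        + 2 * polyRadial (MvPolynomial.X i * (MvPolynomial.X i * q)) (deriv (deriv η)) y)) =
      ∫ y, partialDeriv i (partialDeriv i F) y * polyRadial q η y := fun i => by
    have A := integral_mul_lineDeriv_polyRadial (MvPolynomial.pderiv i q) hη hF.continuousOn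
      (c1 i).continuousOn i fun y hy => hasLineDerivAt_partialDeriv hF two_ne_zero hy i
    have B := integral_mul_lineDeriv_polyRadial (MvPolynomial.X i * q) hη.deriv hF.continuousOn
      (c1 i).continuousOn i fun y hy => hasLineDerivAt_partialDeriv hF two_ne_zero hy i
    have C := integral_mul_lineDeriv_polyRadial q hη (c1 i).continuousOn
      (c2 i).continuousOn i fun y hy => hasLineDerivAt_partialDeriv (c1 i) one_ne_zero hy i
    have iA : Integrable fun y => F y * (polyRadial (MvPolynomial.pderiv i
        (MvPolynomial.pderiv i q)) η y
        + 2 * polyRadial (MvPolynomial.X i * MvPolynomial.pderiv i q) (deriv η) y) := by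
      refine ((integrable_mul_polyRadial (MvPolynomial.pderiv i (MvPolynomial.pderiv i q)) hη
        hF.continuousOn).add ((integrable_mul_polyRadial (MvPolynomial.X i * MvPolynomial.pderiv i q)
          hη.deriv hF.continuousOn).const_mul 2)).congr (Eventually.of_forall fun y => ?_)
      simp only [Pi.add_apply]; ring
    have iB : Integrable fun y => F y * (polyRadial (MvPolynomial.pderiv i
        (MvPolynomial.X i * q)) (deriv η) y
        + 2 * polyRadial (MvPolynomial.X i * (MvPolynomial.X i * q)) (deriv (deriv η)) y) := by
      refine ((integrable_mul_polyRadial (MvPolynomial.pderiv i (MvPolynomial.X i * q)) hη.deriv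
        hF.continuousOn).add ((integrable_mul_polyRadial
          (MvPolynomial.X i * (MvPolynomial.X i * q)) hη.deriv.deriv hF.continuousOn).const_mul
            2)).congr (Eventually.of_forall fun y => ?_)
      simp only [Pi.add_apply]; ring
    have i1 := integrable_mul_polyRadial (MvPolynomial.pderiv i q) hη (c1 i).continuousOn
    have i2 := integrable_mul_polyRadial (MvPolynomial.X i * q) hη.deriv (c1 i).continuousOn
    have e : ∀ y, partialDeriv i F y * (polyRadial (MvPolynomial.pderiv i q) η y
        + 2 * polyRadial (MvPolynomial.X i * q) (deriv η) y)
        = partialDeriv i F y * polyRadial (MvPolynomial.pderiv i q) η y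
          + 2 * (partialDeriv i F y * polyRadial (MvPolynomial.X i * q) (deriv η) y) := fun y => by
      ring
    simp_rw [e] at C
    rw [integral_add i1 (i2.const_mul 2), integral_const_mul] at C
    have e' : ∀ a b c : ℂ, a * (b + 2 * c) = a * b + 2 * (a * c) := fun a b c => by ring
    simp_rw [e' _ (_ + _) _]
    rw [integral_add iA (iB.const_mul 2), integral_const_mul, A, B]
    linear_combination -C
  have s1 : ∀ y : Ambient d, y ≠ 0 → Laplacian.laplacian F y * polyRadial q η y =
      ∑ i, partialDeriv i (partialDeriv i F) y * polyRadial q η y := fun y hy => by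
    rw [laplacian_eq_sum_partialDeriv hF hy, Finset.sum_mul]
  -- The expression of the Laplacian by partial derivatives is available only off the origin, which
  -- is a null set.
  have hae : ∀ᵐ y : Ambient d, y ≠ 0 := by
    simp [ae_iff]
  rw [integral_congr_ae (hae.mono s1), integral_finsetSum]
  · simp_rw [← key]
    rw [← integral_finsetSum]
    · simp_rw [← Finset.mul_sum, sum_polyRadial_second_deriv hq hl]
    · intro i _
      refine (((integrable_mul_polyRadial (MvPolynomial.pderiv i (MvPolynomial.pderiv i q)) hη
        hF.continuousOn).add ((integrable_mul_polyRadial (MvPolynomial.X i * MvPolynomial.pderiv i q)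
          hη.deriv hF.continuousOn).const_mul 2)).add
          (((integrable_mul_polyRadial (MvPolynomial.pderiv i (MvPolynomial.X i * q)) hη.deriv
        hF.continuousOn).add ((integrable_mul_polyRadial
          (MvPolynomial.X i * (MvPolynomial.X i * q)) hη.deriv.deriv hF.continuousOn).const_mul
            2)).const_mul 2)).congr (Eventually.of_forall fun y => ?_)
      simp only [Pi.add_apply]; ring
  · exact fun i _ => integrable_mul_polyRadial q hη (c2 i).continuousOn

/-! ### Homogeneous functions and the eigenvalue identity. -/

/-- A scaling relation with factor `c` becomes one with factor `c / t`. Fixing `t` and leaving `c`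
arbitrary allows the lemma to be applied to its own conclusion. -/
theorem partialDeriv_smul {d : ℕ} {F : Ambient d → ℂ} {t : ℝ} {c : ℂ} (ht : t ≠ 0)
    (h : ∀ y, y ≠ 0 → F (t • y) = c * F y) (i : Fin (d + 1)) {y : Ambient d} (hy : y ≠ 0) :
    partialDeriv i F (t • y) = (c / t) * partialDeriv i F y := by
  have h1 : (fun z => F (t • z)) =ᶠ[𝓝 y] fun z => c • F z := by
    filter_upwards [isOpen_compl_singleton.mem_nhds hy] with z hz using h z hz
  have h2 := h1.fderiv_eq (𝕜 := ℝ)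
  rw [fderiv_comp_smul, show (fun z => c • F z) = c • F from rfl,
    fderiv_const_smul_field] at h2
  have h3 := congrArg (fun L : Ambient d →L[ℝ] ℂ => L (coordVec i)) h2
  simp only [Pi.smul_apply, smul_apply, smul_eq_mul, Complex.real_smul] at h3
  have ht' : (t : ℂ) ≠ 0 := by exact_mod_cast ht
  unfold partialDeriv
  rw [div_mul_eq_mul_div, eq_div_iff ht', ← h3, mul_comm]

/-- The factor is a quotient rather than a power with exponent `a - 2`, because degree `a = 0`, the
case of radial extensions, is needed. -/
theorem laplacian_smul_of_homogeneous {d a : ℕ} {F : Ambient d → ℂ} (hF : ContDiffOn ℝ 2 F {0}ᶜ)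
    (ha : ∀ t : ℝ, 0 < t → ∀ y, y ≠ 0 → F (t • y) = (t : ℂ) ^ a * F y) {t : ℝ} (ht : 0 < t)
    {y : Ambient d} (hy : y ≠ 0) :
    Laplacian.laplacian F (t • y) = (t : ℂ) ^ a / (t : ℂ) ^ 2 * Laplacian.laplacian F y := by
  rw [laplacian_eq_sum_partialDeriv hF hy,
    laplacian_eq_sum_partialDeriv hF (smul_ne_zero ht.ne' hy), Finset.mul_sum]
  refine Finset.sum_congr rfl fun i _ => ?_
  rw [partialDeriv_smul ht.ne' (fun z hz => partialDeriv_smul ht.ne' (ha t ht) i hz) i hy]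
  rw [div_div, sq]

theorem IsRadialBump.apply_zero {ψ : ℝ → ℝ} (h : IsRadialBump ψ) : ψ 0 = 0 :=
  h.supp 0 (by norm_num)

theorem IsRadialBump.hasCompactSupport_sq {ψ : ℝ → ℝ} (h : IsRadialBump ψ) (u : ℝ → ℝ) :
    HasCompactSupport fun r => u r * ψ (r ^ 2) := by
  refine HasCompactSupport.intro (isCompact_Icc (a := (-2 : ℝ)) (b := 2)) fun r hr => ?_
  rw [h.supp, mul_zero]
  rintro ⟨-, h2⟩
  exact hr (abs_le.1 (by nlinarith [sq_abs r, abs_nonneg r]))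

theorem IsRadialBump.integrable_pow_mul {ψ : ℝ → ℝ} (h : IsRadialBump ψ) (k : ℕ) :
    Integrable fun r : ℝ => r ^ k * ψ (r ^ 2) := by
  have := h.smooth.continuous
  exact Continuous.integrable_of_hasCompactSupport (by fun_prop) (h.hasCompactSupport_sq _)

/-- The integral over the half-line of the derivative of `r^k ψ(r²)` vanishes. Writing `r^(k+1) (ψ /
r²)` in place of `r^(k-1) ψ` keeps the identity uniform in `k`, including `k = 0`. -/
theorem IsRadialBump.integral_pow_mul_deriv {ψ : ℝ → ℝ} (h : IsRadialBump ψ) (k : ℕ) :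
    (k : ℝ) * (∫ r in Set.Ioi (0 : ℝ), r ^ (k + 1) * (ψ (r ^ 2) / r ^ 2))
      + 2 * ∫ r in Set.Ioi (0 : ℝ), r ^ (k + 1) * _root_.deriv ψ (r ^ 2) = 0 := by
  have hs : ContDiff ℝ 1 ψ := h.smooth.of_le (by exact_mod_cast le_top)
  have hu : ContDiff ℝ 1 fun r : ℝ => r ^ k * ψ (r ^ 2) := by fun_prop
  have h1 := HasCompactSupport.integral_Ioi_deriv_eq hu (h.hasCompactSupport_sq _) 0
  have h2 : ∀ r : ℝ, _root_.deriv (fun r : ℝ => r ^ k * ψ (r ^ 2)) r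
      = k * (r ^ (k - 1) * ψ (r ^ 2)) + 2 * (r ^ (k + 1) * _root_.deriv ψ (r ^ 2)) := fun r => by
    have e1 : HasDerivAt (fun r : ℝ => ψ (r ^ 2)) (_root_.deriv ψ (r ^ 2) * (2 * r)) r := by
      have := (h.differentiable (r ^ 2)).hasDerivAt.comp r (hasDerivAt_pow 2 r)
      simpa [Function.comp_def] using this
    have := ((hasDerivAt_pow k r).mul e1).deriv
    change _root_.deriv ((fun r : ℝ => r ^ k) * fun r : ℝ => ψ (r ^ 2)) r = _
    rw [this]; ring
  simp_rw [h2] at h1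
  rw [integral_add ((h.integrable_pow_mul (k - 1)).integrableOn.const_mul _)
    ((h.deriv.integrable_pow_mul (k + 1)).integrableOn.const_mul _), integral_const_mul,
    integral_const_mul] at h1
  have h3 : (k : ℝ) * ∫ r in Set.Ioi (0 : ℝ), r ^ (k + 1) * (ψ (r ^ 2) / r ^ 2)
      = k * ∫ r in Set.Ioi (0 : ℝ), r ^ (k - 1) * ψ (r ^ 2) := by
    rcases k with _ | k
    · simp
    · congr 1
      refine setIntegral_congr_fun measurableSet_Ioi fun r hr => ?_
      have hr' : r ≠ 0 := ne_of_gt hr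
      simp only [Nat.add_sub_cancel]
      field_simp
      ring
  rw [h3, h1]
  simp [h.apply_zero]

/-- Positivity of the radial integrals is what permits them to be cancelled from Green's identity in
polar coordinates. -/
theorem exists_isRadialBump : ∃ η : ℝ → ℝ, IsRadialBump η ∧
    ∀ k : ℕ, 0 < ∫ r in Set.Ioi (0 : ℝ), r ^ k * (η (r ^ 2) / r ^ 2) := by
  let b : ContDiffBump (1 : ℝ) := ⟨1 / 4, 1 / 2, by norm_num, by norm_num⟩
  have hb : IsRadialBump b := ⟨b.contDiff, fun s hs => by
    have h : s ∉ Function.support b := by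
      rw [b.support_eq, Metric.mem_ball, Real.dist_eq]
      intro h
      have := abs_lt.1 h
      simp only [b] at this
      exact hs ⟨by linarith [this.1], by linarith [this.2]⟩
    simpa using h⟩
  refine ⟨b, hb, fun k => ?_⟩
  have hi : IntegrableOn (fun r : ℝ => r ^ k * (b (r ^ 2) / r ^ 2)) (Set.Ioi 0) := by
    refine Integrable.integrableOn ?_
    refine Continuous.integrable_of_hasCompactSupport ?_ ?_
    · have hc : HasCompactSupport fun r : ℝ => r ^ k * b (r ^ 2) := hb.hasCompactSupport_sq _
      refine continuous_of_tsupport fun r hr => ?_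
      have hr0 : r ≠ 0 := by
        rintro rfl
        have hz : (fun r : ℝ => r ^ k * (b (r ^ 2) / r ^ 2)) =ᶠ[𝓝 0] fun _ => 0 := by
          have : Set.Ioo (-1 / 2 : ℝ) (1 / 2) ∈ 𝓝 (0 : ℝ) := Ioo_mem_nhds (by norm_num) (by norm_num)
          filter_upwards [this] with r hr
          rw [hb.supp (r ^ 2)]
          · simp
          · rintro ⟨h1, -⟩
            nlinarith [hr.1, hr.2]
        exact (notMem_tsupport_iff_eventuallyEq.2 hz) hr
      have := b.continuous
      exact (continuousAt_id.pow k).mul (((this.comp (continuous_pow 2)).continuousAt).div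
        (continuousAt_id.pow 2) (pow_ne_zero 2 hr0))
    · have := hb.hasCompactSupport_sq fun r => r ^ k / r ^ 2
      have e : (fun r : ℝ => r ^ k * (b (r ^ 2) / r ^ 2)) = fun r => r ^ k / r ^ 2 * b (r ^ 2) := by
        funext r; ring
      rw [e]; exact this
  rw [setIntegral_pos_iff_support_of_nonneg_ae _ hi]
  · have hsub : Set.Ioo (9 / 10 : ℝ) 1 ⊆
        Function.support (fun r : ℝ => r ^ k * (b (r ^ 2) / r ^ 2)) ∩ Set.Ioi 0 := by
      intro r hr
      have h0 : 0 < r := by linarith [hr.1]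
      refine ⟨?_, h0⟩
      have h1 : 0 < b (r ^ 2) := by
        refine b.pos_of_mem_ball ?_
        rw [Metric.mem_ball, Real.dist_eq, abs_lt]
        simp only [b]
        constructor <;> nlinarith [hr.1, hr.2]
      exact ne_of_gt (by positivity)
    refine lt_of_lt_of_le ?_ (measure_mono hsub)
    simp; norm_num
  · refine (ae_restrict_iff' measurableSet_Ioi).2 (Eventually.of_forall fun r hr => ?_)
    have h0 : (0 : ℝ) < r := hr
    have := b.nonneg (x := r ^ 2)
    simp only [Pi.zero_apply]
    positivity

/-- Integrating the Laplacian of a homogeneous function against a spherical harmonic. -/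
theorem integral_laplacian_mul_harmonic {d a l : ℕ} (hd : 1 ≤ d) {F : Ambient d → ℂ}
    (hF : ContDiffOn ℝ 2 F {0}ᶜ)
    (ha : ∀ t : ℝ, 0 < t → ∀ y, y ≠ 0 → F (t • y) = (t : ℂ) ^ a * F y)
    {q : MvPolynomial (Fin (d + 1)) ℂ} (hq : q.IsHomogeneous l) (hl : lap q = 0) :
    ∫ x, Laplacian.laplacian F x.1 * polyEval q x.1 ∂(sphereMeasure d) =
      ((a : ℂ) - l) * (a + l + d - 1) * ∫ x, F x.1 * polyEval q x.1 ∂(sphereMeasure d) := by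
  obtain ⟨η, hη, hpos⟩ := exists_isRadialBump
  have hG := integral_laplacian_mul_polyRadial hq hl hη hF
  have hdir : ∀ {y : Ambient d}, y ≠ 0 → (sphereDir y).1 ≠ 0 := fun {y} _ h => by
    have := (sphereDir y).2
    rw [h] at this
    simp at this
  have hFp : ∀ {y : Ambient d}, y ≠ 0 → F y = (‖y‖ : ℂ) ^ a * F (sphereDir y).1 := fun {y} hy => by
    conv_lhs => rw [← norm_smul_sphereDir hy]
    exact ha _ (norm_pos_iff.2 hy) _ (hdir hy)
  have hLp : ∀ {y : Ambient d}, y ≠ 0 → Laplacian.laplacian F y =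
      (‖y‖ : ℂ) ^ a / (‖y‖ : ℂ) ^ 2 * Laplacian.laplacian F (sphereDir y).1 := fun {y} hy => by
    conv_lhs => rw [← norm_smul_sphereDir hy]
    exact laplacian_smul_of_homogeneous hF ha (norm_pos_iff.2 hy) (hdir hy)
  have hqp : ∀ {y : Ambient d}, y ≠ 0 → polyEval q y = (‖y‖ : ℂ) ^ l * polyEval q (sphereDir y).1 :=
    fun {y} hy => by
      conv_lhs => rw [← norm_smul_sphereDir hy]
      exact polyEval_smul hq _ _
  rw [integral_polar (fun x => Laplacian.laplacian F x.1 * polyEval q x.1)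
      (fun r => (r : ℂ) ^ a / (r : ℂ) ^ 2 * (r : ℂ) ^ l * ((η (r ^ 2) : ℝ) : ℂ)) _
      (fun y hy => by rw [polyRadial, hLp hy, hqp hy]; ring),
    integral_polar (fun x => F x.1 * polyEval q x.1)
      (fun r => (r : ℂ) ^ a * (r : ℂ) ^ l * ((4 * l + 2 * (d + 1)) * ((deriv η (r ^ 2) : ℝ) : ℂ)
        + 4 * (r : ℂ) ^ 2 * ((deriv (deriv η) (r ^ 2) : ℝ) : ℂ))) _
      (fun y hy => by rw [hFp hy, hqp hy]; ring)] at hG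
  -- In polar coordinates both sides of Green's identity split into an angular and a radial
  -- integral. `M` collects the powers of `r` from the volume element, `F` and `q`.
  set M := d + a + l with hM
  have e1 : ∫ r in Set.Ioi (0 : ℝ), (r : ℂ) ^ d * ((r : ℂ) ^ a / (r : ℂ) ^ 2 * (r : ℂ) ^ l
      * ((η (r ^ 2) : ℝ) : ℂ)) =
      ((∫ r in Set.Ioi (0 : ℝ), r ^ M * (η (r ^ 2) / r ^ 2) : ℝ) : ℂ) := by
    rw [← integral_complex_ofReal]
    refine integral_congr_ae (Eventually.of_forall fun r => ?_)
    simp only [hM]; push_cast; ring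
  have e2 : ∫ r in Set.Ioi (0 : ℝ), (r : ℂ) ^ d * ((r : ℂ) ^ a * (r : ℂ) ^ l *
        ((4 * l + 2 * (d + 1)) * ((deriv η (r ^ 2) : ℝ) : ℂ)
        + 4 * (r : ℂ) ^ 2 * ((deriv (deriv η) (r ^ 2) : ℝ) : ℂ))) =
      (((4 * l + 2 * (d + 1)) * (∫ r in Set.Ioi (0 : ℝ), r ^ M * deriv η (r ^ 2)) +
        4 * ∫ r in Set.Ioi (0 : ℝ), r ^ (M + 2) * deriv (deriv η) (r ^ 2) : ℝ) : ℂ) := by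
    rw [← integral_const_mul, ← integral_const_mul,
      ← integral_add ((hη.deriv.integrable_pow_mul M).integrableOn.const_mul _)
        ((hη.deriv.deriv.integrable_pow_mul (M + 2)).integrableOn.const_mul _),
      ← integral_complex_ofReal]
    refine integral_congr_ae (Eventually.of_forall fun r => ?_)
    simp only [hM]; push_cast; ring
  rw [e1, e2] at hG
  have k1 := hη.integral_pow_mul_deriv (M - 1)
  have k2 := hη.deriv.integral_pow_mul_deriv (M + 1)
  have k3 : ∫ r in Set.Ioi (0 : ℝ), r ^ (M + 1 + 1) * (deriv η (r ^ 2) / r ^ 2) =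
      ∫ r in Set.Ioi (0 : ℝ), r ^ M * deriv η (r ^ 2) := by
    refine setIntegral_congr_fun measurableSet_Ioi fun r hr => ?_
    have hr' : r ≠ 0 := ne_of_gt hr
    field_simp
    ring
  rw [k3] at k2
  rw [Nat.sub_add_cancel (by omega), Nat.cast_sub (by omega)] at k1
  have hJ := hpos M
  set J := ∫ r in Set.Ioi (0 : ℝ), r ^ M * (η (r ^ 2) / r ^ 2)
  set I1 := ∫ r in Set.Ioi (0 : ℝ), r ^ M * deriv η (r ^ 2)
  set I2 := ∫ r in Set.Ioi (0 : ℝ), r ^ (M + 1 + 1) * deriv (deriv η) (r ^ 2)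
  -- The radial relations `(M - 1) J + 2 I1 = 0` and `(M + 1) I1 + 2 I2 = 0` first reduce the left
  -- side to `2 (l - a) I1`, then to `(a - l) (M - 1) J`.
  have k4 : (4 * l + 2 * (d + 1)) * I1 + 4 * I2 = ((a : ℝ) - l) * (a + l + d - 1) * J := by
    have hMc : (M : ℝ) = d + a + l := by rw [hM]; push_cast; ring
    push_cast at k1 k2
    rw [hMc] at k1 k2
    linear_combination 2 * k2 - (a - l) * k1
  rw [k4] at hG
  have hJ' : (J : ℂ) ≠ 0 := by exact_mod_cast hJ.ne'
  refine mul_right_cancel₀ hJ' ?_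
  rw [hG]
  push_cast
  ring

/-! ### Radial extensions and the Laplace-Beltrami operator. -/

theorem radialExtension_eq {d : ℕ} (f : USphere d → ℝ) {y : Ambient d} (hy : y ≠ 0) :
    radialExtension f y = f (sphereDir y) := by
  simp [radialExtension, sphereDir, hy]

theorem USphere.coe_ne_zero {d : ℕ} (x : USphere d) : x.1 ≠ 0 := by
  intro h
  have := x.2
  rw [h] at this
  simp at this

theorem sphereDir_coe_sphere {d : ℕ} (x : USphere d) : sphereDir x.1 = x := by
  apply Subtype.ext
  rw [sphereDir_coe x.coe_ne_zero]
  simp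

theorem radialExtension_coe {d : ℕ} (f : USphere d → ℝ) (x : USphere d) :
    radialExtension f x.1 = f x := by
  rw [radialExtension_eq f x.coe_ne_zero, sphereDir_coe_sphere]

theorem sphereDir_smul {d : ℕ} {t : ℝ} (ht : 0 < t) {y : Ambient d} (hy : y ≠ 0) :
    sphereDir (t • y) = sphereDir y := by
  apply Subtype.ext
  rw [sphereDir_coe hy, sphereDir_coe (smul_ne_zero ht.ne' hy), norm_smul, smul_smul,
    Real.norm_of_nonneg ht.le, mul_inv, mul_assoc, mul_comm, mul_assoc, mul_inv_cancel₀ ht.ne',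
    mul_one]

theorem contDiffOn_radialExtension {d n : ℕ} {f : USphere d → ℝ}
    (hf : ContMDiff (𝓡 d) 𝓘(ℝ, ℝ) (n : WithTop ℕ∞) f) :
    ContDiffOn ℝ n (radialExtension f) {0}ᶜ := by
  intro y₀ hy₀
  have hy₀' : 0 < ‖y₀‖ := norm_pos_iff.2 hy₀
  refine ContDiffAt.contDiffWithinAt ?_
  let χ : ContDiffBump y₀ := ⟨‖y₀‖ / 4, ‖y₀‖ / 2, by positivity, by linarith⟩
  -- A globally smooth map into the sphere is needed, while `y / ‖y‖` is smooth only off the origin.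
  -- `G` is the identity near `y₀` and stays within distance less than `‖y₀‖` of `y₀`, so it never
  -- vanishes and can be normalized everywhere.
  let G : Ambient d → Ambient d := fun y => y₀ + χ y • (y - y₀)
  have hG : ContDiff ℝ n G := by
    have := χ.contDiff (n := n)
    fun_prop
  have hG0 : ∀ y, G y ≠ 0 := fun y h0 => by
    have h1 : ‖χ y • (y - y₀)‖ < ‖y₀‖ := by
      by_cases hy : y ∈ Metric.ball y₀ (‖y₀‖ / 2)
      · rw [norm_smul, Real.norm_of_nonneg χ.nonneg]
        rw [Metric.mem_ball, dist_eq_norm] at hy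
        have h2 : χ y ≤ 1 := χ.le_one
        nlinarith [norm_nonneg (y - y₀), χ.nonneg (x := y)]
      · have : χ y = 0 := χ.zero_of_le_dist (by simpa using hy)
        rw [this]; simpa using hy₀'
    have h2 : χ y • (y - y₀) = -y₀ := (neg_eq_of_add_eq_zero_right h0).symm
    rw [h2, norm_neg] at h1
    exact lt_irrefl _ h1
  let H : Ambient d → Ambient d := fun y => ‖G y‖⁻¹ • G y
  have hH : ContDiff ℝ n H :=
    ((hG.norm ℝ hG0).inv fun y => norm_ne_zero_iff.2 (hG0 y)).smul hG
  have hHs : ∀ y, H y ∈ Metric.sphere (0 : Ambient d) 1 := fun y => by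
    simp [H, norm_smul, norm_ne_zero_iff.2 (hG0 y)]
  have : Fact (Module.finrank ℝ (Ambient d) = d + 1) := ⟨by simp⟩
  have h1 : ContMDiff 𝓘(ℝ, Ambient d) (𝓡 d) (n : WithTop ℕ∞)
      (Set.codRestrict H (Metric.sphere (0 : Ambient d) 1) hHs) :=
    hH.contMDiff.codRestrict_sphere hHs
  have h2 := (hf.comp h1).contDiff.contDiffAt (x := y₀)
  refine h2.congr_of_eventuallyEq ?_
  filter_upwards [χ.eventuallyEq_one, isOpen_compl_singleton.mem_nhds hy₀] with y h1 h2
  rw [radialExtension_eq f h2]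
  simp only [Function.comp]
  congr 1
  apply Subtype.ext
  rw [sphereDir_coe h2]
  have : G y = y := by
    simp only [G, h1, Pi.one_apply, one_smul]; abel
  simp [H, this]

theorem laplacian_ofReal_radialExtension {d : ℕ} {f : USphere d → ℝ}
    (hf : ContDiffOn ℝ 2 (radialExtension f) {0}ᶜ) {y : Ambient d} (hy : y ≠ 0) :
    Laplacian.laplacian (Complex.ofRealCLM ∘ radialExtension f) y =
      ((Laplacian.laplacian (radialExtension f) y : ℝ) : ℂ) :=
  (hf.contDiffAt (isOpen_compl_singleton.mem_nhds hy)).laplacian_CLM_comp_left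
    (l := Complex.ofRealCLM)

theorem contDiffOn_radialExtension_laplaceBeltrami {d : ℕ} {n m : WithTop ℕ∞} {f : USphere d → ℝ}
    (hf : ContDiffOn ℝ n (radialExtension f) {0}ᶜ) (hmn : m + 2 ≤ n) :
    ContDiffOn ℝ m (radialExtension (laplaceBeltrami f)) {0}ᶜ := by
  have hF : ContDiffOn ℝ n (Complex.ofRealCLM ∘ radialExtension f) {0}ᶜ :=
    Complex.ofRealCLM.contDiff.comp_contDiffOn hf
  have h1 := Complex.reCLM.contDiff.comp_contDiffOn (contDiffOn_laplacian hF hmn)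
  have h2 : ContDiffOn ℝ m (fun y : Ambient d => ‖y‖⁻¹ • y) {0}ᶜ := by
    have h3 : ContDiffOn ℝ m (fun y : Ambient d => ‖y‖) {0}ᶜ := contDiffOn_id.norm ℝ fun y hy => hy
    exact (h3.inv fun y hy => norm_ne_zero_iff.2 hy).smul contDiffOn_id
  have h4 := h1.comp h2 fun y hy => smul_ne_zero (inv_ne_zero (norm_ne_zero_iff.2 hy)) hy
  refine h4.congr fun y hy => ?_
  rw [radialExtension_eq _ hy]
  simp only [laplaceBeltrami, Function.comp]
  rw [← sphereDir_coe hy]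
  rw [laplacian_ofReal_radialExtension (hf.of_le (le_trans (by simp) hmn))
    (sphereDir y).coe_ne_zero]
  simp

theorem continuous_of_radialExtension {d : ℕ} {n : WithTop ℕ∞} {f : USphere d → ℝ}
    (hf : ContDiffOn ℝ n (radialExtension f) {0}ᶜ) : Continuous f := by
  have h : Continuous fun x : USphere d => radialExtension f x.1 :=
    hf.continuousOn.comp_continuous continuous_subtype_val fun x => x.coe_ne_zero
  simpa only [radialExtension_coe] using h

/-- The radial extension is homogeneous of degree `0`, so the eigenvalue identity with `a = 0`,
tested against the conjugate of `B l q`, gives the factor `-l (l + d - 1)`. -/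
theorem harmFourier_laplaceBeltrami {d : ℕ} (hd : 1 ≤ d) {B : HarmFamily d} (hB : IsHarmONB B)
    {f : USphere d → ℝ} (hf : ContDiffOn ℝ 2 (radialExtension f) {0}ᶜ) (l : ℕ)
    (q : Fin (harmDim d l)) :
    harmFourier B (laplaceBeltrami f) l q = -((l : ℂ) * (l + d - 1)) * harmFourier B f l q := by
  have hBm : B l q ∈ sphericalHarmonics d l := by
    rw [← hB.span_eq l]; exact Submodule.subset_span ⟨q, rfl⟩
  obtain ⟨p, hp, hpl, he⟩ := mem_sphericalHarmonics.1 (conj_mem_sphericalHarmonics hBm)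
  have hF : ContDiffOn ℝ 2 (Complex.ofRealCLM ∘ radialExtension f) {0}ᶜ :=
    Complex.ofRealCLM.contDiff.comp_contDiffOn hf
  have h := integral_laplacian_mul_harmonic hd (a := 0) hF (fun t ht y hy => by
    simp [radialExtension_eq _ hy, radialExtension_eq _ (smul_ne_zero ht.ne' hy),
      sphereDir_smul ht hy]) hp hpl
  have e : ∀ x, conj (B l q x) = polyEval p x.1 := fun x => congrFun he x
  simp only [harmFourier, e]
  convert! h using 1
  · refine integral_congr_ae (Eventually.of_forall fun x => ?_)
    simp only [laplaceBeltrami]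
    rw [laplacian_ofReal_radialExtension hf x.coe_ne_zero]
  · simp only [Function.comp, radialExtension_coe]
    push_cast
    simp

/-! ### Orthogonality, the addition theorem and Bessel's inequality. -/

theorem continuous_of_mem_sphericalHarmonics {d l : ℕ} {f : USphere d → ℂ}
    (hf : f ∈ sphericalHarmonics d l) : Continuous f := by
  obtain ⟨p, -, -, rfl⟩ := mem_sphericalHarmonics.1 hf
  exact (contDiff_polyEval p (n := 0)).continuous.comp continuous_subtype_val

theorem Continuous.integrable_sphereMeasure {d : ℕ} {E : Type*} [NormedAddCommGroup E]
    {f : USphere d → E} (hf : Continuous f) : Integrable f (sphereMeasure d) :=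
  hf.integrable_of_hasCompactSupport (HasCompactSupport.of_compactSpace f)

theorem Continuous.integrable_mul_sphereMeasure {d : ℕ} {f g : USphere d → ℂ} (hf : Continuous f)
    (hg : Continuous g) : Integrable (fun x => f x * g x) (sphereMeasure d) :=
  (hf.mul hg).integrable_sphereMeasure

theorem partialDeriv_polyEval {d : ℕ} (p : MvPolynomial (Fin (d + 1)) ℂ) (i : Fin (d + 1)) :
    partialDeriv i (polyEval p) = polyEval (MvPolynomial.pderiv i p) := by
  funext y
  obtain ⟨L, hL, hLi⟩ := polyEval_hasStrictFDerivAt p y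
  rw [partialDeriv, hL.fderiv, hLi]

theorem laplacian_polyEval {d : ℕ} (p : MvPolynomial (Fin (d + 1)) ℂ) {y : Ambient d} (hy : y ≠ 0) :
    Laplacian.laplacian (polyEval p) y = polyEval (lap p) y := by
  rw [laplacian_eq_sum_partialDeriv (contDiff_polyEval p).contDiffOn hy]
  simp only [partialDeriv_polyEval]
  simp [polyEval, lap]

/-- Spherical harmonics of different degrees are orthogonal. -/
theorem integral_mul_eq_zero_of_ne {d l l' : ℕ} (hd : 1 ≤ d) (hl : l ≠ l') {f g : USphere d → ℂ}
    (hf : f ∈ sphericalHarmonics d l) (hg : g ∈ sphericalHarmonics d l') :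
    ∫ x, f x * g x ∂(sphereMeasure d) = 0 := by
  obtain ⟨p, hp, hp', rfl⟩ := mem_sphericalHarmonics.1 hf
  obtain ⟨q, hq, hq', rfl⟩ := mem_sphericalHarmonics.1 hg
  -- With `F` itself a harmonic polynomial of degree `l`, the left side of the eigenvalue identity
  -- is zero. The factor `(l - l') (l + l' + d - 1)` is nonzero for `l ≠ l'` and `d ≥ 1`, so the
  -- integral must vanish.
  have h := integral_laplacian_mul_harmonic hd (contDiff_polyEval p).contDiffOn
    (fun t _ y _ => polyEval_smul hp t y) hq hq'
  have h0 : ∀ x : USphere d, Laplacian.laplacian (polyEval p) x.1 = 0 := fun x => by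
    rw [laplacian_polyEval p x.coe_ne_zero, hp']; simp [polyEval]
  simp only [h0, zero_mul, integral_zero] at h
  have h1 : ((l : ℂ) - l') * (l + l' + d - 1) ≠ 0 := by
    refine mul_ne_zero (sub_ne_zero.2 (by exact_mod_cast hl)) ?_
    have : ((l : ℂ) + l' + d - 1) = ((l + l' + (d - 1) : ℕ) : ℂ) := by
      push_cast [Nat.cast_sub hd]; ring
    rw [this]
    exact_mod_cast (by omega : l + l' + (d - 1) ≠ 0)
  exact (mul_eq_zero.1 h.symm).resolve_left h1

namespace IsHarmONB

variable {d : ℕ} {B : HarmFamily d}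

theorem mem (hB : IsHarmONB B) (l : ℕ) (q : Fin (harmDim d l)) :
    B l q ∈ sphericalHarmonics d l := by
  rw [← hB.span_eq l]; exact Submodule.subset_span ⟨q, rfl⟩

theorem continuous (hB : IsHarmONB B) (l : ℕ) (q : Fin (harmDim d l)) : Continuous (B l q) :=
  continuous_of_mem_sphericalHarmonics (hB.mem l q)

theorem orthogonal (hB : IsHarmONB B) (hd : 1 ≤ d) {l l' : ℕ} (h : l ≠ l') (q : Fin (harmDim d l))
    (r : Fin (harmDim d l')) : ∫ x, B l q x * conj (B l' r x) ∂(sphereMeasure d) = 0 :=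
  integral_mul_eq_zero_of_ne hd h (hB.mem l q) (conj_mem_sphericalHarmonics (hB.mem l' r))

theorem eq_sum (hB : IsHarmONB B) {l : ℕ} {f : USphere d → ℂ} (hf : f ∈ sphericalHarmonics d l)
    (x : USphere d) :
    f x = ∑ q, (∫ y, f y * conj (B l q y) ∂(sphereMeasure d)) * B l q x := by
  rw [← hB.span_eq l, Submodule.mem_span_range_iff_exists_fun] at hf
  obtain ⟨c, rfl⟩ := hf
  have h : ∀ q, ∫ y, (∑ r, c r • B l r) y * conj (B l q y) ∂(sphereMeasure d) = c q := fun q => by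
    have e : ∀ y, (∑ r, c r • B l r) y * conj (B l q y)
        = ∑ r, c r * (B l r y * conj (B l q y)) := fun y => by
      rw [Finset.sum_apply, Finset.sum_mul]
      exact Finset.sum_congr rfl fun r _ => by simp [mul_assoc]
    simp_rw [e]
    rw [integral_finsetSum]
    · simp_rw [integral_const_mul, hB.orthonormal]
      simp
    · intro r _
      have h1 := hB.continuous l r
      have h2 := hB.continuous l q
      have h3 : Continuous fun y => B l r y * conj (B l q y) :=
        h1.mul (Complex.continuous_conj.comp h2)
      exact h3.integrable_sphereMeasure.const_mul _
  simp_rw [h]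
  simp

/-- The addition theorem, on the diagonal. -/
theorem sum_normSq_onSphere (hB : IsHarmONB B) (l : ℕ) (T : Ambient d ≃ₗᵢ[ℝ] Ambient d)
    (x : USphere d) : ∑ q, ‖B l q (T.onSphere x)‖ ^ 2 = ∑ q, ‖B l q x‖ ^ 2 := by
  let c : Matrix (Fin (harmDim d l)) (Fin (harmDim d l)) ℂ := Matrix.of fun q r =>
    ∫ y, B l q (T.onSphere y) * conj (B l r y) ∂(sphereMeasure d)
  have hc : ∀ q y, B l q (T.onSphere y) = ∑ r, c q r * B l r y := fun q y =>
    hB.eq_sum (onSphere_mem_sphericalHarmonics (hB.mem l q) T) y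
  -- Since `T` preserves the surface measure, the rotated basis is again orthonormal; hence the
  -- change of basis matrix is unitary and preserves the sum of squares.
  have h1 : c * cᴴ = 1 := by
    ext q q'
    have e := T.integral_onSphere fun y => B l q y * conj (B l q' y)
    rw [hB.orthonormal] at e
    rw [Matrix.mul_apply, Matrix.one_apply, ← e]
    have e2 : ∀ y, B l q (T.onSphere y) * conj (B l q' (T.onSphere y)) =
        ∑ r, conj (c q' r) * (B l q (T.onSphere y) * conj (B l r y)) := fun y => by
      rw [hc q' y, map_sum, Finset.mul_sum]
      exact Finset.sum_congr rfl fun r _ => by rw [map_mul]; ring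
    simp_rw [e2]
    rw [integral_finsetSum]
    · refine Finset.sum_congr rfl fun r _ => ?_
      rw [integral_const_mul]
      simp [c, mul_comm]
    · intro r _
      have h3 : Continuous fun y => B l q (T.onSphere y) * conj (B l r y) :=
        ((hB.continuous l q).comp T.continuous_onSphere).mul
          (Complex.continuous_conj.comp (hB.continuous l r))
      exact h3.integrable_sphereMeasure.const_mul _
  have h2 : cᴴ * c = 1 := mul_eq_one_comm.1 h1
  have h3 : ∀ v : Fin (harmDim d l) → ℂ, ((∑ q, ‖v q‖ ^ 2 : ℝ) : ℂ) = star v ⬝ᵥ v := fun v => by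
    simp only [dotProduct, Pi.star_apply]
    push_cast
    exact Finset.sum_congr rfl fun q _ => by
      rw [← Complex.conj_mul']; rfl
  have h4 : (fun q => B l q (T.onSphere x)) = c *ᵥ fun r => B l r x := by
    funext q; rw [hc q x]; rfl
  have h5 : ((∑ q, ‖B l q (T.onSphere x)‖ ^ 2 : ℝ) : ℂ) = ((∑ q, ‖B l q x‖ ^ 2 : ℝ) : ℂ) := by
    rw [h3 fun q => B l q (T.onSphere x), h3 fun q => B l q x, h4, Matrix.star_mulVec,
      Matrix.dotProduct_mulVec, Matrix.vecMul_vecMul, h2, Matrix.vecMul_one]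
  exact_mod_cast h5

/-- Isometries are transitive, so the invariant sum is a constant function; its integral is the
number of basis elements. -/
theorem sum_normSq_eq (hB : IsHarmONB B) (l : ℕ) (x : USphere d) :
    ∑ q, ‖B l q x‖ ^ 2 = harmDim d l / (sphereMeasure d).real Set.univ := by
  have hconst : ∀ y, ∑ q, ‖B l q y‖ ^ 2 = ∑ q, ‖B l q x‖ ^ 2 := fun y => by
    obtain ⟨T, rfl⟩ := exists_onSphere_eq x y
    exact hB.sum_normSq_onSphere l T x
  have h1 : ∫ y, ∑ q, ‖B l q y‖ ^ 2 ∂(sphereMeasure d) = harmDim d l := by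
    rw [integral_finsetSum]
    · have : ∀ q, ∫ y, ‖B l q y‖ ^ 2 ∂(sphereMeasure d) = 1 := fun q => by
        have h := hB.orthonormal l q q
        have e : ∀ y, B l q y * conj (B l q y) = ((‖B l q y‖ ^ 2 : ℝ) : ℂ) := fun y => by
          rw [Complex.mul_conj']; push_cast; rfl
        simp_rw [e] at h
        rw [integral_complex_ofReal] at h
        simpa using h
      simp [this]
    · intro q _
      exact ((hB.continuous l q).norm.pow 2).integrable_sphereMeasure
  simp_rw [hconst] at h1
  rw [integral_const, smul_eq_mul] at h1
  rw [eq_div_iff (sphereMeasure_real_univ_pos d).ne', mul_comm, h1]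

theorem sum_normSq_le (hB : IsHarmONB B) (hd : 1 ≤ d) (l : ℕ) (x : USphere d) :
    ∑ q, ‖B l q x‖ ^ 2 ≤ 2 / (sphereMeasure d).real Set.univ * ((l : ℝ) + 1) ^ (d - 1) := by
  rw [hB.sum_normSq_eq l x, div_mul_eq_mul_div]
  have h : (harmDim d l : ℝ) ≤ 2 * ((l : ℝ) + 1) ^ (d - 1) := by exact_mod_cast harmDim_le hd l
  have := sphereMeasure_real_univ_pos d
  gcongr

theorem memLp_two (hB : IsHarmONB B) (l : ℕ) (q : Fin (harmDim d l)) :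
    MemLp (B l q) 2 (sphereMeasure d) :=
  (hB.continuous l q).memLp_of_hasCompactSupport (HasCompactSupport.of_compactSpace _)

/-- Bessel's inequality: the Fourier coefficients of a continuous function are square summable. -/
theorem summable_harmFourier_sq (hB : IsHarmONB B) (hd : 1 ≤ d) {f : USphere d → ℝ}
    (hf : Continuous f) : Summable fun l => ∑ q, ‖harmFourier B f l q‖ ^ 2 := by
  classical
  let v : ((l : ℕ) × Fin (harmDim d l)) → Lp ℂ 2 (sphereMeasure d) := fun i =>
    (hB.memLp_two i.1 i.2).toLp
  have hfc : Continuous fun x => (f x : ℂ) := Complex.continuous_ofReal.comp hf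
  let F : Lp ℂ 2 (sphereMeasure d) :=
    (hfc.memLp_of_hasCompactSupport (HasCompactSupport.of_compactSpace _)).toLp
  have hinner : ∀ (g h : USphere d → ℂ) (hg : MemLp g 2 (sphereMeasure d))
      (hh : MemLp h 2 (sphereMeasure d)),
      inner ℂ hg.toLp hh.toLp = ∫ x, h x * conj (g x) ∂(sphereMeasure d) := fun g h hg hh => by
    rw [L2.inner_def]
    refine integral_congr_ae ?_
    filter_upwards [hg.coeFn_toLp, hh.coeFn_toLp] with x h1 h2
    rw [h1, h2]; simp
  have hv : Orthonormal ℂ v := by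
    rw [orthonormal_iff_ite]
    rintro ⟨l, q⟩ ⟨l', r⟩
    simp only [v]
    rw [hinner]
    by_cases hl : l' = l
    · subst hl
      rw [hB.orthonormal]
      simp [eq_comm]
    · rw [hB.orthogonal hd hl, if_neg]
      rintro ⟨⟩
      exact hl rfl
  have hs := hv.inner_products_summable (x := F)
  have h2 := hs.sigma
  refine h2.congr fun l => ?_
  rw [tsum_fintype]
  refine Finset.sum_congr rfl fun q _ => ?_
  simp only [v, F]
  rw [hinner]
  rfl

end IsHarmONB

/-! ### Iterated Laplacians and uniform bounds on Fourier-Laplace terms. -/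

theorem contDiffOn_radialExtension_iterate {d k : ℕ} {f : USphere d → ℝ}
    (hf : ContDiffOn ℝ (2 * k : ℕ) (radialExtension f) {0}ᶜ) :
    ContDiffOn ℝ 0 (radialExtension (laplaceBeltrami^[k] f)) {0}ᶜ := by
  induction k generalizing f with
  | zero => simpa using hf
  | succ k ih =>
    rw [Function.iterate_succ_apply]
    exact ih (contDiffOn_radialExtension_laplaceBeltrami hf (by norm_cast))

theorem harmFourier_iterate_laplaceBeltrami {d : ℕ} (hd : 1 ≤ d) {B : HarmFamily d}
    (hB : IsHarmONB B) {k : ℕ} {f : USphere d → ℝ}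
    (hf : ContDiffOn ℝ (2 * k : ℕ) (radialExtension f) {0}ᶜ) (l : ℕ) (q : Fin (harmDim d l)) :
    harmFourier B (laplaceBeltrami^[k] f) l q =
      (-((l : ℂ) * (l + d - 1))) ^ k * harmFourier B f l q := by
  induction k generalizing f with
  | zero => simp
  | succ k ih =>
    rw [Function.iterate_succ_apply, ih (contDiffOn_radialExtension_laplaceBeltrami hf
      (by norm_cast)), harmFourier_laplaceBeltrami hd hB (hf.of_le (by norm_cast; omega))]
    ring

/-- The absolute value of the degree `l` eigenvalue of the Laplace-Beltrami operator. -/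
def sphereEigenvalue (d l : ℕ) : ℕ := l * (l + (d - 1))

theorem sq_le_sphereEigenvalue (d l : ℕ) : l ^ 2 ≤ sphereEigenvalue d l := by
  rw [sphereEigenvalue, sq]; exact Nat.mul_le_mul_left _ (Nat.le_add_right _ _)

theorem norm_neg_eigenvalue {d : ℕ} (hd : 1 ≤ d) (l k : ℕ) :
    ‖(-((l : ℂ) * (l + d - 1))) ^ k‖ = (sphereEigenvalue d l : ℝ) ^ k := by
  have : ((l : ℂ) * (l + d - 1)) = (sphereEigenvalue d l : ℕ) := by
    rw [sphereEigenvalue]; push_cast [Nat.cast_sub hd]; ring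
  rw [this, norm_pow, norm_neg]; simp

theorem fourierLaplaceTerm_iterate {d : ℕ} (hd : 1 ≤ d) {B : HarmFamily d}
    (hB : IsHarmONB B) {k : ℕ} {f : USphere d → ℝ}
    (hf : ContDiffOn ℝ (2 * k : ℕ) (radialExtension f) {0}ᶜ) (l : ℕ) (x : USphere d) :
    fourierLaplaceTerm B (laplaceBeltrami^[k] f) l x =
      (-((l : ℂ) * (l + d - 1))) ^ k * fourierLaplaceTerm B f l x := by
  simp only [fourierLaplaceTerm, harmFourier_iterate_laplaceBeltrami hd hB hf, Finset.mul_sum,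
    mul_assoc]

namespace IsHarmONB

variable {d : ℕ} {B : HarmFamily d}

theorem continuous_fourierLaplaceTerm (hB : IsHarmONB B) (f : USphere d → ℝ) (l : ℕ) :
    Continuous (fourierLaplaceTerm B f l) :=
  continuous_finsetSum _ fun q _ => continuous_const.mul (hB.continuous l q)

/-- Cauchy-Schwarz separates the coefficients from the basis, whose square sum is controlled
pointwise by the addition theorem. -/
theorem norm_fourierLaplaceTerm_le (hB : IsHarmONB B) (hd : 1 ≤ d) (f : USphere d → ℝ) (l : ℕ)
    (x : USphere d) : ‖fourierLaplaceTerm B f l x‖ ≤ √(∑ q, ‖harmFourier B f l q‖ ^ 2) *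
      √(2 / (sphereMeasure d).real Set.univ * ((l : ℝ) + 1) ^ (d - 1)) := by
  calc ‖fourierLaplaceTerm B f l x‖ ≤ ∑ q, ‖harmFourier B f l q‖ * ‖B l q x‖ :=
        (norm_sum_le _ _).trans_eq (by simp only [norm_mul])
    _ ≤ √(∑ q, ‖harmFourier B f l q‖ ^ 2) * √(∑ q, ‖B l q x‖ ^ 2) :=
      Real.sum_mul_le_sqrt_mul_sqrt _ _ _
    _ ≤ _ := by gcongr; exact hB.sum_normSq_le hd l x

/-- The uniform bounds on the terms of the Fourier-Laplace series of a smooth function are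
summable. -/
theorem summable_fourierLaplace_bound (hB : IsHarmONB B) (hd : 1 ≤ d) {k : ℕ}
    (hk : (d : ℝ) / 4 < k) {f : USphere d → ℝ}
    (hf : ContDiffOn ℝ (2 * k : ℕ) (radialExtension f) {0}ᶜ) :
    Summable fun l : ℕ => √(∑ q, ‖harmFourier B f l q‖ ^ 2) *
      √(2 / (sphereMeasure d).real Set.univ * ((l : ℝ) + 1) ^ (d - 1)) := by
  set C := 2 / (sphereMeasure d).real Set.univ with hC
  have hCpos : 0 < C := by have := sphereMeasure_real_univ_pos d; positivity
  have hS := hB.summable_harmFourier_sq hd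
    (continuous_of_radialExtension (contDiffOn_radialExtension_iterate hf))
  -- The condition `d/4 < k` in integers. It is exactly what makes `l^(d-1) λ_l^(-2k)` at most
  -- `l^(-2)`.
  have hk' : d + 1 ≤ 4 * k := by
    have : (d : ℝ) < 4 * k := by linarith
    exact_mod_cast this
  have h2 : Summable fun l : ℕ => C * 2 ^ (d - 1) * (1 / (l : ℝ) ^ 2) :=
    (Real.summable_one_div_nat_pow.2 one_lt_two).mul_left _
  refine Summable.of_norm_bounded_eventually_nat (hS.add h2) ?_
  filter_upwards [eventually_ge_atTop 1] with l hl
  have hl' : (1 : ℝ) ≤ l := by exact_mod_cast hl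
  set lam : ℝ := (sphereEigenvalue d l : ℝ) with hlam
  have hlam1 : (l : ℝ) ^ 2 ≤ lam := by
    rw [hlam]; exact_mod_cast sq_le_sphereEigenvalue d l
  have hlam0 : 0 < lam := lt_of_lt_of_le (by positivity) hlam1
  have e1 : ∑ q, ‖harmFourier B (laplaceBeltrami^[k] f) l q‖ ^ 2
      = lam ^ (2 * k) * ∑ q, ‖harmFourier B f l q‖ ^ 2 := by
    rw [Finset.mul_sum]
    refine Finset.sum_congr rfl fun q _ => ?_
    rw [harmFourier_iterate_laplaceBeltrami hd hB hf, norm_mul, norm_neg_eigenvalue hd, mul_pow,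
      ← pow_mul, mul_comm k 2]
  set S := ∑ q, ‖harmFourier B f l q‖ ^ 2 with hSdef
  have hS0 : 0 ≤ S := Finset.sum_nonneg fun q _ => by positivity
  have e2 : C * ((l : ℝ) + 1) ^ (d - 1) ≤ lam ^ (2 * k) * (C * 2 ^ (d - 1) * (1 / (l : ℝ) ^ 2)) := by
    have h3 : ((l : ℝ) + 1) ^ (d - 1) ≤ 2 ^ (d - 1) * (l : ℝ) ^ (d - 1) := by
      rw [← mul_pow]; gcongr; linarith
    have h4 : (l : ℝ) ^ (d - 1) * (l : ℝ) ^ 2 ≤ lam ^ (2 * k) := by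
      calc (l : ℝ) ^ (d - 1) * (l : ℝ) ^ 2 = (l : ℝ) ^ (d + 1) := by
            rw [← pow_add]; congr 1; omega
        _ ≤ (l : ℝ) ^ (4 * k) := pow_le_pow_right₀ hl' hk'
        _ = ((l : ℝ) ^ 2) ^ (2 * k) := by rw [← pow_mul]; congr 1; ring
        _ ≤ lam ^ (2 * k) := by gcongr
    have h5 : (l : ℝ) ^ (d - 1) ≤ lam ^ (2 * k) * (1 / (l : ℝ) ^ 2) := by
      rw [mul_one_div, le_div_iff₀ (by positivity)]; exact h4
    calc C * ((l : ℝ) + 1) ^ (d - 1) ≤ C * (2 ^ (d - 1) * (l : ℝ) ^ (d - 1)) := by gcongr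
      _ ≤ C * (2 ^ (d - 1) * (lam ^ (2 * k) * (1 / (l : ℝ) ^ 2))) := by gcongr
      _ = _ := by ring
  set R := C * 2 ^ (d - 1) * (1 / (l : ℝ) ^ 2) with hR
  have hR0 : 0 ≤ R := by positivity
  rw [Real.norm_of_nonneg (by positivity), e1]
  set L := lam ^ (2 * k) with hL
  have hL0 : 0 < L := by positivity
  -- The eigenvalue weight `L` is moved onto the coefficients before estimating the product by a
  -- sum: `L * S` is summable by Bessel's inequality for `Δ^k f`, and `R` is a multiple of `l^(-2)`.
  calc √S * √(C * ((l : ℝ) + 1) ^ (d - 1)) ≤ √S * √(L * R) := by gcongr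
    _ = √(L * S) * √R := by
      rw [← Real.sqrt_mul hS0, ← Real.sqrt_mul (by positivity)]; congr 1; ring
    _ ≤ L * S + R := by
      have h6 := Real.sq_sqrt (show 0 ≤ L * S by positivity)
      have h7 := Real.sq_sqrt hR0
      nlinarith [sq_nonneg (√(L * S) - √R), Real.sqrt_nonneg (L * S), Real.sqrt_nonneg R]

end IsHarmONB

/-! ### Completeness of spherical harmonics and convergence of the series. -/

/-- A continuous function on the sphere which is orthogonal to all spherical harmonics vanishes. -/
theorem eq_zero_of_integral_mul_harmonic_eq_zero {d : ℕ} {D : USphere d → ℂ} (hD : Continuous D)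
    (h : ∀ l, ∀ f ∈ sphericalHarmonics d l, ∫ x, D x * f x ∂(sphereMeasure d) = 0) : D = 0 := by
  have hpoly : ∀ p : MvPolynomial (Fin (d + 1)) ℂ,
      ∫ x, D x * polyEval p x.1 ∂(sphereMeasure d) = 0 := fun p => by
    have hmem := polyEval_mem_iSup_sphericalHarmonics (d := d) p
    have key : ∀ f ∈ ⨆ l, sphericalHarmonics d l,
        Continuous f ∧ ∫ x, D x * f x ∂(sphereMeasure d) = 0 := by
      intro f hf
      refine Submodule.iSup_induction _ (motive := fun f => Continuous f ∧
        ∫ x, D x * f x ∂(sphereMeasure d) = 0) hf ?_ ?_ ?_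
      · exact fun l f hf => ⟨continuous_of_mem_sphericalHarmonics hf, h l f hf⟩
      · exact ⟨continuous_const, by simp⟩
      · rintro f g ⟨h1, h2⟩ ⟨h3, h4⟩
        refine ⟨h1.add h3, ?_⟩
        simp only [Pi.add_apply, mul_add]
        rw [integral_add (hD.integrable_mul_sphereMeasure h1) (hD.integrable_mul_sphereMeasure h3),
          h2, h4, add_zero]
    exact (key _ hmem).2
  -- Stone-Weierstrass: restrictions of polynomials form a self-adjoint algebra that separates
  -- points.
  let A : StarSubalgebra ℂ C(USphere d, ℂ) :=
    { carrier := {f | ∃ p : MvPolynomial (Fin (d + 1)) ℂ, ∀ x : USphere d, f x = polyEval p x.1}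
      mul_mem' := by
        rintro f g ⟨p, hp⟩ ⟨q, hq⟩
        exact ⟨p * q, fun x => by simp [hp, hq, polyEval]⟩
      add_mem' := by
        rintro f g ⟨p, hp⟩ ⟨q, hq⟩
        exact ⟨p + q, fun x => by simp [hp, hq, polyEval]⟩
      algebraMap_mem' := fun c => ⟨MvPolynomial.C c, fun x => by
        simp [polyEval]⟩
      star_mem' := by
        rintro f ⟨p, hp⟩
        refine ⟨MvPolynomial.map (starRingEnd ℂ) p, fun x => ?_⟩
        rw [ContinuousMap.star_apply, hp]
        simp only [polyEval, MvPolynomial.eval_map]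
        rw [← MvPolynomial.eval₂_id]
        change (starRingEnd ℂ) _ = _
        rw [MvPolynomial.hom_eval₂]
        simp }
  have hsep : A.SeparatesPoints := by
    intro x y hxy
    have : ∃ i, x.1 i ≠ y.1 i := by
      by_contra hc
      push Not at hc
      exact hxy (Subtype.ext (by ext i; exact hc i))
    obtain ⟨i, hi⟩ := this
    refine ⟨fun z => ((z.1 i : ℝ) : ℂ), ⟨⟨fun z : USphere d => ((z.1 i : ℝ) : ℂ), by fun_prop⟩,
      ⟨MvPolynomial.X i, fun z => by simp [polyEval]⟩, rfl⟩, ?_⟩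
    simpa using hi
  have hdense := ContinuousMap.starSubalgebra_topologicalClosure_eq_top_of_separatesPoints A hsep
  let D' : C(USphere d, ℂ) := ⟨fun x => conj (D x), Complex.continuous_conj.comp hD⟩
  have hD' : D' ∈ closure (A : Set C(USphere d, ℂ)) := by
    have : D' ∈ A.topologicalClosure := by rw [hdense]; trivial
    exact this
  -- Approximate the conjugate of `D` uniformly within `ε` by a polynomial `g`. As `D` annihilates
  -- `g`, `∫ |D|² = ∫ D (conj D - g) ≤ ε ∫ |D|`.
  have hI : ∫ x, ‖D x‖ ^ 2 ∂(sphereMeasure d) = 0 := by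
    set M := ∫ x, ‖D x‖ ∂(sphereMeasure d) with hM
    have hM0 : 0 ≤ M := integral_nonneg fun x => norm_nonneg _
    have hle : ∀ ε > 0, ∫ x, ‖D x‖ ^ 2 ∂(sphereMeasure d) ≤ M * ε := fun ε hε => by
      obtain ⟨g, ⟨p, hp⟩, hg⟩ := Metric.mem_closure_iff.1 hD' ε hε
      have e : ((∫ x, ‖D x‖ ^ 2 ∂(sphereMeasure d) : ℝ) : ℂ) =
          ∫ x, D x * (D' x - g x) ∂(sphereMeasure d) := by
        simp only [mul_sub]
        rw [integral_sub (hD.integrable_mul_sphereMeasure D'.continuous)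
          (hD.integrable_mul_sphereMeasure g.continuous)]
        simp only [hp]
        rw [hpoly, sub_zero, ← integral_complex_ofReal]
        refine integral_congr_ae (Eventually.of_forall fun x => ?_)
        simp only [D', ContinuousMap.coe_mk]
        rw [Complex.mul_conj']; push_cast; rfl
      have h0 : 0 ≤ ∫ x, ‖D x‖ ^ 2 ∂(sphereMeasure d) := integral_nonneg fun x => by positivity
      calc ∫ x, ‖D x‖ ^ 2 ∂(sphereMeasure d)
          = ‖((∫ x, ‖D x‖ ^ 2 ∂(sphereMeasure d) : ℝ) : ℂ)‖ := by
            rw [Complex.norm_real, Real.norm_of_nonneg h0]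
        _ ≤ ∫ x, ‖D x‖ * ε ∂(sphereMeasure d) := by
            rw [e]
            refine norm_integral_le_of_norm_le
              (hD.norm.mul continuous_const).integrable_sphereMeasure
              (Eventually.of_forall fun x => ?_)
            rw [norm_mul]
            have := (ContinuousMap.dist_apply_le_dist (f := D') (g := g) x).trans hg.le
            rw [dist_eq_norm] at this
            gcongr
        _ = M * ε := by rw [integral_mul_const]
    have h0 : 0 ≤ ∫ x, ‖D x‖ ^ 2 ∂(sphereMeasure d) := integral_nonneg fun x => by positivity
    refine le_antisymm (le_of_forall_pos_le_add fun ε hε => ?_) h0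
    have := hle (ε / (M + 1)) (by positivity)
    have h3 : M * (ε / (M + 1)) ≤ ε := by
      rw [mul_div_assoc', div_le_iff₀ (by positivity)]; nlinarith
    linarith
  have hc : Continuous fun x => ‖D x‖ ^ 2 := hD.norm.pow 2
  have hae := (integral_eq_zero_iff_of_nonneg (fun x => by positivity)
    hc.integrable_sphereMeasure).1 hI
  have hz := Continuous.ae_eq_iff_eq (sphereMeasure d) hc continuous_const |>.1 hae
  funext x
  have h0 : ‖D x‖ ^ 2 = 0 := congrFun hz x
  simpa using h0

namespace IsHarmONB

variable {d : ℕ} {B : HarmFamily d}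

/-- The Fourier-Laplace series of a smooth function converges to the function. -/
theorem hasSum_fourierLaplaceTerm (hB : IsHarmONB B) (hd : 1 ≤ d) {k : ℕ}
    (hk : (d : ℝ) / 4 < k) {f : USphere d → ℝ}
    (hf : ContDiffOn ℝ (2 * k : ℕ) (radialExtension f) {0}ᶜ) (x : USphere d) :
    HasSum (fun l => fourierLaplaceTerm B f l x) (f x : ℂ) := by
  have hu := hB.summable_fourierLaplace_bound hd hk hf
  set u : ℕ → ℝ := fun l => √(∑ q, ‖harmFourier B f l q‖ ^ 2) *
      √(2 / (sphereMeasure d).real Set.univ * ((l : ℝ) + 1) ^ (d - 1)) with hu_def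
  have hle : ∀ l y, ‖fourierLaplaceTerm B f l y‖ ≤ u l := hB.norm_fourierLaplaceTerm_le hd f
  -- The series converges uniformly to a continuous `g`, and termwise integration gives `g` the
  -- Fourier coefficients of `f`. Completeness applied to `f - g` then identifies the two.
  let g : USphere d → ℂ := fun y => ∑' l, fourierLaplaceTerm B f l y
  have hg : Continuous g := continuous_tsum (fun l => hB.continuous_fourierLaplaceTerm f l) hu hle
  have hfc : Continuous fun y => (f y : ℂ) :=
    Complex.continuous_ofReal.comp (continuous_of_radialExtension hf)
  have hgB : ∀ l q, ∫ y, g y * conj (B l q y) ∂(sphereMeasure d) = harmFourier B f l q := by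
    intro l q
    have hcB : Continuous fun y => conj (B l q y) :=
      Complex.continuous_conj.comp (hB.continuous l q)
    have hint : ∀ l', Integrable (fun y => fourierLaplaceTerm B f l' y * conj (B l q y))
        (sphereMeasure d) := fun l' =>
      ((hB.continuous_fourierLaplaceTerm f l').mul hcB).integrable_sphereMeasure
    have hsum : Summable fun l' => ∫ y, ‖fourierLaplaceTerm B f l' y * conj (B l q y)‖
        ∂(sphereMeasure d) := by
      refine Summable.of_nonneg_of_le (fun l' => integral_nonneg fun y => norm_nonneg _)
        (fun l' => ?_) (hu.mul_right (∫ y, ‖conj (B l q y)‖ ∂(sphereMeasure d)))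
      rw [← integral_const_mul]
      refine integral_mono (hint l').norm (hcB.norm.integrable_sphereMeasure.const_mul _)
        fun y => ?_
      simp only [norm_mul]
      exact mul_le_mul_of_nonneg_right (hle l' y) (norm_nonneg _)
    have h1 := hasSum_integral_of_summable_integral_norm hint hsum
    have h2 : ∀ l', ∫ y, fourierLaplaceTerm B f l' y * conj (B l q y) ∂(sphereMeasure d)
        = if l' = l then harmFourier B f l q else 0 := fun l' => by
      simp only [fourierLaplaceTerm, Finset.sum_mul, mul_assoc]
      rw [integral_finsetSum]
      · simp_rw [integral_const_mul]
        split_ifs with h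
        · subst h
          simp_rw [hB.orthonormal]
          simp
        · exact Finset.sum_eq_zero fun r _ => by rw [hB.orthogonal hd h, mul_zero]
      · intro r _
        exact ((hB.continuous l' r).mul hcB).integrable_sphereMeasure.const_mul _
    simp_rw [h2] at h1
    have h3 := h1.unique (hasSum_ite_eq l (harmFourier B f l q))
    rw [← h3]
    refine integral_congr_ae (Eventually.of_forall fun y => ?_)
    simp only [g]
    rw [tsum_mul_right]
  have hD : (fun y => (f y : ℂ) - g y) = 0 := by
    refine eq_zero_of_integral_mul_harmonic_eq_zero (hfc.sub hg) fun l φ hφ => ?_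
    have hφ' : ∀ y, φ y = ∑ q, conj (∫ z, conj (φ z) * conj (B l q z) ∂(sphereMeasure d))
        * conj (B l q y) := fun y => by
      have := congrArg conj (hB.eq_sum (conj_mem_sphericalHarmonics hφ) y)
      simpa only [Complex.conj_conj, map_sum, map_mul] using this
    have e : ∀ y, ((f y : ℂ) - g y) * φ y = ∑ q, conj (∫ z, conj (φ z) * conj (B l q z)
        ∂(sphereMeasure d)) * ((f y : ℂ) * conj (B l q y) - g y * conj (B l q y)) := fun y => by
      conv_lhs => rw [hφ' y]
      rw [Finset.mul_sum]
      exact Finset.sum_congr rfl fun q _ => by ring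
    simp_rw [e]
    have hcB : ∀ q, Continuous fun y => conj (B l q y) := fun q =>
      Complex.continuous_conj.comp (hB.continuous l q)
    rw [integral_finsetSum]
    · refine Finset.sum_eq_zero fun q _ => ?_
      rw [integral_const_mul, integral_sub (hfc.integrable_mul_sphereMeasure (hcB q))
        (hg.integrable_mul_sphereMeasure (hcB q)), hgB l q]
      simp [harmFourier]
    · intro q _
      exact ((hfc.mul (hcB q)).sub (hg.mul (hcB q))).integrable_sphereMeasure.const_mul _
  have hx : (f x : ℂ) = g x := sub_eq_zero.1 (congrFun hD x)
  rw [hx]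
  exact (Summable.of_norm_bounded hu fun l => hle l x).hasSum

/-- The rate of convergence of the Fourier-Laplace series of a smooth function. -/
theorem tendsto_fourierLaplace_remainder (hB : IsHarmONB B) (hd : 1 ≤ d) {k : ℕ}
    (hk : (d : ℝ) / 4 < k) {f : USphere d → ℝ}
    (hf : ContDiffOn ℝ (2 * k : ℕ) (radialExtension f) {0}ᶜ) (x : USphere d)
    (hs : Summable fun l => ‖fourierLaplaceTerm B (laplaceBeltrami^[k] f) l x‖) :
    Tendsto (fun N : ℕ => (N : ℝ) ^ (2 * k) *
      ‖∑ l ∈ Finset.range N, fourierLaplaceTerm B f l x - f x‖) atTop (𝓝 0) := by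
  have hsum := hB.hasSum_fourierLaplaceTerm hd hk hf x
  have ht := tendsto_sum_nat_add fun l => ‖fourierLaplaceTerm B (laplaceBeltrami^[k] f) l x‖
  refine squeeze_zero (fun N => by positivity) (fun N => ?_) ht
  have e : ∑ l ∈ Finset.range N, fourierLaplaceTerm B f l x - f x
      = -∑' l, fourierLaplaceTerm B f (l + N) x := by
    rw [← hsum.tsum_eq, ← hsum.summable.sum_add_tsum_nat_add N]; ring
  have hs' := (summable_nat_add_iff N).2 hs
  rw [e, norm_neg]
  -- In degrees at least `N` the eigenvalue of `Δ^k` has modulus at least `N^(2k)`, so the weighted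
  -- tail for `f` is dominated by the unweighted tail for `Δ^k f`.
  have hle : ∀ l, (N : ℝ) ^ (2 * k) * ‖fourierLaplaceTerm B f (l + N) x‖ ≤
      ‖fourierLaplaceTerm B (laplaceBeltrami^[k] f) (l + N) x‖ := fun l => by
    rw [fourierLaplaceTerm_iterate hd hB hf, norm_mul, norm_neg_eigenvalue hd, pow_mul]
    have h1 : ((l + N : ℕ) : ℝ) ^ 2 ≤ sphereEigenvalue d (l + N) := by
      exact_mod_cast sq_le_sphereEigenvalue d (l + N)
    have h2 : (N : ℝ) ≤ ((l + N : ℕ) : ℝ) := by push_cast; linarith [Nat.cast_nonneg (α := ℝ) l]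
    gcongr
    exact le_trans (by gcongr) h1
  rcases Nat.eq_zero_or_pos N with rfl | hN
  · rcases Nat.eq_zero_or_pos k with rfl | hk0
    · have : (0 : ℝ) ≤ d := Nat.cast_nonneg d
      simp only [Nat.cast_zero] at hk
      linarith
    · rw [Nat.cast_zero, zero_pow (by omega), zero_mul]
      exact tsum_nonneg fun l => norm_nonneg _
  have hN' : (0 : ℝ) < (N : ℝ) ^ (2 * k) := by positivity
  have hsn : Summable fun l => ‖fourierLaplaceTerm B f (l + N) x‖ := by
    refine Summable.of_nonneg_of_le (fun l => norm_nonneg _) (fun l => ?_)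
      (hs'.mul_left ((N : ℝ) ^ (2 * k))⁻¹)
    rw [← div_eq_inv_mul, le_div_iff₀ hN', mul_comm]
    exact hle l
  calc (N : ℝ) ^ (2 * k) * ‖∑' l, fourierLaplaceTerm B f (l + N) x‖
      ≤ (N : ℝ) ^ (2 * k) * ∑' l, ‖fourierLaplaceTerm B f (l + N) x‖ := by
        gcongr; exact norm_tsum_le_tsum_norm hsn
    _ = ∑' l, (N : ℝ) ^ (2 * k) * ‖fourierLaplaceTerm B f (l + N) x‖ := by rw [tsum_mul_left]
    _ ≤ _ := (hsn.mul_left _).tsum_le_tsum hle hs'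

end IsHarmONB

/-! ### Size and continuity of the deconvolution kernel. -/

instance SOGroup.instSecondCountableTopology (d : ℕ) : SecondCountableTopology (SOGroup d) := by
  have : SecondCountableTopology (Matrix (Fin (d + 1)) (Fin (d + 1)) ℝ) :=
    inferInstanceAs (SecondCountableTopology (Fin (d + 1) → Fin (d + 1) → ℝ))
  exact TopologicalSpace.Subtype.secondCountableTopology _

theorem norm_bilin_le_matOpNorm {n : ℕ} (A : Matrix (Fin n) (Fin n) ℂ) (v w : Fin n → ℂ) :
    ‖∑ q, (∑ r, A q r * v r) * w q‖ ≤ matOpNorm A * √(∑ q, ‖v q‖ ^ 2) * √(∑ q, ‖w q‖ ^ 2) := by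
  let V : EuclideanSpace ℂ (Fin n) := WithLp.toLp 2 v
  have h1 : ‖Matrix.toEuclideanCLM (n := Fin n) (𝕜 := ℂ) A V‖ ≤ matOpNorm A * ‖V‖ :=
    ContinuousLinearMap.le_opNorm _ _
  rw [EuclideanSpace.norm_eq, EuclideanSpace.norm_eq] at h1
  have h2 : ∀ q, (Matrix.toEuclideanCLM (n := Fin n) (𝕜 := ℂ) A V) q = ∑ r, A q r * v r :=
    fun q => rfl
  simp only [h2] at h1
  calc ‖∑ q, (∑ r, A q r * v r) * w q‖ ≤ ∑ q, ‖∑ r, A q r * v r‖ * ‖w q‖ :=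
        (norm_sum_le _ _).trans_eq (by simp only [norm_mul])
    _ ≤ √(∑ q, ‖∑ r, A q r * v r‖ ^ 2) * √(∑ q, ‖w q‖ ^ 2) := Real.sum_mul_le_sqrt_mul_sqrt _ _ _
    _ ≤ _ := by gcongr

namespace IsHarmONB

variable {d : ℕ} {B : HarmFamily d}

/-- The inverse Fourier matrix contributes at most order `(l + 1)^β` and the two basis vectors
together `(l + 1)^(d-1)`; at most `T + 1` degrees are summed. -/
theorem norm_deconvKernel_le (hB : IsHarmONB B) (hd : 1 ≤ d) {fU : SOGroup d → ℝ} {β : ℝ}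
    (hβ : 0 ≤ β)
    (hS1 : ∃ c₁ > 0, ∀ l : ℕ, 1 ≤ l → matOpNorm (rotFourier B fU l)⁻¹ ≤ c₁ * (l : ℝ) ^ β) :
    ∃ C > 0, ∀ T : ℝ, 0 ≤ T → ∀ x z, ‖deconvKernel B fU T x z‖ ≤ C * (T + 1) ^ (β + d) := by
  obtain ⟨c₁, hc₁, h1⟩ := hS1
  -- Ordinary smoothness says nothing about degree `0`, so its norm is absorbed into the constant
  -- and `l^β` is replaced by `(l + 1)^β`.
  set c := max c₁ (matOpNorm (rotFourier B fU 0)⁻¹) with hc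
  have hc0 : 0 < c := lt_of_lt_of_le hc₁ (le_max_left _ _)
  have hA : ∀ l : ℕ, matOpNorm (rotFourier B fU l)⁻¹ ≤ c * ((l : ℝ) + 1) ^ β := fun l => by
    rcases Nat.eq_zero_or_pos l with rfl | hl
    · simp [hc]
    · refine (h1 l hl).trans ?_
      gcongr
      · exact le_max_left _ _
      · linarith
  set K := 2 / (sphereMeasure d).real Set.univ with hK
  have hK0 : 0 < K := by have := sphereMeasure_real_univ_pos d; positivity
  refine ⟨c * K, by positivity, fun T hT x z => ?_⟩
  have hterm : ∀ l ∈ Finset.range (⌊T⌋₊ + 1),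
      ‖∑ q, (∑ r, (rotFourier B fU l)⁻¹ q r * conj (B l r z)) * B l q x‖ ≤
        c * K * (T + 1) ^ (β + (d - 1 : ℕ)) := fun l hl => by
    have hlT : (l : ℝ) + 1 ≤ T + 1 := by
      have h2 : l ≤ ⌊T⌋₊ := Nat.lt_succ_iff.1 (Finset.mem_range.1 hl)
      have := (Nat.le_floor_iff hT).1 h2
      linarith
    have hl0 : (0 : ℝ) < (l : ℝ) + 1 := by positivity
    have hS := hB.sum_normSq_le hd l
    calc _ ≤ matOpNorm (rotFourier B fU l)⁻¹ * √(∑ r, ‖conj (B l r z)‖ ^ 2)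
          * √(∑ q, ‖B l q x‖ ^ 2) := norm_bilin_le_matOpNorm _ _ _
      _ ≤ (c * ((l : ℝ) + 1) ^ β) * √(K * ((l : ℝ) + 1) ^ (d - 1))
          * √(K * ((l : ℝ) + 1) ^ (d - 1)) := by
        simp only [RCLike.norm_conj]
        gcongr
        · exact hA l
        · exact hS z
        · exact hS x
      _ = c * K * (((l : ℝ) + 1) ^ β * ((l : ℝ) + 1) ^ (d - 1)) := by
        rw [mul_assoc, Real.mul_self_sqrt (by positivity)]; ring
      _ = c * K * ((l : ℝ) + 1) ^ (β + (d - 1 : ℕ)) := by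
        rw [Real.rpow_add hl0, Real.rpow_natCast]
      _ ≤ _ := by gcongr
  have hT1 : 0 < T + 1 := by linarith
  calc ‖deconvKernel B fU T x z‖ ≤ ∑ l ∈ Finset.range (⌊T⌋₊ + 1),
        c * K * (T + 1) ^ (β + (d - 1 : ℕ)) := norm_sum_le_of_le _ hterm
    _ = (⌊T⌋₊ + 1 : ℝ) * (c * K * (T + 1) ^ (β + (d - 1 : ℕ))) := by simp
    _ ≤ (T + 1) * (c * K * (T + 1) ^ (β + (d - 1 : ℕ))) := by
      gcongr; exact Nat.floor_le hT
    _ = c * K * ((T + 1) ^ (β + (d - 1 : ℕ)) * (T + 1) ^ (1 : ℝ)) := by rw [Real.rpow_one]; ring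
    _ = c * K * (T + 1) ^ (β + d) := by
      rw [← Real.rpow_add hT1]; congr 2; push_cast [Nat.cast_sub hd]; ring

theorem continuous_deconvKernel (hB : IsHarmONB B) (fU : SOGroup d → ℝ) (T : ℝ) (x : USphere d) :
    Continuous (deconvKernel B fU T x) := by
  have h : ∀ l r, Continuous fun z => conj (B l r z) := fun l r =>
    Complex.continuous_conj.comp (hB.continuous l r)
  exact continuous_finsetSum _ fun l _ => continuous_finsetSum _ fun q _ =>
    (continuous_finsetSum _ fun r _ => continuous_const.mul (h l r)).mul continuous_const

/-- Rotated harmonics stay in the same degree, so the random rotation acts linearly through a matrix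
depending on `u` alone. This separates `U` from `X` in the kernel. -/
theorem conj_rot_eq_sum (hB : IsHarmONB B) {l : ℕ} (r : Fin (harmDim d l)) (u : SOGroup d)
    (x : USphere d) : conj (B l r (rot u x)) = ∑ s, rotCoeff B l r s u * conj (B l s x) := by
  obtain ⟨T, hT⟩ := exists_isometry_eq_rot u
  have hm := onSphere_mem_sphericalHarmonics (hB.mem l r) T
  rw [hT] at hm
  rw [hB.eq_sum hm x, map_sum]
  refine Finset.sum_congr rfl fun s _ => ?_
  rw [map_mul, ← integral_conj, rotCoeff]
  simp

theorem continuous_rotCoeff (hB : IsHarmONB B) (l : ℕ) (q r : Fin (harmDim d l)) :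
    Continuous (rotCoeff B l q r) := by
  have h1 : Continuous (Function.uncurry fun (u : SOGroup d) (x : USphere d) =>
      conj (B l q (rot u x)) * B l r x) :=
    (Complex.continuous_conj.comp ((hB.continuous l q).comp (continuous_rot d))).mul
      ((hB.continuous l r).comp continuous_snd)
  have := continuous_parametric_integral_of_continuous (μ := sphereMeasure d) h1 isCompact_univ
  rw [Measure.restrict_univ] at this
  exact this

end IsHarmONB

/-! ### The expectation of the kernel. -/

theorem exists_norm_le_of_continuous {K : Type*} [TopologicalSpace K] [CompactSpace K] {f : K → ℂ}
    (hf : Continuous f) : ∃ C, ∀ x, ‖f x‖ ≤ C := by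
  obtain ⟨C, hC⟩ := (isCompact_range hf.norm).bddAbove
  exact ⟨C, fun x => hC ⟨x, rfl⟩⟩

theorem IsDensityOf.integral_comp {α Ω : Type*} [MeasurableSpace α] [MeasurableSpace Ω]
    {P : Measure Ω} {ref : Measure α} {f : α → ℝ} {X : Ω → α} (hX : Measurable X)
    (hf : IsDensityOf f (P.map X) ref) {h : α → ℂ} (hh : Measurable h) :
    ∫ ω, h (X ω) ∂P = ∫ a, (f a : ℂ) * h a ∂ref := by
  rw [← integral_map hX.aemeasurable hh.aestronglyMeasurable, hf.2.2,
    integral_withDensity_eq_integral_toReal_smul (hf.1.ennreal_ofReal)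
      (Eventually.of_forall fun _ => ENNReal.ofReal_lt_top)]
  refine integral_congr_ae (Eventually.of_forall fun a => ?_)
  simp [ENNReal.toReal_ofReal (hf.2.1 a)]

namespace IsHarmONB

variable {d : ℕ} {B : HarmFamily d}

/-- The expectation of the deconvolution kernel is a partial sum of a Fourier-Laplace series. -/
theorem integral_deconvKernel (hB : IsHarmONB B) {Ω : Type*} [MeasurableSpace Ω] {P : Measure Ω}
    [IsProbabilityMeasure P] {X : Ω → USphere d} {U : Ω → SOGroup d} {fX : USphere d → ℝ}
    {fU : SOGroup d → ℝ} (hX : Measurable X) (hU : Measurable U) (hindep : IndepFun U X P)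
    (hfX : IsDensityOf fX (P.map X) (sphereMeasure d)) (hfU : IsDensityOf fU (P.map U) (haarSO d))
    (hinv : ∀ l, IsUnit (rotFourier B fU l)) {g : USphere d → ℝ} (hg : Continuous g) (T : ℝ)
    (x : USphere d) :
    ∫ ω, deconvKernel B fU T x (rot (U ω) (X ω)) * (g (X ω) : ℂ) ∂P =
      ∑ l ∈ Finset.range (⌊T⌋₊ + 1), fourierLaplaceTerm B (fun y => g y * fX y) l x := by
  have hgc : Continuous fun y => (g y : ℂ) := Complex.continuous_ofReal.comp hg
  have hBc : ∀ l s, Continuous fun y => conj (B l s y) * (g y : ℂ) := fun l s =>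
    (Complex.continuous_conj.comp (hB.continuous l s)).mul hgc
  have hint : ∀ {K : Type} [TopologicalSpace K] [CompactSpace K] [MeasurableSpace K]
      [BorelSpace K] {h : K → ℂ} (_ : Continuous h) {V : Ω → K} (_ : Measurable V),
      Integrable (fun ω => h (V ω)) P := by
    intro K _ _ _ _ h hh V hV
    obtain ⟨C, hC⟩ := exists_norm_le_of_continuous hh
    exact Integrable.of_bound (C := C) (hh.measurable.comp hV).aestronglyMeasurable
      (Eventually.of_forall fun ω => hC _)
  have e1 : ∀ l r s, ∫ ω, rotCoeff B l r s (U ω) ∂P = rotFourier B fU l r s := fun l r s =>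
    hfU.integral_comp hU (hB.continuous_rotCoeff l r s).measurable
  have e2 : ∀ l s, ∫ ω, conj (B l s (X ω)) * (g (X ω) : ℂ) ∂P =
      harmFourier B (fun y => g y * fX y) l s := fun l s => by
    rw [hfX.integral_comp hX (hBc l s).measurable, harmFourier]
    refine integral_congr_ae (Eventually.of_forall fun y => ?_)
    simp only; push_cast; ring
  have hprod : ∀ l r s, Integrable (fun ω => rotCoeff B l r s (U ω) *
      (conj (B l s (X ω)) * (g (X ω) : ℂ))) P := fun l r s =>
    (hindep.comp (hB.continuous_rotCoeff l r s).measurable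
      (hBc l s).measurable).integrable_mul (hint (hB.continuous_rotCoeff l r s) hU)
        (hint (hBc l s) hX)
  -- Independence of `U` and `X` turns the average over the rotation into multiplication by the
  -- rotational Fourier matrix.
  have e3 : ∀ l r, ∫ ω, conj (B l r (rot (U ω) (X ω))) * (g (X ω) : ℂ) ∂P =
      ∑ s, rotFourier B fU l r s * harmFourier B (fun y => g y * fX y) l s := fun l r => by
    simp only [hB.conj_rot_eq_sum, Finset.sum_mul, mul_assoc]
    rw [integral_finsetSum _ fun s _ => hprod l r s]
    refine Finset.sum_congr rfl fun s _ => ?_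
    rw [← e1, ← e2]
    exact (hindep.comp (hB.continuous_rotCoeff l r s).measurable
      (hBc l s).measurable).integral_fun_mul_eq_mul_integral
        (hint (hB.continuous_rotCoeff l r s) hU).aestronglyMeasurable
        (hint (hBc l s) hX).aestronglyMeasurable
  have hint3 : ∀ l r, Integrable (fun ω => conj (B l r (rot (U ω) (X ω))) * (g (X ω) : ℂ)) P :=
    fun l r => by
      simp only [hB.conj_rot_eq_sum, Finset.sum_mul, mul_assoc]
      exact integrable_finsetSum _ fun s _ => hprod l r s
  have e4 : ∀ ω, deconvKernel B fU T x (rot (U ω) (X ω)) * (g (X ω) : ℂ) =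
      ∑ l ∈ Finset.range (⌊T⌋₊ + 1), ∑ q, ∑ r, (rotFourier B fU l)⁻¹ q r * B l q x *
        (conj (B l r (rot (U ω) (X ω))) * (g (X ω) : ℂ)) := fun ω => by
    simp only [deconvKernel, Finset.sum_mul]
    refine Finset.sum_congr rfl fun l _ => Finset.sum_congr rfl fun q _ =>
      Finset.sum_congr rfl fun r _ => ?_
    ring
  simp_rw [e4]
  rw [integral_finsetSum _ fun l _ => integrable_finsetSum _ fun q _ => integrable_finsetSum _
    fun r _ => (hint3 l r).const_mul _]
  refine Finset.sum_congr rfl fun l _ => ?_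
  rw [integral_finsetSum _ fun q _ => integrable_finsetSum _ fun r _ => (hint3 l r).const_mul _]
  refine Finset.sum_congr rfl fun q _ => ?_
  rw [integral_finsetSum _ fun r _ => (hint3 l r).const_mul _]
  simp_rw [integral_const_mul, e3]
  -- Here the deconvolution takes place: the inverse matrix in the kernel cancels the effect of the
  -- random rotation in each degree.
  have hmat : (rotFourier B fU l)⁻¹ *ᵥ (rotFourier B fU l *ᵥ
      harmFourier B (fun y => g y * fX y) l) = harmFourier B (fun y => g y * fX y) l := by
    rw [Matrix.mulVec_mulVec, Matrix.nonsing_inv_mul _ ((Matrix.isUnit_iff_isUnit_det _).1 (hinv l)),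
      Matrix.one_mulVec]
  conv_rhs => rw [← congrFun hmat q]
  simp only [Matrix.mulVec, dotProduct]
  rw [Finset.sum_mul]
  exact Finset.sum_congr rfl fun r _ => by ring

end IsHarmONB

/-! ### Conditioning on `X` in the presence of an independent factor. -/

section ConditionalMoments

variable {Ω α χ E : Type*} [MeasurableSpace Ω] [MeasurableSpace α] [MeasurableSpace χ]
  [MeasurableSpace E] {P : Measure Ω} [IsProbabilityMeasure P] {U : Ω → α} {X : Ω → χ} {e : Ω → E}
  {κ : α × χ → ℝ} {h : χ × E → ℝ} {C : ℝ}

/-- A factor `κ (U, X)` with `U` independent of `(X, e)` may be averaged over the law of `U`, and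
the remaining factor replaced by its conditional expectation given `X`. -/
theorem integral_mul_eq_integral_mul_condExp (hU : Measurable U) (hX : Measurable X)
    (he : Measurable e) (hind : IndepFun U (fun ω => (X ω, e ω)) P) (hκ : Measurable κ)
    (hκC : ∀ a, |κ a| ≤ C) (hh : Measurable h) (hint : Integrable (fun ω => h (X ω, e ω)) P) :
    ∫ ω, κ (U ω, X ω) * h (X ω, e ω) ∂P =
      ∫ ω, (∫ u, κ (u, X ω) ∂(P.map U)) *
        (P[fun ω => h (X ω, e ω) | MeasurableSpace.comap X inferInstance]) ω ∂P := by
  have hXe : Measurable fun ω => (X ω, e ω) := hX.prodMk he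
  have : IsProbabilityMeasure (P.map U) := Measure.isProbabilityMeasure_map hU.aemeasurable
  have : IsProbabilityMeasure (P.map fun ω => (X ω, e ω)) :=
    Measure.isProbabilityMeasure_map hXe.aemeasurable
  have hmap := (indepFun_iff_map_prod_eq_prod_map_map hU.aemeasurable hXe.aemeasurable).1 hind
  set F : α × (χ × E) → ℝ := fun z => κ (z.1, z.2.1) * h z.2 with hF
  have hFm : Measurable F :=
    (hκ.comp (measurable_fst.prodMk (measurable_fst.comp measurable_snd))).mul
      (hh.comp measurable_snd)
  have hFi : Integrable F ((P.map U).prod (P.map fun ω => (X ω, e ω))) := by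
    rw [← hmap, integrable_map_measure hFm.aestronglyMeasurable (hU.prodMk hXe).aemeasurable]
    exact hint.bdd_mul (c := C) (hκ.comp (hU.prodMk hX)).aestronglyMeasurable
      (Eventually.of_forall fun ω => hκC _)
  have hbar : StronglyMeasurable fun y => ∫ u, κ (u, y) ∂(P.map U) :=
    hκ.stronglyMeasurable.integral_prod_left'
  have hbarC : ∀ y, |∫ u, κ (u, y) ∂(P.map U)| ≤ C := fun y => by
    have := norm_integral_le_of_norm_le_const (μ := P.map U) (f := fun u => κ (u, y)) (C := C)
      (Eventually.of_forall fun u => hκC _)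
    simpa using this
  calc ∫ ω, κ (U ω, X ω) * h (X ω, e ω) ∂P
      = ∫ z, F z ∂((P.map U).prod (P.map fun ω => (X ω, e ω))) := by
        rw [← hmap, integral_map (hU.prodMk hXe).aemeasurable hFm.aestronglyMeasurable]
    _ = ∫ w, (∫ u, κ (u, w.1) ∂(P.map U)) * h w ∂(P.map fun ω => (X ω, e ω)) := by
        rw [integral_prod_symm _ hFi]
        simp only [hF, integral_mul_const]
    _ = ∫ ω, (∫ u, κ (u, X ω) ∂(P.map U)) * h (X ω, e ω) ∂P :=
        integral_map hXe.aemeasurable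
          ((hbar.measurable.comp measurable_fst).mul hh).aestronglyMeasurable
    _ = _ := by
        have hsm : StronglyMeasurable[MeasurableSpace.comap X inferInstance]
            fun ω => ∫ u, κ (u, X ω) ∂(P.map U) :=
          hbar.comp_measurable (comap_measurable X)
        have hpull := condExp_mul_of_stronglyMeasurable_left (μ := P) hsm
          (g := fun ω => h (X ω, e ω))
          (hint.bdd_mul (c := C) (hbar.measurable.comp hX).aestronglyMeasurable
            (Eventually.of_forall fun ω => hbarC _)) hint
        rw [← integral_condExp hX.comap_le]
        exact integral_congr_ae hpull

theorem integral_mul_eq_zero_of_condExp (hU : Measurable U) (hX : Measurable X)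
    (he : Measurable e) (hind : IndepFun U (fun ω => (X ω, e ω)) P) (hκ : Measurable κ)
    (hκC : ∀ a, |κ a| ≤ C) (hh : Measurable h) (hint : Integrable (fun ω => h (X ω, e ω)) P)
    (h0 : P[fun ω => h (X ω, e ω) | MeasurableSpace.comap X inferInstance] =ᵐ[P] 0) :
    ∫ ω, κ (U ω, X ω) * h (X ω, e ω) ∂P = 0 := by
  rw [integral_mul_eq_integral_mul_condExp hU hX he hind hκ hκC hh hint]
  refine integral_eq_zero_of_ae ?_
  filter_upwards [h0] with ω hω
  simp [hω]

/-- Both integrals are first rewritten with `κ` averaged over `U`, the left one by taking `h = 1`.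
The average is nonnegative, so the conditional bound may be integrated against it. -/
theorem mul_integral_le_integral_mul_of_condExp (hU : Measurable U) (hX : Measurable X)
    (he : Measurable e) (hind : IndepFun U (fun ω => (X ω, e ω)) P) (hκ : Measurable κ)
    (hκC : ∀ a, |κ a| ≤ C) (hκ0 : ∀ a, 0 ≤ κ a) (hh : Measurable h)
    (hint : Integrable (fun ω => h (X ω, e ω)) P) {c : ℝ}
    (hc : ∀ᵐ ω ∂P, c ≤ (P[fun ω => h (X ω, e ω) | MeasurableSpace.comap X inferInstance]) ω) :
    c * ∫ ω, κ (U ω, X ω) ∂P ≤ ∫ ω, κ (U ω, X ω) * h (X ω, e ω) ∂P := by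
  have hone := integral_mul_eq_integral_mul_condExp (h := fun _ => (1 : ℝ)) hU hX he hind hκ hκC
    measurable_const (integrable_const _)
  rw [condExp_const hX.comap_le] at hone
  simp only [mul_one] at hone
  have : IsProbabilityMeasure (P.map U) := Measure.isProbabilityMeasure_map hU.aemeasurable
  have hbar : StronglyMeasurable fun y => ∫ u, κ (u, y) ∂(P.map U) :=
    hκ.stronglyMeasurable.integral_prod_left'
  have hbarC : ∀ y, ‖∫ u, κ (u, y) ∂(P.map U)‖ ≤ C := fun y => by
    have := norm_integral_le_of_norm_le_const (μ := P.map U) (f := fun u => κ (u, y)) (C := C)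
      (Eventually.of_forall fun u => hκC _)
    simpa using this
  rw [hone, integral_mul_eq_integral_mul_condExp hU hX he hind hκ hκC hh hint,
    ← integral_const_mul]
  refine integral_mono_ae ?_ ?_ ?_
  · exact (Integrable.of_bound (hbar.measurable.comp hX).aestronglyMeasurable C
      (Eventually.of_forall fun ω => hbarC _)).const_mul c
  · exact integrable_condExp.bdd_mul (c := C) (hbar.measurable.comp hX).aestronglyMeasurable
      (Eventually.of_forall fun ω => hbarC _)
  · filter_upwards [hc] with ω hω
    rw [mul_comm]
    exact mul_le_mul_of_nonneg_left hω (integral_nonneg fun u => hκ0 _)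

theorem integral_mul_le_mul_integral_of_condExp (hU : Measurable U) (hX : Measurable X)
    (he : Measurable e) (hind : IndepFun U (fun ω => (X ω, e ω)) P) (hκ : Measurable κ)
    (hκC : ∀ a, |κ a| ≤ C) (hκ0 : ∀ a, 0 ≤ κ a) (hh : Measurable h)
    (hint : Integrable (fun ω => h (X ω, e ω)) P) {c : ℝ}
    (hc : ∀ᵐ ω ∂P, (P[fun ω => h (X ω, e ω) | MeasurableSpace.comap X inferInstance]) ω ≤ c) :
    ∫ ω, κ (U ω, X ω) * h (X ω, e ω) ∂P ≤ c * ∫ ω, κ (U ω, X ω) ∂P := by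
  have h1 := mul_integral_le_integral_mul_of_condExp (h := fun w => -h w) (c := -c) hU hX he hind
    hκ hκC hκ0 hh.neg hint.neg (by
      filter_upwards [hc, condExp_neg (μ := P) (fun ω => h (X ω, e ω))
        (MeasurableSpace.comap X inferInstance)] with ω h2 h3
      have h4 : (P[fun ω => -h (X ω, e ω) | MeasurableSpace.comap X inferInstance]) ω =
        -(P[fun ω => h (X ω, e ω) | MeasurableSpace.comap X inferInstance]) ω := h3
      rw [h4]; linarith)
  simp only [mul_neg, integral_neg, neg_mul] at h1
  linarith

end ConditionalMoments

/-! ### Limit theorems for row means and their ratios. -/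

section RatioEstimator

variable {Ω : Type*} [MeasurableSpace Ω] {P : Measure Ω} [IsProbabilityMeasure P]

theorem tendstoInMeasure_zero_of_integral_sq {f : ℕ → Ω → ℝ}
    (hf : ∀ᶠ n in atTop, MemLp (f n) 2 P)
    (h : Tendsto (fun n => ∫ ω, f n ω ^ 2 ∂P) atTop (𝓝 0)) :
    TendstoInMeasure P f atTop fun _ => (0 : ℝ) := by
  rw [tendstoInMeasure_iff_measureReal_norm]
  intro η hη
  refine squeeze_zero' (Eventually.of_forall fun n => measureReal_nonneg) ?_
    (by simpa using h.const_mul (η ^ 2)⁻¹)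
  filter_upwards [hf] with n hn
  have h1 := mul_meas_ge_le_integral_of_nonneg (μ := P) (f := fun ω => f n ω ^ 2)
    (Eventually.of_forall fun ω => sq_nonneg _) hn.integrable_sq (η ^ 2)
  have h2 : {ω | η ^ 2 ≤ f n ω ^ 2} = {ω | η ≤ ‖f n ω - 0‖} := by
    ext ω
    simp only [sub_zero, Set.mem_ofPred_eq, Real.norm_eq_abs]
    rw [← sq_abs (f n ω), sq_le_sq₀ hη.le (abs_nonneg _)]
  rw [h2] at h1
  rw [inv_mul_eq_div, le_div_iff₀ (by positivity), mul_comm]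
  exact h1

theorem integral_sq_mean_sub_le {G : Ω → ℝ} {V : ℕ → Ω → ℝ} (hind : iIndepFun V P)
    (hV : ∀ i, IdentDistrib (V i) G P P) (hG : MemLp G 2 P) (a : ℝ) {n : ℕ} (hn : n ≠ 0) :
    MemLp (fun ω => (n : ℝ)⁻¹ * ∑ i ∈ Finset.range n, V i ω - a) 2 P ∧
    ∫ ω, ((n : ℝ)⁻¹ * ∑ i ∈ Finset.range n, V i ω - a) ^ 2 ∂P ≤
      (∫ ω, G ω ^ 2 ∂P) / n + (∫ ω, G ω ∂P - a) ^ 2 := by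
  have hn' : (n : ℝ) ≠ 0 := Nat.cast_ne_zero.2 hn
  have hVL : ∀ i, MemLp (V i) 2 P := fun i => (hV i).memLp_iff.2 hG
  have hsum : MemLp (fun ω => ∑ i ∈ Finset.range n, V i ω) 2 P :=
    memLp_finsetSum _ fun i _ => hVL i
  have hmean : MemLp (fun ω => (n : ℝ)⁻¹ * ∑ i ∈ Finset.range n, V i ω) 2 P := hsum.const_mul _
  have hL : MemLp (fun ω => (n : ℝ)⁻¹ * ∑ i ∈ Finset.range n, V i ω - a) 2 P :=
    hmean.sub (memLp_const a)
  refine ⟨hL, ?_⟩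
  have hvar : Var[fun ω => ∑ i ∈ Finset.range n, V i ω; P] = n * Var[G; P] := by
    have h1 := IndepFun.variance_sum (μ := P) (s := Finset.range n) (X := V) (fun i _ => hVL i)
      fun i _ j _ hij => hind.indepFun hij
    have h2 : (fun ω => ∑ i ∈ Finset.range n, V i ω) = ∑ i ∈ Finset.range n, V i := by
      ext ω; simp
    rw [h2, h1, Finset.sum_congr rfl fun i _ => (hV i).variance_eq]
    simp
  have hE : ∫ ω, ((n : ℝ)⁻¹ * ∑ i ∈ Finset.range n, V i ω - a) ∂P = ∫ ω, G ω ∂P - a := by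
    rw [integral_sub (hmean.integrable one_le_two) (integrable_const a), integral_const_mul,
      integral_finsetSum _ fun i _ => (hVL i).integrable one_le_two,
      Finset.sum_congr rfl fun i _ => (hV i).integral_eq]
    simp [hn']
  have h3 := variance_eq_sub hL
  rw [variance_sub_const hmean.aestronglyMeasurable, variance_const_mul, hvar] at h3
  simp only [Pi.pow_apply] at h3
  rw [hE] at h3
  have h4 : Var[G; P] ≤ ∫ ω, G ω ^ 2 ∂P := variance_le_expectation_sq hG.aestronglyMeasurable
  have h5 : ((n : ℝ)⁻¹) ^ 2 * (n * Var[G; P]) = Var[G; P] / n := by field_simp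
  have h6 : Var[G; P] / n ≤ (∫ ω, G ω ^ 2 ∂P) / n := by gcongr
  linarith

theorem abs_sub_rpow_le {a b δ : ℝ} (hδ : 0 < δ) (hb : |b| ≤ 1) :
    |a - b| ^ δ ≤ 2 ^ δ * (|a| ^ δ + 1) := by
  have h1 : |a - b| ≤ 2 * max |a| 1 := by
    have := abs_sub a b
    have := le_max_left |a| 1
    have := le_max_right |a| 1
    linarith
  calc |a - b| ^ δ ≤ (2 * max |a| 1) ^ δ := by gcongr
    _ = 2 ^ δ * (max |a| 1) ^ δ := Real.mul_rpow (by norm_num) (by positivity)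
    _ ≤ _ := by
      gcongr
      rcases max_cases |a| 1 with h | h <;> rw [h.1]
      · linarith
      · rw [Real.one_rpow]; have := Real.rpow_nonneg (abs_nonneg a) δ; linarith

/-- Lyapunov's theorem for the standardized row means of a triangular array whose `n`-th row
consists of independent copies of `W n`. -/
theorem tendstoInDistribution_standardized {W : ℕ → Ω → ℝ} {V : ℕ → ℕ → Ω → ℝ}
    (hind : ∀ n, iIndepFun (V n) P) (hV : ∀ n i, IdentDistrib (V n i) (W n) P P) {δ : ℝ}
    (hδ : 0 < δ) (hδ1 : δ ≤ 1) (hW : ∀ n, MemLp (W n) (ENNReal.ofReal (2 + δ)) P) {v₀ : ℝ}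
    (hv₀ : 0 < v₀) (hvar : ∀ᶠ n in atTop, v₀ ≤ Var[W n; P])
    (hmean : Tendsto (fun n => ∫ ω, W n ω ∂P) atTop (𝓝 0))
    (hlim : Tendsto (fun n : ℕ => (√(n : ℝ))⁻¹ ^ δ *
      ((∫ ω, |W n ω| ^ (2 + δ) ∂P) / (√Var[W n; P]) ^ (2 + δ))) atTop (𝓝 0)) :
    TendstoInDistribution (fun (n : ℕ) ω => (√(n : ℝ))⁻¹ * ∑ i ∈ Finset.range n,
      (V n i ω - ∫ ω', W n ω' ∂P) / √Var[W n; P]) atTop (id : ℝ → ℝ) (fun _ => P)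
      (gaussianReal 0 1) := by
  have hδ2 : (0 : ℝ) < 2 + δ := by linarith
  have hp2 : (2 : ENNReal) ≤ ENNReal.ofReal (2 + δ) := by
    rw [← ENNReal.ofReal_ofNat 2]; exact ENNReal.ofReal_le_ofReal (by linarith)
  have hW2 : ∀ n, MemLp (W n) 2 P := fun n => (hW n).mono_exponent hp2
  set μ : ℕ → ℝ := fun n => ∫ ω, W n ω ∂P with hμ
  set s : ℕ → ℝ := fun n => √Var[W n; P] with hs
  have hphi : ∀ n, Measurable fun y : ℝ => (y - μ n) / s n := fun n =>
    (measurable_id.sub_const _).div_const _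
  have hid : ∀ n i, IdentDistrib (fun ω => (V n i ω - μ n) / s n)
      (fun ω => (W n ω - μ n) / s n) P P := fun n i => (hV n i).comp (hphi n)
  have hlp : ∀ n, MemLp (fun ω => (W n ω - μ n) / s n) (ENNReal.ofReal (2 + δ)) P := fun n => by
    have h := ((hW n).sub (memLp_const (μ n))).const_mul (s n)⁻¹
    refine h.congr_norm (h.aestronglyMeasurable.congr (Eventually.of_forall fun ω => ?_))
      (Eventually.of_forall fun ω => ?_) <;> simp [div_eq_inv_mul]
  have hspos : ∀ᶠ n in atTop, 0 < s n := by
    filter_upwards [hvar] with n hn using Real.sqrt_pos.2 (hv₀.trans_le hn)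
  have habs : ∀ n, Integrable (fun ω => |W n ω| ^ (2 + δ)) P := fun n => by
    simpa [ENNReal.toReal_ofReal hδ2.le] using (hW n).integrable_norm_rpow'
  have habs' : ∀ n, Integrable (fun ω => |(W n ω - μ n) / s n| ^ (2 + δ)) P := fun n => by
    simpa [ENNReal.toReal_ofReal hδ2.le, abs_div] using (hlp n).integrable_norm_rpow'
  refine tendstoInDistribution_of_lyapunov (V := fun n i ω => (V n i ω - μ n) / s n) (δ := δ)
    (fun n => (hind n).comp _ fun _ => hphi n)
    (fun n i => (hid n i).trans (hid n 0).symm) hδ hδ1 ?_ ?_ ?_ ?_ ?_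
  · refine Eventually.of_forall fun n => ?_
    rw [(hid n 0).integral_eq, integral_div,
      integral_sub ((hW2 n).integrable one_le_two) (integrable_const _)]
    simp [hμ]
  · filter_upwards [hspos] with n hn
    have h1 := ((hid n 0).comp (measurable_id.pow_const 2)).integral_eq
    have h2 : Var[W n; P] = ∫ ω, (W n ω - μ n) ^ 2 ∂P :=
      variance_eq_integral (hW2 n).aemeasurable
    have h3 : s n ^ 2 = Var[W n; P] := Real.sq_sqrt (variance_nonneg _ _)
    calc _ = ∫ ω, ((W n ω - μ n) / s n) ^ 2 ∂P := h1
      _ = (∫ ω, (W n ω - μ n) ^ 2 ∂P) / s n ^ 2 := by simp only [div_pow, integral_div]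
      _ = 1 := by rw [← h2, ← h3]; exact div_self (by positivity)
  · exact Eventually.of_forall fun n => (hid n 0).memLp_iff.2 ((hlp n).mono_exponent hp2)
  · refine Eventually.of_forall fun n => ?_
    exact ((hid n 0).comp (measurable_abs.pow_const (2 + δ))).integrable_iff.2 (habs' n)
  -- Centring is harmless: since eventually `|μ n| ≤ 1`, it only adds a constant to the absolute
  -- moment, and this is negligible because the variances stay above `v₀`.
  · have hμ1 : ∀ᶠ n in atTop, |μ n| ≤ 1 := by
      have h1 := hmean.abs
      rw [abs_zero] at h1
      filter_upwards [h1.eventually_lt_const one_pos] with n hn using le_of_lt hn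
    have hz : Tendsto (fun n : ℕ => (√(n : ℝ))⁻¹ ^ δ) atTop (𝓝 0) := by
      have h1 : Tendsto (fun n : ℕ => (√(n : ℝ))⁻¹) atTop (𝓝 0) :=
        (Real.tendsto_sqrt_atTop.comp tendsto_natCast_atTop_atTop).inv_tendsto_atTop
      simpa [Real.zero_rpow hδ.ne'] using h1.rpow_const (p := δ) (Or.inr hδ.le)
    have hup := (hlim.const_mul (2 ^ (2 + δ))).add (hz.const_mul (2 ^ (2 + δ) / (√v₀) ^ (2 + δ)))
    simp only [mul_zero, add_zero] at hup
    refine squeeze_zero' (Eventually.of_forall fun n => mul_nonneg (by positivity)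
      (integral_nonneg fun ω => by positivity)) ?_ hup
    filter_upwards [hμ1, hspos, hvar] with n h1 h2 h3
    have hv : √v₀ ≤ s n := Real.sqrt_le_sqrt h3
    have hsv : 0 < √v₀ := Real.sqrt_pos.2 hv₀
    have e1 : ∫ ω, |(V n 0 ω - μ n) / s n| ^ (2 + δ) ∂P =
        ∫ ω, |(W n ω - μ n) / s n| ^ (2 + δ) ∂P :=
      ((hid n 0).comp (measurable_abs.pow_const (2 + δ))).integral_eq
    have e2 : ∫ ω, |(W n ω - μ n) / s n| ^ (2 + δ) ∂P ≤
        2 ^ (2 + δ) * ((∫ ω, |W n ω| ^ (2 + δ) ∂P) + 1) / s n ^ (2 + δ) := by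
      have e3 : ∀ ω, |(W n ω - μ n) / s n| ^ (2 + δ) ≤
          2 ^ (2 + δ) * (|W n ω| ^ (2 + δ) + 1) / s n ^ (2 + δ) := fun ω => by
        rw [abs_div, abs_of_pos h2, Real.div_rpow (abs_nonneg _) h2.le]
        gcongr
        exact abs_sub_rpow_le hδ2 h1
      refine (integral_mono (habs' n) ((((habs n).add (integrable_const 1)).const_mul _).div_const
        _) e3).trans_eq ?_
      rw [integral_div, integral_const_mul]
      congr 2
      refine (integral_add (habs n) (integrable_const 1)).trans ?_
      simp
    rw [e1]
    calc _ ≤ (√(n : ℝ))⁻¹ ^ δ *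
          (2 ^ (2 + δ) * ((∫ ω, |W n ω| ^ (2 + δ) ∂P) + 1) / s n ^ (2 + δ)) := by gcongr
      _ = 2 ^ (2 + δ) * ((√(n : ℝ))⁻¹ ^ δ * ((∫ ω, |W n ω| ^ (2 + δ) ∂P) / s n ^ (2 + δ))) +
          2 ^ (2 + δ) / s n ^ (2 + δ) * (√(n : ℝ))⁻¹ ^ δ := by ring
      _ ≤ _ := by gcongr

/-- Asymptotic normality of a self-normalized ratio `∑ κ n (z i) * y i / ∑ κ n (z i)`. -/
theorem tendstoInDistribution_ratio {χ : Type*} [MeasurableSpace χ] {Y : Ω → ℝ} {Z : Ω → χ}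
    {Ys : ℕ → Ω → ℝ} {Zs : ℕ → Ω → χ} (hiid : iIndepFun (fun i ω => (Ys i ω, Zs i ω)) P)
    (hlaw : ∀ i, IdentDistrib (fun ω => (Ys i ω, Zs i ω)) (fun ω => (Y ω, Z ω)) P P)
    {κ : ℕ → χ → ℝ} (hκ : ∀ n, Measurable (κ n)) (hκL : ∀ n, MemLp (fun ω => κ n (Z ω)) 2 P)
    {f₀ m₀ : ℝ} (hf₀ : 0 < f₀) {δ : ℝ} (hδ : 0 < δ) (hδ1 : δ ≤ 1)
    (hW : ∀ n, MemLp (fun ω => κ n (Z ω) * (Y ω - m₀)) (ENNReal.ofReal (2 + δ)) P)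
    {v₀ c : ℝ} (hv₀ : 0 < v₀) (hc : 0 < c)
    (hvar : ∀ᶠ n in atTop, v₀ ≤ Var[fun ω => κ n (Z ω) * (Y ω - m₀); P])
    (hvar' : ∀ᶠ n in atTop,
      c * ∫ ω, κ n (Z ω) ^ 2 ∂P ≤ Var[fun ω => κ n (Z ω) * (Y ω - m₀); P])
    (hmean : Tendsto (fun n => ∫ ω, κ n (Z ω) * (Y ω - m₀) ∂P) atTop (𝓝 0))
    (hlim : Tendsto (fun n : ℕ => (√(n : ℝ))⁻¹ ^ δ *
      ((∫ ω, |κ n (Z ω) * (Y ω - m₀)| ^ (2 + δ) ∂P) /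
        (√Var[fun ω => κ n (Z ω) * (Y ω - m₀); P]) ^ (2 + δ))) atTop (𝓝 0))
    (hsq : Tendsto (fun n : ℕ => (∫ ω, κ n (Z ω) ^ 2 ∂P) / n) atTop (𝓝 0))
    (hbias : Tendsto (fun n => ∫ ω, κ n (Z ω) ∂P - f₀) atTop (𝓝 0))
    (hprod : Tendsto (fun n : ℕ => √(n : ℝ) * (∫ ω, κ n (Z ω) * (Y ω - m₀) ∂P) *
      (∫ ω, κ n (Z ω) ∂P - f₀) / √Var[fun ω => κ n (Z ω) * (Y ω - m₀); P]) atTop (𝓝 0)) :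
    TendstoInDistribution (fun (n : ℕ) ω => √(n : ℝ) *
      ((((n : ℝ)⁻¹ * ∑ i ∈ Finset.range n, κ n (Zs i ω))⁻¹ *
          ((n : ℝ)⁻¹ * ∑ i ∈ Finset.range n, κ n (Zs i ω) * Ys i ω) - m₀ -
          (∫ ω', κ n (Z ω') * (Y ω' - m₀) ∂P) / f₀) /
        (√Var[fun ω' => κ n (Z ω') * (Y ω' - m₀); P] / f₀)))
      atTop (id : ℝ → ℝ) (fun _ => P) (gaussianReal 0 1) := by
  set W : ℕ → Ω → ℝ := fun n ω => κ n (Z ω) * (Y ω - m₀) with hWdef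
  set μ : ℕ → ℝ := fun n => ∫ ω, W n ω ∂P with hμ
  set s : ℕ → ℝ := fun n => √Var[W n; P] with hs
  set b : ℕ → ℝ := fun n => ∫ ω, κ n (Z ω) ∂P - f₀ with hb
  set S : ℕ → ℝ := fun n => ∫ ω, κ n (Z ω) ^ 2 ∂P with hS
  have hφm : ∀ n, Measurable fun w : ℝ × χ => κ n w.2 * (w.1 - m₀) := fun n =>
    ((hκ n).comp measurable_snd).mul (measurable_fst.sub_const _)
  have hψm : ∀ n, Measurable fun w : ℝ × χ => κ n w.2 := fun n => (hκ n).comp measurable_snd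
  have hVid : ∀ n i, IdentDistrib (fun ω => κ n (Zs i ω) * (Ys i ω - m₀)) (W n) P P := fun n i =>
    (hlaw i).comp (hφm n)
  have hKid : ∀ n i, IdentDistrib (fun ω => κ n (Zs i ω)) (fun ω => κ n (Z ω)) P P := fun n i =>
    (hlaw i).comp (hψm n)
  set A : ℕ → Ω → ℝ := fun n ω => (√(n : ℝ))⁻¹ * ∑ i ∈ Finset.range n,
      (κ n (Zs i ω) * (Ys i ω - m₀) - μ n) / s n with hA
  have hclt : TendstoInDistribution A atTop (id : ℝ → ℝ) (fun _ => P) (gaussianReal 0 1) :=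
    tendstoInDistribution_standardized (V := fun n i ω => κ n (Zs i ω) * (Ys i ω - m₀)) (W := W)
      (fun n => hiid.comp _ fun _ => hφm n) hVid hδ hδ1 hW hv₀ hvar hmean hlim
  set F : ℕ → Ω → ℝ := fun n ω => (n : ℝ)⁻¹ * ∑ i ∈ Finset.range n, κ n (Zs i ω) with hF
  have hFm : ∀ n, AEMeasurable (F n) P := fun n =>
    (Finset.aemeasurable_fun_sum _ fun i _ => (hKid n i).aemeasurable_fst).const_mul _
  have hAm : ∀ n, AEMeasurable (A n) P := hclt.forall_aemeasurable
  have hFsq : ∀ n, n ≠ 0 → MemLp (fun ω => F n ω - f₀) 2 P ∧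
      ∫ ω, (F n ω - f₀) ^ 2 ∂P ≤ S n / n + b n ^ 2 := fun n hn =>
    integral_sq_mean_sub_le (hiid.comp (fun _ w => κ n w.2) fun _ => hψm n) (hKid n) (hκL n) f₀ hn
  have hFtend : TendstoInMeasure P (fun n ω => F n ω - f₀) atTop fun _ => (0 : ℝ) := by
    refine tendstoInMeasure_zero_of_integral_sq ?_ ?_
    · filter_upwards [eventually_ne_atTop 0] with n hn using (hFsq n hn).1
    · refine squeeze_zero' (Eventually.of_forall fun n => integral_nonneg fun ω => sq_nonneg _)
        ?_ (by simpa using hsq.add (hbias.pow 2))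
      filter_upwards [eventually_ne_atTop 0] with n hn using (hFsq n hn).2
  have hFtend' : TendstoInMeasure P F atTop fun _ => f₀ := by
    rw [tendstoInMeasure_iff_norm] at hFtend ⊢
    simpa using hFtend
  -- `R n / f₀` is the error from subtracting the deterministic `μ n / f₀` while dividing by the
  -- random `F n`. Where `F n > f₀ / 2`, the studentized ratio is exactly `(A n - R n / f₀) * (f₀ /
  -- F n)`.
  set R : ℕ → Ω → ℝ := fun n ω => √(n : ℝ) * μ n / s n * (F n ω - f₀) with hR
  have hRtend : TendstoInMeasure P (fun n ω => R n ω / f₀) atTop fun _ => (0 : ℝ) := by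
    refine tendstoInMeasure_zero_of_integral_sq ?_ ?_
    · filter_upwards [eventually_ne_atTop 0] with n hn
      have := (hFsq n hn).1.const_mul (√(n : ℝ) * μ n / s n / f₀)
      refine this.ae_eq (Eventually.of_forall fun ω => ?_)
      simp only [hR]; ring
    -- The mean square error of `F n` is at most `S n / n + b n ^ 2`. Its stochastic part leaves `μ
    -- n ^ 2 * S n / s n ^ 2`, bounded by `hvar'`; its bias part is the square of the quantity in
    -- `hprod`.
    · have hup : Tendsto (fun n : ℕ => (μ n ^ 2 * c⁻¹ + (√(n : ℝ) * μ n * b n / s n) ^ 2) / f₀ ^ 2)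
          atTop (𝓝 0) := by
        simpa using (((hmean.pow 2).mul_const c⁻¹).add (hprod.pow 2)).div_const (f₀ ^ 2)
      refine squeeze_zero' (Eventually.of_forall fun n => integral_nonneg fun ω => sq_nonneg _)
        ?_ hup
      filter_upwards [eventually_ne_atTop 0, hvar, hvar'] with n hn h1 h2
      have hn' : (0 : ℝ) < n := Nat.cast_pos.2 (Nat.pos_of_ne_zero hn)
      have hsn : s n ^ 2 = Var[W n; P] := Real.sq_sqrt (variance_nonneg _ _)
      have hv : 0 < s n ^ 2 := by rw [hsn]; exact hv₀.trans_le h1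
      have e1 : ∀ ω, (R n ω / f₀) ^ 2 = (n * μ n ^ 2 / s n ^ 2 / f₀ ^ 2) * (F n ω - f₀) ^ 2 :=
        fun ω => by
          simp only [hR, div_pow, mul_pow, Real.sq_sqrt hn'.le]; ring
      simp_rw [e1]
      rw [integral_const_mul]
      calc _ ≤ (n * μ n ^ 2 / s n ^ 2 / f₀ ^ 2) * (S n / n + b n ^ 2) := by
            gcongr; exact (hFsq n hn).2
        _ = (μ n ^ 2 * (S n / s n ^ 2) + (√(n : ℝ) * μ n * b n / s n) ^ 2) / f₀ ^ 2 := by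
            rw [div_pow, mul_pow, mul_pow, Real.sq_sqrt hn'.le]; field_simp
        _ ≤ _ := by
            gcongr
            rw [div_le_iff₀ hv, hsn, inv_mul_eq_div, le_div_iff₀ hc, mul_comm]
            exact h2
  have hARt : TendstoInDistribution (fun n ω => A n ω - R n ω / f₀) atTop (id : ℝ → ℝ)
      (fun _ => P) (gaussianReal 0 1) := by
    refine tendstoInDistribution_of_tendstoInMeasure_sub _ _ hclt ?_ fun n => ?_
    · rw [tendstoInMeasure_iff_norm] at hRtend ⊢
      simpa using hRtend
    · exact (hAm n).sub ((((hFm n).sub_const _).const_mul _).div_const _)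
  -- The truncation at `f₀ / 2` makes the Slutsky map continuous everywhere; it is inactive with
  -- probability tending to one.
  have hslut := hARt.continuous_comp_prodMk_of_tendstoInMeasure_const
    (g := fun w : ℝ × ℝ => w.1 * (f₀ / max w.2 (f₀ / 2)))
    (continuous_fst.mul (continuous_const.div (continuous_snd.max continuous_const) fun w =>
      (lt_of_lt_of_le (half_pos hf₀) (le_max_right _ _)).ne')) hFtend' hFm
  have hlimid : (fun ω : ℝ => id ω * (f₀ / max f₀ (f₀ / 2))) = id := by
    funext ω
    rw [max_eq_left (half_le_self hf₀.le), div_self hf₀.ne', mul_one]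
  simp only [hlimid] at hslut
  have hYm : ∀ i, AEMeasurable (Ys i) P := fun i => measurable_fst.comp_aemeasurable
    (hlaw i).aemeasurable_fst
  refine tendstoInDistribution_of_tendstoInMeasure_sub _ _ hslut ?_ fun n => ?_
  · rw [tendstoInMeasure_iff_measureReal_norm] at hFtend' ⊢
    intro η hη
    refine squeeze_zero' (Eventually.of_forall fun n => measureReal_nonneg) ?_
      (hFtend' (f₀ / 2) (half_pos hf₀))
    filter_upwards [eventually_ne_atTop 0] with n hn
    refine measureReal_mono ?_
    intro ω hω
    by_contra hcon
    have hn' : (0 : ℝ) < n := Nat.cast_pos.2 (Nat.pos_of_ne_zero hn)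
    have hFω : f₀ / 2 < F n ω := by
      simp only [Set.mem_ofPred_eq, not_le, Real.norm_eq_abs] at hcon
      have := (abs_lt.1 hcon).1
      linarith
    have hF0 : F n ω ≠ 0 := by linarith [half_pos hf₀]
    have hsqrt : √(n : ℝ) ≠ 0 := (Real.sqrt_pos.2 hn').ne'
    have hnn : √(n : ℝ) * √(n : ℝ) = n := Real.mul_self_sqrt hn'.le
    set G := (n : ℝ)⁻¹ * ∑ i ∈ Finset.range n, κ n (Zs i ω) * Ys i ω with hG
    have hAω : A n ω = √(n : ℝ) * (G - m₀ * F n ω - μ n) / s n := by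
      simp only [hA, hG, hF, ← Finset.sum_div, Finset.sum_sub_distrib, mul_sub, Finset.sum_const,
        Finset.card_range, nsmul_eq_mul, ← Finset.sum_mul]
      have : (n : ℝ)⁻¹ = (√(n : ℝ))⁻¹ * (√(n : ℝ))⁻¹ := by rw [← mul_inv, hnn]
      rw [this]
      field_simp
      rw [Real.sq_sqrt hn'.le]
    have hzero : √(n : ℝ) * (((F n ω)⁻¹ * G - m₀ - μ n / f₀) / (s n / f₀)) -
        (A n ω - R n ω / f₀) * (f₀ / max (F n ω) (f₀ / 2)) = 0 := by
      rw [max_eq_left hFω.le, hAω]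
      simp only [hR]
      by_cases hs0 : s n = 0
      · simp [hs0]
      · field_simp
        ring
    simp only [Set.mem_ofPred_eq, Pi.sub_apply, Pi.zero_apply, sub_zero] at hω
    rw [hzero, norm_zero] at hω
    linarith
  · refine AEMeasurable.const_mul (((((hFm n).inv.mul ?_).sub_const _).sub_const _).div_const _) _
    exact (Finset.aemeasurable_fun_sum _ fun i _ =>
      (hKid n i).aemeasurable_fst.mul (hYm i)).const_mul _

end RatioEstimator

/-! ### Moments of the kernel times the centred response. -/

section ConditionalMoments

variable {Ω α χ : Type*} [MeasurableSpace Ω] [MeasurableSpace α] [MeasurableSpace χ]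
  {P : Measure Ω} [IsProbabilityMeasure P] {U : Ω → α} {X : Ω → χ} {ε : Ω → ℝ}
  {κ : α × χ → ℝ} {M : ℝ}

theorem integral_kernel_mul_eq (hU : Measurable U) (hX : Measurable X) (hε : Measurable ε)
    (hind : IndepFun U (fun ω => (X ω, ε ω)) P) (hκ : Measurable κ) (hκM : ∀ a, |κ a| ≤ M)
    (hε_int : Integrable ε P) (hε_mean : P[ε | MeasurableSpace.comap X inferInstance] =ᵐ[P] 0)
    {g : χ → ℝ} (hg : Measurable g) {G : ℝ} (hgG : ∀ y, |g y| ≤ G) :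
    ∫ ω, κ (U ω, X ω) * (g (X ω) + ε ω) ∂P = ∫ ω, κ (U ω, X ω) * g (X ω) ∂P := by
  have hκm : AEStronglyMeasurable (fun ω => κ (U ω, X ω)) P :=
    (hκ.comp (hU.prodMk hX)).aestronglyMeasurable
  have hgi : Integrable (fun ω => g (X ω)) P :=
    Integrable.of_bound (hg.comp hX).aestronglyMeasurable G (Eventually.of_forall fun ω => hgG _)
  have h0 := integral_mul_eq_zero_of_condExp (h := fun w => w.2) hU hX hε hind hκ hκM
    measurable_snd hε_int hε_mean
  simp_rw [mul_add]
  rw [integral_add (hgi.bdd_mul (c := M) hκm (Eventually.of_forall fun ω => hκM _))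
    (hε_int.bdd_mul (c := M) hκm (Eventually.of_forall fun ω => hκM _)), h0, add_zero]

/-- Expanding the square, the cross term vanishes because the noise has conditional mean zero, the
`g²` term is nonnegative, and the noise term is bounded below conditionally. -/
theorem mul_integral_sq_le_integral_sq (hU : Measurable U) (hX : Measurable X)
    (hε : Measurable ε) (hind : IndepFun U (fun ω => (X ω, ε ω)) P) (hκ : Measurable κ)
    (hκM : ∀ a, |κ a| ≤ M) (hε2 : MemLp ε 2 P)
    (hε_mean : P[ε | MeasurableSpace.comap X inferInstance] =ᵐ[P] 0) {c : ℝ}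
    (hε_var : ∀ᵐ ω ∂P,
      c ≤ (P[fun ω' => ε ω' ^ 2 | MeasurableSpace.comap X inferInstance]) ω)
    {g : χ → ℝ} (hg : Measurable g) {G : ℝ} (hgG : ∀ y, |g y| ≤ G) :
    c * ∫ ω, κ (U ω, X ω) ^ 2 ∂P ≤ ∫ ω, (κ (U ω, X ω) * (g (X ω) + ε ω)) ^ 2 ∂P := by
  have hκ2 : ∀ a, |κ a ^ 2| ≤ M ^ 2 := fun a => by
    rw [abs_pow]; exact pow_le_pow_left₀ (abs_nonneg _) (hκM a) 2
  have hκg : ∀ a : α × χ, |2 * κ a ^ 2 * g a.2| ≤ 2 * M ^ 2 * G := fun a => by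
    rw [abs_mul, abs_mul, abs_two]
    have := (abs_nonneg _).trans (hgG a.2)
    gcongr
    · exact hκ2 a
    · exact hgG _
  have hκgm : Measurable fun a : α × χ => 2 * κ a ^ 2 * g a.2 :=
    ((hκ.pow_const 2).const_mul 2).mul (hg.comp measurable_snd)
  have h0 := integral_mul_eq_zero_of_condExp (h := fun w => w.2) hU hX hε hind hκgm hκg
    measurable_snd (hε2.integrable one_le_two) hε_mean
  have h1 := mul_integral_le_integral_mul_of_condExp (h := fun w => w.2 ^ 2) hU hX hε hind
    (hκ.pow_const 2) hκ2 (fun a => sq_nonneg _) (measurable_snd.pow_const 2) hε2.integrable_sq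
    hε_var
  have hUX := hU.prodMk hX
  have hi1 : Integrable (fun ω => κ (U ω, X ω) ^ 2 * g (X ω) ^ 2) P := by
    refine Integrable.of_bound (((hκ.comp hUX).pow_const 2).mul
      ((hg.comp hX).pow_const 2)).aestronglyMeasurable (M ^ 2 * G ^ 2)
      (Eventually.of_forall fun ω => ?_)
    rw [Real.norm_eq_abs, abs_mul, abs_pow (g _)]
    gcongr
    · exact hκ2 _
    · exact hgG _
  have hi2 : Integrable (fun ω => 2 * κ (U ω, X ω) ^ 2 * g (X ω) * ε ω) P :=
    (hε2.integrable one_le_two).bdd_mul (hκgm.comp hUX).aestronglyMeasurable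
      (Eventually.of_forall fun ω => hκg (U ω, X ω))
  have hi3 : Integrable (fun ω => κ (U ω, X ω) ^ 2 * ε ω ^ 2) P :=
    hε2.integrable_sq.bdd_mul ((hκ.pow_const 2).comp hUX).aestronglyMeasurable
      (Eventually.of_forall fun ω => hκ2 (U ω, X ω))
  have e : ∀ ω, (κ (U ω, X ω) * (g (X ω) + ε ω)) ^ 2 = κ (U ω, X ω) ^ 2 * g (X ω) ^ 2 +
      2 * κ (U ω, X ω) ^ 2 * g (X ω) * ε ω + κ (U ω, X ω) ^ 2 * ε ω ^ 2 := fun ω => by ring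
  have hi12 : Integrable (fun ω => κ (U ω, X ω) ^ 2 * g (X ω) ^ 2 +
      2 * κ (U ω, X ω) ^ 2 * g (X ω) * ε ω) P := hi1.add hi2
  simp only at h0 h1
  simp_rw [e]
  rw [integral_add hi12 hi3, integral_add hi1 hi2, h0, add_zero]
  have : 0 ≤ ∫ ω, κ (U ω, X ω) ^ 2 * g (X ω) ^ 2 ∂P :=
    integral_nonneg fun ω => by positivity
  linarith

theorem abs_sub_rpow_le_add {a b δ δ' : ℝ} (hδ' : 0 < δ') (h : δ' ≤ δ) :
    |a - b| ^ δ' ≤ 1 + 2 ^ δ * |b| ^ δ + 2 ^ δ * |a| ^ δ := by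
  have hδ : 0 < δ := hδ'.trans_le h
  have h1 : |a - b| ^ δ' ≤ 1 + |a - b| ^ δ := by
    rcases le_total |a - b| 1 with h1 | h1
    · have := Real.rpow_le_one (abs_nonneg _) h1 hδ'.le
      have := Real.rpow_nonneg (abs_nonneg (a - b)) δ
      linarith
    · have := Real.rpow_le_rpow_of_exponent_le h1 h
      linarith
  have h2 : |a - b| ^ δ ≤ 2 ^ δ * |b| ^ δ + 2 ^ δ * |a| ^ δ := by
    have h3 : |a - b| ≤ 2 * max |a| |b| := by
      have := abs_sub a b
      have := le_max_left |a| |b|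
      have := le_max_right |a| |b|
      linarith
    calc |a - b| ^ δ ≤ (2 * max |a| |b|) ^ δ := by gcongr
      _ = 2 ^ δ * (max |a| |b|) ^ δ := Real.mul_rpow (by norm_num) (by positivity)
      _ ≤ _ := by
        rw [← mul_add]
        gcongr
        have ha := Real.rpow_nonneg (abs_nonneg a) δ
        have hb := Real.rpow_nonneg (abs_nonneg b) δ
        rcases max_cases |a| |b| with h | h <;> rw [h.1] <;> linarith
  linarith

/-- Only `|κ|^δ'` is bounded uniformly, leaving `κ²` inside the integral, so the estimate is
comparable with the variance. `K` does not depend on `κ`, hence serves all sample sizes. -/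
theorem exists_integral_abs_rpow_le (hU : Measurable U) (hX : Measurable X) (hε : Measurable ε)
    (hind : IndepFun U (fun ω => (X ω, ε ω)) P) {m : χ → ℝ} (hm : Measurable m) {δ δ' : ℝ}
    (hδ' : 0 < δ') (hδ : δ' ≤ δ)
    (hY_int : Integrable (fun ω => |m (X ω) + ε ω| ^ (2 + δ)) P)
    (hY_bdd : ∃ C : ℝ, ∀ᵐ ω ∂P,
      (P[fun ω' => |m (X ω') + ε ω'| ^ (2 + δ) | MeasurableSpace.comap X inferInstance]) ω ≤ C)
    (m₀ : ℝ) :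
    ∃ K, 0 ≤ K ∧ ∀ (κ : α × χ → ℝ) (M : ℝ), Measurable κ → (∀ a, |κ a| ≤ M) →
      ∫ ω, |κ (U ω, X ω) * (m (X ω) + ε ω - m₀)| ^ (2 + δ') ∂P ≤
        K * (M ^ δ' * ∫ ω, κ (U ω, X ω) ^ 2 ∂P) := by
  obtain ⟨C, hC⟩ := hY_bdd
  set D : ℝ := 1 + 2 ^ (2 + δ) * |m₀| ^ (2 + δ) with hD
  have hD0 : 0 ≤ D := by positivity
  refine ⟨D + 2 ^ (2 + δ) * max C 0, by positivity, fun κ M hκ hκM => ?_⟩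
  have hUX := hU.prodMk hX
  have hκ2 : ∀ a, |κ a ^ 2| ≤ M ^ 2 := fun a => by
    rw [abs_pow]; exact pow_le_pow_left₀ (abs_nonneg _) (hκM a) 2
  have hκi : Integrable (fun ω => κ (U ω, X ω) ^ 2) P :=
    Integrable.of_bound ((hκ.pow_const 2).comp hUX).aestronglyMeasurable (M ^ 2)
      (Eventually.of_forall fun ω => hκ2 (U ω, X ω))
  have hκY : Integrable (fun ω => κ (U ω, X ω) ^ 2 * |m (X ω) + ε ω| ^ (2 + δ)) P :=
    hY_int.bdd_mul ((hκ.pow_const 2).comp hUX).aestronglyMeasurable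
      (Eventually.of_forall fun ω => hκ2 (U ω, X ω))
  have h1 := integral_mul_le_mul_integral_of_condExp
    (h := fun w : χ × ℝ => |m w.1 + w.2| ^ (2 + δ)) hU hX hε hind
    (hκ.pow_const 2) hκ2 (fun a => sq_nonneg _)
    ((measurable_abs.comp ((hm.comp measurable_fst).add measurable_snd)).pow_const _) hY_int hC
  have hM : ∀ ω, 0 ≤ M := fun ω => (abs_nonneg _).trans (hκM (U ω, X ω))
  have hM0 : 0 ≤ M := by
    obtain ⟨ω⟩ := P.nonempty_of_neZero
    exact hM ω
  have hS0 : 0 ≤ ∫ ω, κ (U ω, X ω) ^ 2 ∂P := integral_nonneg fun ω => sq_nonneg _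
  calc ∫ ω, |κ (U ω, X ω) * (m (X ω) + ε ω - m₀)| ^ (2 + δ') ∂P
      ≤ ∫ ω, M ^ δ' * (D * κ (U ω, X ω) ^ 2 +
          2 ^ (2 + δ) * (κ (U ω, X ω) ^ 2 * |m (X ω) + ε ω| ^ (2 + δ))) ∂P := by
        refine integral_mono_of_nonneg (Eventually.of_forall fun ω => by positivity)
          (((hκi.const_mul _).add (hκY.const_mul _)).const_mul _)
          (Eventually.of_forall fun ω => ?_)
        simp only
        rw [abs_mul, Real.mul_rpow (abs_nonneg _) (abs_nonneg _)]
        have e1 : |κ (U ω, X ω)| ^ (2 + δ') ≤ M ^ δ' * κ (U ω, X ω) ^ 2 := by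
          rw [Real.rpow_add_of_nonneg (abs_nonneg _) zero_le_two hδ'.le, Real.rpow_two, sq_abs,
            mul_comm]
          gcongr
          exact hκM _
        have e2 := abs_sub_rpow_le_add (a := m (X ω) + ε ω) (b := m₀) (δ' := 2 + δ')
          (δ := 2 + δ) (by linarith) (by linarith)
        calc _ ≤ (M ^ δ' * κ (U ω, X ω) ^ 2) *
              (D + 2 ^ (2 + δ) * |m (X ω) + ε ω| ^ (2 + δ)) := by gcongr
          _ = _ := by ring
    _ = M ^ δ' * (D * ∫ ω, κ (U ω, X ω) ^ 2 ∂P +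
          2 ^ (2 + δ) * ∫ ω, κ (U ω, X ω) ^ 2 * |m (X ω) + ε ω| ^ (2 + δ) ∂P) := by
        rw [integral_const_mul, integral_add (hκi.const_mul _) (hκY.const_mul _),
          integral_const_mul, integral_const_mul]
    _ ≤ M ^ δ' * (D * ∫ ω, κ (U ω, X ω) ^ 2 ∂P +
          2 ^ (2 + δ) * (max C 0 * ∫ ω, κ (U ω, X ω) ^ 2 ∂P)) := by
        gcongr
        exact h1.trans (by gcongr; exact le_max_left _ _)
    _ = _ := by ring

end ConditionalMoments

/-! ### Growth rates of the truncation level and truncation bias. -/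

/-- The kernel bound is negligible with respect to `√n`. -/
theorem tendsto_kernelBound_div_sqrt {C b p γ : ℝ} (hC : 0 ≤ C) (hb : 0 < b) (hp : 0 < p)
    (hγ : 0 ≤ γ) (hpγ : p * γ < 1 / 2) {T : ℕ → ℝ} (hT0 : ∀ n : ℕ, 1 ≤ n → 0 ≤ T n)
    (hT : ∀ n : ℕ, 1 ≤ n → T n ≤ b * (n : ℝ) ^ p) :
    Tendsto (fun n : ℕ => C * (T n + 1) ^ γ / √(n : ℝ)) atTop (𝓝 0) := by
  have h0 : Tendsto (fun n : ℕ => C * (b + 1) ^ γ * (n : ℝ) ^ (-(1 / 2 - p * γ))) atTop (𝓝 0) := by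
    simpa using ((tendsto_rpow_neg_atTop (sub_pos.2 hpγ)).comp
      tendsto_natCast_atTop_atTop).const_mul (C * (b + 1) ^ γ)
  refine squeeze_zero' ?_ ?_ h0
  · filter_upwards [eventually_ge_atTop 1] with n hn
    have := hT0 n hn
    positivity
  · filter_upwards [eventually_ge_atTop 1] with n hn
    have hn0 : (0 : ℝ) < n := Nat.cast_pos.2 hn
    have hn1 : (1 : ℝ) ≤ n := Nat.one_le_cast.2 hn
    have hnp : 1 ≤ (n : ℝ) ^ p := Real.one_le_rpow hn1 hp.le
    have h1 : T n + 1 ≤ (b + 1) * (n : ℝ) ^ p := by have := hT n hn; linarith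
    have h2 := hT0 n hn
    calc C * (T n + 1) ^ γ / √(n : ℝ) ≤ C * ((b + 1) * (n : ℝ) ^ p) ^ γ / √(n : ℝ) := by gcongr
      _ = C * (b + 1) ^ γ * ((n : ℝ) ^ (p * γ) / (n : ℝ) ^ (1 / 2 : ℝ)) := by
        rw [Real.mul_rpow (by positivity) (by positivity), ← Real.rpow_mul hn0.le, Real.sqrt_eq_rpow]
        ring
      _ = _ := by rw [← Real.rpow_sub hn0]; congr 2; ring

/-- `√n T_n^{-4k}` is at most of the order of the standard deviation of the kernel. -/
theorem exists_sqrt_le_mul_rpow {a p : ℝ} (ha : 0 < a) {β : ℝ} (hβ : 0 ≤ β) {d k : ℕ} (hd : 1 ≤ d)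
    (hp : 1 / (2 * β + d + 8 * k) ≤ p) {T : ℕ → ℝ} (hT : ∀ n : ℕ, 1 ≤ n → a * (n : ℝ) ^ p ≤ T n) :
    ∃ K > 0, ∀ n : ℕ, 1 ≤ n → √(n : ℝ) ≤ K * ((T n) ^ (4 * k) * √((T n) ^ (2 * β + d))) := by
  set q : ℝ := 2 * β + d + 8 * k with hq
  have hd' : (1 : ℝ) ≤ d := Nat.one_le_cast.2 hd
  have hk0 : (0 : ℝ) ≤ k := Nat.cast_nonneg k
  have hq0 : 0 < q := by linarith
  refine ⟨(a ^ (q / 2))⁻¹, by positivity, fun n hn => ?_⟩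
  have hn0 : (0 : ℝ) < n := Nat.cast_pos.2 hn
  have hn1 : (1 : ℝ) ≤ n := Nat.one_le_cast.2 hn
  have hT0 : 0 < T n := lt_of_lt_of_le (by positivity) (hT n hn)
  have h1 : (T n) ^ (4 * k) * √((T n) ^ (2 * β + d)) = (T n) ^ (q / 2) := by
    rw [Real.sqrt_eq_rpow, ← Real.rpow_mul hT0.le, ← Real.rpow_natCast, ← Real.rpow_add hT0]
    congr 1; push_cast; rw [hq]; ring
  rw [h1, inv_mul_eq_div, le_div_iff₀ (by positivity), Real.sqrt_eq_rpow]
  have h2 : (1 : ℝ) / 2 ≤ p * (q / 2) := by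
    rw [div_le_iff₀ hq0] at hp; linarith
  calc (n : ℝ) ^ (1 / 2 : ℝ) * a ^ (q / 2) ≤ (n : ℝ) ^ (p * (q / 2)) * a ^ (q / 2) := by gcongr
    _ = (a * (n : ℝ) ^ p) ^ (q / 2) := by
      rw [Real.mul_rpow ha.le (by positivity), ← Real.rpow_mul hn0.le, mul_comm]
    _ ≤ _ := by gcongr; exact hT n hn

theorem IsHarmONB.integral_re_deconvKernel {d : ℕ} {B : HarmFamily d} (hB : IsHarmONB B)
    {Ω : Type*} [MeasurableSpace Ω] {P : Measure Ω} [IsProbabilityMeasure P] {X : Ω → USphere d}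
    {U : Ω → SOGroup d} {fX : USphere d → ℝ} {fU : SOGroup d → ℝ} (hX : Measurable X)
    (hU : Measurable U) (hindep : IndepFun U X P)
    (hfX : IsDensityOf fX (P.map X) (sphereMeasure d)) (hfU : IsDensityOf fU (P.map U) (haarSO d))
    (hinv : ∀ l, IsUnit (rotFourier B fU l)) {g : USphere d → ℝ} (hg : Continuous g) (T : ℝ)
    (x : USphere d) :
    ∫ ω, (deconvKernel B fU T x (rot (U ω) (X ω))).re * g (X ω) ∂P =
      (∑ l ∈ Finset.range (⌊T⌋₊ + 1), fourierLaplaceTerm B (fun y => g y * fX y) l x).re := by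
  rw [← hB.integral_deconvKernel hX hU hindep hfX hfU hinv hg T x]
  have hc : Continuous fun q : SOGroup d × USphere d =>
      deconvKernel B fU T x (rot q.1 q.2) * (g q.2 : ℂ) :=
    ((hB.continuous_deconvKernel fU T x).comp (continuous_rot d)).mul
      (Complex.continuous_ofReal.comp (hg.comp continuous_snd))
  obtain ⟨C, hC⟩ := exists_norm_le_of_continuous hc
  have hi : Integrable (fun ω => deconvKernel B fU T x (rot (U ω) (X ω)) * (g (X ω) : ℂ)) P :=
    Integrable.of_bound (hc.measurable.comp (hU.prodMk hX)).aestronglyMeasurable C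
      (Eventually.of_forall fun ω => hC (U ω, X ω))
  have h := integral_re hi
  simp only [RCLike.re_to_complex, Complex.re_mul_ofReal] at h
  exact h

theorem IsHarmONB.tendsto_pow_mul_re_remainder {d : ℕ} {B : HarmFamily d} (hB : IsHarmONB B)
    (hd : 1 ≤ d) {k : ℕ} (hk : (d : ℝ) / 4 < k) {f : USphere d → ℝ}
    (hf : ContMDiff (𝓡 d) 𝓘(ℝ, ℝ) ((2 * k : ℕ) : WithTop ℕ∞) f) (x : USphere d)
    (hs : Summable fun l => ‖fourierLaplaceTerm B (laplaceBeltrami^[k] f) l x‖) {T : ℕ → ℝ}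
    (hT : Tendsto T atTop atTop) :
    Tendsto (fun n => (T n) ^ (2 * k) *
      ((∑ l ∈ Finset.range (⌊T n⌋₊ + 1), fourierLaplaceTerm B f l x).re - f x)) atTop (𝓝 0) := by
  have h1 := (hB.tendsto_fourierLaplace_remainder hd hk (contDiffOn_radialExtension hf) x hs).comp
    ((tendsto_add_atTop_nat 1).comp (tendsto_nat_floor_atTop.comp hT))
  rw [tendsto_zero_iff_norm_tendsto_zero]
  refine squeeze_zero' (Eventually.of_forall fun n => norm_nonneg _) ?_ h1
  filter_upwards [hT.eventually_ge_atTop 0] with n hn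
  simp only [Function.comp_apply]
  rw [norm_mul, norm_pow, Real.norm_of_nonneg hn]
  gcongr
  -- The sum has `⌊T n⌋₊ + 1` terms, and that number is at least `T n`; this is why the integer rate
  -- transfers to the real level.
  · push_cast; exact (Nat.lt_floor_add_one _).le
  · have h2 := Complex.abs_re_le_norm
      (∑ l ∈ Finset.range (⌊T n⌋₊ + 1), fourierLaplaceTerm B f l x - (f x : ℂ))
    rwa [Complex.sub_re, Complex.ofReal_re] at h2

/-! ### The asymptotic normality of the regression estimator. -/

theorem mainTheorem3
    (d : ℕ) (hd : 1 ≤ d)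
    -- an orthonormal basis of each space of spherical harmonics
    (B : HarmFamily d) (hB : IsHarmONB B)
    -- the model `Y = m(X) + ε`, `Z = U X`
    {Ω : Type*} [MeasurableSpace Ω] (P : Measure Ω) [IsProbabilityMeasure P]
    (X : Ω → USphere d) (U : Ω → SOGroup d) (ε Y : Ω → ℝ) (Z : Ω → USphere d)
    (m fX : USphere d → ℝ) (fU : SOGroup d → ℝ)
    (hX : Measurable X) (hU : Measurable U) (hε : Measurable ε)
    (hY : ∀ ω, Y ω = m (X ω) + ε ω) (hZ : ∀ ω, Z ω = rot (U ω) (X ω))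
    (hε_int : Integrable ε P)
    (hε_mean : P[ε | MeasurableSpace.comap X inferInstance] =ᵐ[P] 0)
    (hindep : IndepFun U (fun ω => (X ω, ε ω)) P)
    (hfX : IsDensityOf fX (P.map X) (sphereMeasure d))
    (hfU : IsDensityOf fU (P.map U) (haarSO d)) (hfU2 : MemLp fU 2 (haarSO d))
    (hinv : ∀ l, IsUnit (rotFourier B fU l))
    -- i.i.d. observations with the law of `(Y, Z)`
    (Ys : ℕ → Ω → ℝ) (Zs : ℕ → Ω → USphere d)
    (hiid : iIndepFun (fun i ω => (Ys i ω, Zs i ω)) P)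
    (hlaw : ∀ i, IdentDistrib (fun ω => (Ys i ω, Zs i ω)) (fun ω => (Y ω, Z ω)) P P)
    -- ordinary smoothness of order `β` (upper bound)
    (β : ℝ) (hβ : 0 ≤ β)
    (hS1 : ∃ c₁ > 0, ∀ l : ℕ, 1 ≤ l → matOpNorm (rotFourier B fU l)⁻¹ ≤ c₁ * (l : ℝ) ^ β)
    -- smoothness of `f_X` and `m`; `f_X` is bounded away from zero
    (k : ℕ) (hk : (d : ℝ) / 4 < k)
    (hfX_smooth : ContMDiff (𝓡 d) 𝓘(ℝ, ℝ) ((2 * k : ℕ) : WithTop ℕ∞) fX)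
    (hm_smooth : ContMDiff (𝓡 d) 𝓘(ℝ, ℝ) ((2 * k : ℕ) : WithTop ℕ∞) m)
    (hfX_pos : ∃ c > 0, ∀ x, c ≤ fX x)
    -- the truncation levels
    (T : ℕ → ℝ) (p : ℝ) (hp_lower : 1 / (2 * β + d + 8 * k) ≤ p) (hp_upper : p < 1 / (2 * β + 2 * d))
    (hT : ∃ a > 0, ∃ b > 0, ∀ n : ℕ, 1 ≤ n → a * (n : ℝ) ^ p ≤ T n ∧ T n ≤ b * (n : ℝ) ^ p)
    -- lower bound on the second moment of the kernel
    (hB1 : ∀ x, ∃ c > 0, ∀ n : ℕ, 1 ≤ n →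
      c * (T n) ^ (2 * β + d) ≤ ∫ ω, (deconvKernel B fU (T n) x (Z ω)).re ^ 2 ∂P)
    -- conditional moments
    (δ : ℝ) (hδ : 0 < δ) (hY_int : Integrable (fun ω => |Y ω| ^ (2 + δ)) P)
    (hY_bdd : ∃ C : ℝ, ∀ᵐ ω ∂P,
      (P[fun ω' => |Y ω'| ^ (2 + δ) | MeasurableSpace.comap X inferInstance]) ω ≤ C)
    (hε_var : ∃ c > 0, ∀ᵐ ω ∂P,
      c ≤ (P[fun ω' => ε ω' ^ 2 | MeasurableSpace.comap X inferInstance]) ω)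
    -- absolute convergence of the Fourier-Laplace series of `Δ^k f_X` and `Δ^k (m f_X)`
    (hser_fX : ∀ x, Summable fun l => ‖fourierLaplaceTerm B (laplaceBeltrami^[k] fX) l x‖)
    (hser_mfX : ∀ x, Summable fun l =>
      ‖fourierLaplaceTerm B (laplaceBeltrami^[k] fun y => m y * fX y) l x‖)
    (x : USphere d) :
    TendstoInDistribution
      (fun (n : ℕ) (ω : Ω) =>
        √(n : ℝ) *
          ((regressionEstimator B fU (T n) n (fun i => Ys i ω) (fun i => Zs i ω) x - m x -
              (∫ ω', (deconvKernel B fU (T n) x (Z ω')).re * (Y ω' - m x) ∂P) / fX x) /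
            (√(Var[fun ω' => (deconvKernel B fU (T n) x (Z ω')).re * (Y ω' - m x); P]) / fX x)))
      atTop (id : ℝ → ℝ) (fun _ => P) (gaussianReal 0 1) := by
  obtain rfl : Y = fun ω => m (X ω) + ε ω := funext hY
  obtain rfl : Z = fun ω => rot (U ω) (X ω) := funext hZ
  obtain ⟨a, ha, b, hb, hTab⟩ := hT
  have hd' : (1 : ℝ) ≤ d := Nat.one_le_cast.2 hd
  have hp : 0 < p := lt_of_lt_of_le (by positivity) hp_lower
  have hTlow : ∀ n : ℕ, 1 ≤ n → a * (n : ℝ) ^ p ≤ T n := fun n hn => (hTab n hn).1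
  have hT0 : ∀ n : ℕ, 1 ≤ n → 0 < T n := fun n hn =>
    lt_of_lt_of_le (mul_pos ha (Real.rpow_pos_of_pos (Nat.cast_pos.2 hn) _)) (hTlow n hn)
  have hTtop : Tendsto T atTop atTop := by
    refine tendsto_atTop_mono' atTop ?_
      (((tendsto_rpow_atTop hp).comp tendsto_natCast_atTop_atTop).const_mul_atTop ha)
    filter_upwards [eventually_ge_atTop 1] with n hn using hTlow n hn
  have hTk : ∀ {r : ℕ → ℝ}, Tendsto (fun n => (T n) ^ (2 * k) * r n) atTop (𝓝 0) →
      Tendsto r atTop (𝓝 0) := fun {r} hr => by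
    refine squeeze_zero_norm' ?_ (tendsto_zero_iff_norm_tendsto_zero.1 hr)
    filter_upwards [hTtop.eventually_ge_atTop 1] with n hn
    rw [norm_mul, norm_pow, Real.norm_of_nonneg (zero_le_one.trans hn)]
    exact le_mul_of_one_le_left (norm_nonneg _) (one_le_pow₀ hn)
  have hmc : Continuous m := hm_smooth.continuous
  obtain ⟨G, hG⟩ : ∃ G, ∀ y, |m y - m x| ≤ G := by
    obtain ⟨G, hG⟩ := (isCompact_range (hmc.sub (continuous_const (y := m x))).abs).bddAbove
    exact ⟨G, fun y => hG ⟨y, rfl⟩⟩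
  have hindep' : IndepFun U X P := hindep.comp measurable_id measurable_fst
  -- the kernel
  set κ : ℕ → USphere d → ℝ := fun n z => (deconvKernel B fU (T n) x z).re with hκdef
  have hκc : ∀ n, Continuous (κ n) := fun n =>
    Complex.continuous_re.comp (hB.continuous_deconvKernel fU (T n) x)
  have hκrot : ∀ n, Continuous fun q : SOGroup d × USphere d => κ n (rot q.1 q.2) := fun n =>
    (hκc n).comp (continuous_rot d)
  have hκrm : ∀ n, Measurable fun q : SOGroup d × USphere d => κ n (rot q.1 q.2) := fun n =>
    (hκrot n).measurable
  have hZm : Measurable fun ω => rot (U ω) (X ω) :=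
    (continuous_rot d).measurable.comp (hU.prodMk hX)
  have hκbdd : ∀ n, ∃ C, ∀ z, |κ n z| ≤ C := fun n => by
    obtain ⟨C, hC⟩ := (isCompact_range (hκc n).abs).bddAbove
    exact ⟨C, fun y => hC ⟨y, rfl⟩⟩
  obtain ⟨C, hC0, hC⟩ := hB.norm_deconvKernel_le hd (fU := fU) hβ hS1
  set M : ℕ → ℝ := fun n => C * (T n + 1) ^ (β + d) with hM
  have hκM : ∀ n : ℕ, 1 ≤ n → ∀ z, |κ n z| ≤ M n := fun n hn z =>
    (Complex.abs_re_le_norm _).trans (hC (T n) (hT0 n hn).le x z)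
  have hM0 : ∀ n : ℕ, 1 ≤ n → 0 ≤ M n := fun n hn => (abs_nonneg _).trans (hκM n hn x)
  have hMlim : Tendsto (fun n : ℕ => M n / √(n : ℝ)) atTop (𝓝 0) := by
    refine tendsto_kernelBound_div_sqrt hC0.le hb hp (by positivity) ?_ (fun n hn => (hT0 n hn).le)
      fun n hn => (hTab n hn).2
    -- The upper bound on `p` says `p (β + d) < 1/2`, precisely the condition for the sup norm of
    -- the kernel to be `o(√n)`.
    rw [lt_div_iff₀ (by positivity)] at hp_upper
    linarith
  -- moments
  have hδ2 : (0 : ℝ) < 2 + δ := by linarith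
  -- The cubic Taylor remainder behind the central limit theorem limits the extra moment exponent to
  -- one.
  set δ' := min δ 1 with hδ'def
  have hδ' : 0 < δ' := lt_min hδ one_pos
  have hYm : Measurable fun ω => m (X ω) + ε ω := (hmc.measurable.comp hX).add hε
  have hYL : MemLp (fun ω => m (X ω) + ε ω) (ENNReal.ofReal (2 + δ)) P := by
    refine (integrable_norm_rpow_iff hYm.aestronglyMeasurable (by simpa using hδ2)
      ENNReal.ofReal_ne_top).1 ?_
    rw [ENNReal.toReal_ofReal hδ2.le]
    exact hY_int
  have hYL' : MemLp (fun ω => m (X ω) + ε ω) (ENNReal.ofReal (2 + δ')) P :=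
    hYL.mono_exponent (ENNReal.ofReal_le_ofReal (by linarith [min_le_left δ 1]))
  have hmXL : ∀ q, MemLp (fun ω => m (X ω)) q P := fun q => by
    obtain ⟨D, hD⟩ := (isCompact_range hmc.abs).bddAbove
    exact MemLp.of_bound (hmc.measurable.comp hX).aestronglyMeasurable D
      (Eventually.of_forall fun ω => hD ⟨X ω, rfl⟩)
  have hε2 : MemLp ε 2 P := by
    have h1 : MemLp (fun ω => m (X ω) + ε ω) 2 P := hYL.mono_exponent (by
      rw [← ENNReal.ofReal_ofNat 2]; exact ENNReal.ofReal_le_ofReal (by linarith))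
    refine (h1.sub (hmXL 2)).ae_eq (Eventually.of_forall fun ω => ?_)
    simp
  have hWL : ∀ n, MemLp (fun ω => κ n (rot (U ω) (X ω)) * (m (X ω) + ε ω - m x))
      (ENNReal.ofReal (2 + δ')) P := fun n => by
    obtain ⟨D, hD⟩ := hκbdd n
    refine (hYL'.sub (memLp_const (m x))).of_le_mul (c := D) (((hκc n).measurable.comp hZm).mul
      (hYm.sub_const _)).aestronglyMeasurable (Eventually.of_forall fun ω => ?_)
    rw [norm_mul]
    exact mul_le_mul_of_nonneg_right (hD _) (norm_nonneg _)
  have hWL2 : ∀ n, MemLp (fun ω => κ n (rot (U ω) (X ω)) * (m (X ω) + ε ω - m x)) 2 P := fun n =>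
    (hWL n).mono_exponent (by
      rw [← ENNReal.ofReal_ofNat 2]; exact ENNReal.ofReal_le_ofReal (by linarith))
  have hκL : ∀ n, MemLp (fun ω => κ n (rot (U ω) (X ω))) 2 P := fun n => by
    obtain ⟨D, hD⟩ := hκbdd n
    exact MemLp.of_bound ((hκc n).measurable.comp hZm).aestronglyMeasurable D
      (Eventually.of_forall fun ω => hD _)
  set S : ℕ → ℝ := fun n => ∫ ω, κ n (rot (U ω) (X ω)) ^ 2 ∂P with hS
  set μ : ℕ → ℝ := fun n => ∫ ω, κ n (rot (U ω) (X ω)) * (m (X ω) + ε ω - m x) ∂P with hμ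
  set v : ℕ → ℝ := fun n =>
    Var[fun ω => κ n (rot (U ω) (X ω)) * (m (X ω) + ε ω - m x); P] with hv
  set bias : ℕ → ℝ := fun n => ∫ ω, κ n (rot (U ω) (X ω)) ∂P - fX x with hbias
  -- biases
  have hbiasT : Tendsto (fun n => (T n) ^ (2 * k) * bias n) atTop (𝓝 0) := by
    have h := hB.tendsto_pow_mul_re_remainder hd hk hfX_smooth x (hser_fX x) hTtop
    refine h.congr fun n => ?_
    have h1 := hB.integral_re_deconvKernel hX hU hindep' hfX hfU hinv (g := fun _ => 1)
      continuous_const (T n) x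
    simp only [mul_one, one_mul] at h1
    simp only [hbias, hκdef, h1]
  have hμT : Tendsto (fun n => (T n) ^ (2 * k) * μ n) atTop (𝓝 0) := by
    have hmf : ContMDiff (𝓡 d) 𝓘(ℝ, ℝ) ((2 * k : ℕ) : WithTop ℕ∞) fun y => m y * fX y :=
      hm_smooth.mul hfX_smooth
    have h := hB.tendsto_pow_mul_re_remainder hd hk hmf x (hser_mfX x) hTtop
    -- `μ n` is the remainder for `m f_X` minus `m x` times the remainder for `f_X`; the limits `m x
    -- * fX x` cancel.
    have h' := h.sub (hbiasT.const_mul (m x))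
    simp only [mul_zero, sub_zero] at h'
    refine h'.congr fun n => ?_
    have h1 := hB.integral_re_deconvKernel hX hU hindep' hfX hfU hinv hmc (T n) x
    obtain ⟨D, hD⟩ := hκbdd n
    have h2 := integral_kernel_mul_eq hU hX hε hindep (hκrm n) (fun q => hD _) hε_int hε_mean
      (g := fun y => m y - m x) (hmc.measurable.sub_const _) hG
    have h3 : μ n = ∫ ω, κ n (rot (U ω) (X ω)) * (m (X ω) - m x) ∂P := by
      rw [← h2]
      exact integral_congr_ae (Eventually.of_forall fun ω => by simp only; ring)
    have h4 : ∫ ω, κ n (rot (U ω) (X ω)) * (m (X ω) - m x) ∂P =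
        ∫ ω, κ n (rot (U ω) (X ω)) * m (X ω) ∂P - (∫ ω, κ n (rot (U ω) (X ω)) ∂P) * m x := by
      have hi : Integrable (fun ω => κ n (rot (U ω) (X ω)) * m (X ω)) P :=
        ((hmXL 2).integrable one_le_two).bdd_mul (c := D)
        ((hκc n).measurable.comp hZm).aestronglyMeasurable (Eventually.of_forall fun ω => hD _)
      simp_rw [mul_sub]
      rw [integral_sub hi (((hκL n).integrable one_le_two).mul_const _), integral_mul_const]
    rw [h3, h4, h1]
    simp only [hbias]
    ring
  have hbias0 := hTk hbiasT
  have hμ0 := hTk hμT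
  -- second moments
  obtain ⟨cS, hcS, hSlow⟩ := hB1 x
  have hSlow' : ∀ n : ℕ, 1 ≤ n → cS * (T n) ^ (2 * β + d) ≤ S n := hSlow
  have hStop : Tendsto S atTop atTop := by
    refine tendsto_atTop_mono' atTop ?_ (((tendsto_rpow_atTop (y := 2 * β + d)
      (by positivity)).comp hTtop).const_mul_atTop hcS)
    filter_upwards [eventually_ge_atTop 1] with n hn using hSlow' n hn
  have hSM : ∀ n : ℕ, 1 ≤ n → S n ≤ M n ^ 2 := fun n hn => by
    have h1 : ∀ ω, κ n (rot (U ω) (X ω)) ^ 2 ≤ M n ^ 2 := fun ω => by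
      rw [← sq_abs]; exact pow_le_pow_left₀ (abs_nonneg _) (hκM n hn _) 2
    simpa using integral_mono (hκL n).integrable_sq (integrable_const _) h1
  have hSn : Tendsto (fun n : ℕ => S n / n) atTop (𝓝 0) := by
    refine squeeze_zero' (Eventually.of_forall fun n =>
      div_nonneg (integral_nonneg fun ω => sq_nonneg _) (Nat.cast_nonneg n)) ?_
      (by simpa using hMlim.pow 2)
    filter_upwards [eventually_ge_atTop 1] with n hn
    rw [div_pow, Real.sq_sqrt (Nat.cast_nonneg n)]
    gcongr
    exact hSM n hn
  -- variances
  obtain ⟨c₀, hc₀, hε_var⟩ := hε_var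
  -- The second moment of `W n` is at least `c₀ S n`. Subtracting `μ n ^ 2 ≤ c₀ / 2` costs at most
  -- half of it once `S n ≥ 1`.
  have hvS : ∀ᶠ n in atTop, c₀ / 2 * S n ≤ v n := by
    have hμsq : ∀ᶠ n in atTop, μ n ^ 2 ≤ c₀ / 2 := by
      have h1 := hμ0.pow 2
      simp only [ne_eq, OfNat.ofNat_ne_zero, not_false_eq_true, zero_pow] at h1
      filter_upwards [h1.eventually_lt_const (half_pos hc₀)] with n hn using hn.le
    filter_upwards [hμsq, hStop.eventually_ge_atTop 1] with n h1 h2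
    obtain ⟨D, hD⟩ := hκbdd n
    have h3 := mul_integral_sq_le_integral_sq hU hX hε hindep (hκrm n) (fun q => hD _) hε2 hε_mean
      hε_var (g := fun y => m y - m x) (hmc.measurable.sub_const _) hG
    have h4 := variance_eq_sub (hWL2 n)
    have h5 : ∫ ω, (κ n (rot (U ω) (X ω)) * (m (X ω) - m x + ε ω)) ^ 2 ∂P =
        P[(fun ω => κ n (rot (U ω) (X ω)) * (m (X ω) + ε ω - m x)) ^ 2] :=
      integral_congr_ae (Eventually.of_forall fun ω => by simp only [Pi.pow_apply]; ring)
    have h6 : c₀ * S n ≤ v n + μ n ^ 2 := by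
      simp only [hv, hμ]
      rw [h4, ← h5]
      linarith
    nlinarith
  have hvlow : ∀ᶠ n in atTop, c₀ / 2 ≤ v n := by
    filter_upwards [hvS, hStop.eventually_ge_atTop 1] with n h1 h2
    nlinarith
  refine tendstoInDistribution_ratio hiid hlaw (κ := κ) (fun n => (hκc n).measurable) hκL
    (f₀ := fX x) (m₀ := m x) ?_ hδ' (min_le_right _ _) hWL (half_pos hc₀) (half_pos hc₀) hvlow hvS
    hμ0 ?_ hSn hbias0 ?_
  · obtain ⟨c, hc, h⟩ := hfX_pos
    exact hc.trans_le (h x)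
  -- Lyapunov's condition: since `S n / v n` is bounded and `v n` is bounded below, the ratio is at
  -- most a constant times `(M n / √n) ^ δ'`.
  · obtain ⟨K, hK0, hK⟩ := exists_integral_abs_rpow_le hU hX hε hindep hmc.measurable hδ'
      (min_le_left δ 1) hY_int hY_bdd (m x)
    have hup : Tendsto (fun n : ℕ => K * (c₀ / 2)⁻¹ * (√(c₀ / 2) ^ δ')⁻¹ *
        (M n / √(n : ℝ)) ^ δ') atTop (𝓝 0) := by
      have h1 := hMlim.rpow_const (p := δ') (Or.inr hδ'.le)
      rw [Real.zero_rpow hδ'.ne'] at h1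
      simpa using h1.const_mul (K * (c₀ / 2)⁻¹ * (√(c₀ / 2) ^ δ')⁻¹)
    refine squeeze_zero' (Eventually.of_forall fun n => mul_nonneg (by positivity)
      (div_nonneg (integral_nonneg fun ω => by positivity) (by positivity))) ?_ hup
    filter_upwards [hvS, hvlow, eventually_ge_atTop 1] with n h1 h2 hn
    have h3 := hK _ (M n) (hκrm n) fun q => hκM n hn _
    have hv0 : 0 < v n := (half_pos hc₀).trans_le h2
    have hs0 : 0 < √(v n) := Real.sqrt_pos.2 hv0
    have hMn := hM0 n hn
    have e1 : √(v n) ^ (2 + δ') = v n * √(v n) ^ δ' := by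
      rw [Real.rpow_add hs0, Real.rpow_two, Real.sq_sqrt hv0.le]
    have e2 : S n / v n ≤ (c₀ / 2)⁻¹ := by
      rw [div_le_iff₀ hv0, inv_mul_eq_div, le_div_iff₀ (half_pos hc₀), mul_comm]
      exact h1
    have e3 : √(c₀ / 2) ^ δ' ≤ √(v n) ^ δ' := by gcongr
    have e4 : 0 < √(c₀ / 2) ^ δ' := Real.rpow_pos_of_pos (Real.sqrt_pos.2 (half_pos hc₀)) _
    calc _ ≤ (√(n : ℝ))⁻¹ ^ δ' * (K * (M n ^ δ' * S n) / √(v n) ^ (2 + δ')) := by gcongr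
      _ = K * (S n / v n) * (√(v n) ^ δ')⁻¹ * (M n / √(n : ℝ)) ^ δ' := by
        rw [e1, div_eq_mul_inv (M n), Real.mul_rpow hMn (by positivity)]
        field_simp
      _ ≤ _ := by gcongr
  -- The two remainders supply `o(T^(-4k))`, the lower bound on `p` gives `√n ≤ K T^(4k)
  -- √(T^(2β+d))`, and the last root is absorbed by `√(v n)`.
  · obtain ⟨K, hK0, hK⟩ := exists_sqrt_le_mul_rpow ha hβ hd hp_lower hTlow
    have hup : Tendsto (fun n => K / √(c₀ / 2 * cS) *
        (|(T n) ^ (2 * k) * μ n| * |(T n) ^ (2 * k) * bias n|)) atTop (𝓝 0) := by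
      simpa using (hμT.abs.mul hbiasT.abs).const_mul (K / √(c₀ / 2 * cS))
    refine squeeze_zero_norm' ?_ hup
    filter_upwards [hvS, eventually_ge_atTop 1] with n h1 hn
    have hTn := hT0 n hn
    have h2 : √(c₀ / 2 * cS) * √((T n) ^ (2 * β + d)) ≤ √(v n) := by
      rw [← Real.sqrt_mul (by positivity)]
      refine Real.sqrt_le_sqrt (le_trans ?_ h1)
      rw [mul_assoc]
      have := hSlow' n hn
      gcongr
    have h3 : 0 < √((T n) ^ (2 * β + d)) := Real.sqrt_pos.2 (Real.rpow_pos_of_pos hTn _)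
    have h4 : 0 < √(c₀ / 2 * cS) := Real.sqrt_pos.2 (by positivity)
    change ‖√(n : ℝ) * μ n * bias n / √(v n)‖ ≤ _
    rw [norm_div, norm_mul, norm_mul, Real.norm_of_nonneg (Real.sqrt_nonneg _),
      Real.norm_of_nonneg (Real.sqrt_nonneg _), Real.norm_eq_abs, Real.norm_eq_abs,
      abs_mul, abs_mul, abs_of_pos (pow_pos hTn _)]
    calc √(n : ℝ) * |μ n| * |bias n| / √(v n)
        ≤ K * ((T n) ^ (4 * k) * √((T n) ^ (2 * β + d))) * |μ n| * |bias n| /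
          (√(c₀ / 2 * cS) * √((T n) ^ (2 * β + d))) := by gcongr; exact hK n hn
      _ = _ := by
        have : (T n) ^ (4 * k) = (T n) ^ (2 * k) * (T n) ^ (2 * k) := by
          rw [← pow_add]; congr 1; omega
        rw [this]; field_simp
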